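/- Consider the $\pi$-calculus with service-oriented sessions, with processes $$P ::= \mathbf 0 \mid P\,|\,Q \mid (\nu k)P \mid {!a}(k).P \mid a(k).P \mid \overline a(k).P \mid \mathsf{if}\ e\ \mathsf{then}\ P\ \mathsf{else}\ Q \mid k?(x).P \mid k!\langle e\rangle.P \mid k?((k')).P \mid k!\langle\langle k'\rangle\rangle.P \mid k\triangleright\{l_i:P_i\}_{i\in I} \mid k\triangleleft l.P$$ where $a,x$ are public names (service channels, data variables), $k,k'$ are session channels, and $e$ are first-order expressions over a many-sorted algebra with truth values, inhabited basic types and total operations. All forms but the first three are called prefixes. The bound names are $k$ in $(\nu k)P$, $!a(k).P$ (replicated service), $a(k).P$ (service) and $\overline a(k).P$ (request), $x$ in $k?(x).P$, and $k'$ in $k?((k')).P$. Structural congruence $\equiv$ is the least congruence containing $\alpha$-equivalence, commutativity and associativity of $|$, $P\,|\,\mathbf 0\equiv P$, $(\nu k)\mathbf 0\equiv\mathbf 0$, and $P\,|\,(\nu k)Q\equiv(\nu k)(P\,|\,Q)$ for $k$ not free in $P$. Reduction $\to$ is the least relation closed under $\equiv$, $\,\cdot\,|\,Q$ and $(\nu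 k)\,\cdot$ with $$\begin{array}{ll} !a(k).P\,|\,\overline a(k).Q\to{!a}(k).P\,|\,(\nu k)(P\,|\,Q), & a(k).P\,|\,\overline a(k).Q\to(\nu k)(P\,|\,Q),\\ k?(x).P\,|\,k!\langle e\rangle.Q\to P[v/x]\,|\,Q\ \ (e\Downarrow v), & k?((k')).P\,|\,k!\langle\langle k'\rangle\rangle.Q\to P\,|\,Q,\\ k\triangleright\{l_i:P_i\}_{i\in I}\,|\,k\triangleleft l_j.Q\to P_j\,|\,Q\ \ (j\in I), & \mathsf{if}\ e\ \mathsf{then}\ P\ \mathsf{else}\ Q\to P\ (e\Downarrow\mathsf{true}),\ \ \to Q\ (e\Downarrow\mathsf{false}). \end{array}$$ Session types are $\alpha::=\ ?(\theta).\alpha\mid{!(\theta)}.\alpha\mid\&\{l_i:\alpha_i\}_{i\in I}\mid\oplus\{l_i:\alpha_i\}_{i\in I}\mid\mathsf{end}$ with $I$ finite and non-empty, $\theta::=S\mid\alpha$, and $S::=b\mid\langle\alpha\rangle$ with $b$ a basic type; $\overline\alpha$ is the dual type. A service typing $\Gamma$ maps finitely many public names to types $S$; a session typing $\Delta$ maps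 finitely many session channels to session types or to $\bot$. Typing $\Gamma\vdash P\triangleright\Delta$ is given by the following rules, where $\Delta\cdot k{:}\alpha$ presupposes $k\notin\mathrm{dom}(\Delta)$, a session typing is *ended* if all its entries are $\mathsf{end}$, and processes are taken up to $\alpha$-equivalence: * if $\Delta$ is ended, then $\Gamma\vdash\mathbf 0\triangleright\Delta$; * if $\Gamma(a)=\langle\alpha\rangle$, $\Gamma\vdash P\triangleright k{:}\alpha$ and $\Delta$ is ended, then $\Gamma\vdash a(k).P\triangleright\Delta$ and $\Gamma\vdash{!a}(k).P\triangleright\Delta$; * if $\Gamma(a)=\langle\alpha\rangle$ and $\Gamma\vdash P\triangleright\Delta\cdot k{:}\overline\alpha$, then $\Gamma\vdash\overline a(k).P\triangleright\Delta$; * if $\Gamma,x{:}S\vdash P\triangleright\Delta\cdot k{:}\alpha$, then $\Gamma\vdash k?(x).P\triangleright\Delta\cdot k{:}?(S).\alpha$; * if $\Gamma\vdash P\triangleright\Delta\cdot k{:}\alpha$ and $\Gamma\vdash e:S$, then $\Gamma\vdash k!\langle e\rangle.P\triangleright\Delta\cdot k{:}!(S).\alpha$; * if $\Gamma\vdash P\triangleright\Delta\cdot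 k{:}\alpha\cdot k'{:}\beta$, then $\Gamma\vdash k?((k')).P\triangleright\Delta\cdot k{:}?(\beta).\alpha$; * if $\Gamma\vdash P\triangleright\Delta\cdot k{:}\alpha$, then $\Gamma\vdash k!\langle\langle k'\rangle\rangle.P\triangleright\Delta\cdot k{:}!(\beta).\alpha\cdot k'{:}\beta$; * if $\Gamma\vdash P_i\triangleright\Delta\cdot k{:}\alpha_i$ for all $i\in I$, then $\Gamma\vdash k\triangleright\{l_i:P_i\}_{i\in I}\triangleright\Delta\cdot k{:}\&\{l_i:\alpha_i\}_{i\in I}$; * if $\Gamma\vdash P\triangleright\Delta\cdot k{:}\alpha_j$ and $j\in I$, then $\Gamma\vdash k\triangleleft l_j.P\triangleright\Delta\cdot k{:}\oplus\{l_i:\alpha_i\}_{i\in I}$; * if $\Gamma\vdash P_i\triangleright\Delta_i$ ($i=1,2$) and $\Delta_1(k)=\overline{\Delta_2(k)}$ (session types, not $\bot$) for all common $k$, then $\Gamma\vdash P_1\,|\,P_2\triangleright\Delta$, where $\Delta$ is the union of $\Delta_1,\Delta_2$ with every common channel reset to $\bot$; * if $\Gamma\vdash P\triangleright\Delta\cdot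 k{:}\bot$, then $\Gamma\vdash(\nu k)P\triangleright\Delta$; * if $\Gamma\vdash e:\mathsf{bool}$ and $\Gamma\vdash P_i\triangleright\Delta$ ($i=1,2$), then $\Gamma\vdash\mathsf{if}\ e\ \mathsf{then}\ P_1\ \mathsf{else}\ P_2\triangleright\Delta$; * if $\Gamma\vdash P\triangleright\Delta\cdot k{:}\mathsf{end}$, then $\Gamma\vdash P\triangleright\Delta\cdot k{:}\bot$. $P$ is *well-typed* if $\Gamma\vdash P\triangleright\Delta$ for some $\Gamma,\Delta$ where $\Gamma$ assigns only service types $\langle\alpha\rangle$ (so $P$ has no free data variables). A *program* is a process without free session channels that is structurally congruent to a process without sub-terms of the form $(\nu k)Q$. The *session dependency graph* of a process is the labelled undirected multigraph defined by: $\mathbf 0$ has the empty graph; a prefix $\gamma$ has one node, labelled with the set of free session channels of $\gamma$; $(\nu k)P$ has the graph of $P$ with $k$ removed from all labels; $P\,|\,Q$ has the disjoint union of both graphs plus one edge between $p$ and $q$ for every node $p$ of $P$, node $q$ of $Q$ and common label $k$ of $p$ and $q$. $P$ is *transparent* if the graph of every sub-term of every $P'\equiv P$ is acyclic. A process *contains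 live channels* if some session channel occurring in it is not bound by a service or a replicated service (the channel that a request or a session input binds always counts as occurring; a restriction $(\nu k)P$ with $k$ not free in $P$ does not count as an occurrence of $k$). *Reduction contexts* are $E::=[\cdot]\mid E\,|\,P\mid(\nu k)E$. *Progress* is the largest predicate such that, if $P$ has progress, then whenever $P\to^*P'$, $P'\equiv E[P'']$ and $P''$ contains live channels, there are processes $Q$ and $R$ with (a) $Q\not\to$; (b) $P''\,|\,Q$ is well-typed; (c) $P''\,|\,Q\to R$; and (d) $R$ has progress. **Theorem.** Every well-typed program is transparent and has progress. -/

import Mathlib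

namespace SessPi

/-! Conventions. Processes are represented with de Bruijn indices, so that alpha-equivalent
processes are equal. There are two separate name spaces, both indexed by natural numbers: session
channels (bound by restriction, service, replicated service, request and session input) and public
names, i.e. service channels and data variables (bound by value input only). A free name of a
process is an index that points beyond all enclosing binders of its name space. -/

/-! ### Data -/

/-- The first-order data the processes compute with: a many-sorted algebra with a sort of truth
values. All basic types are inhabited and all operations are total. -/
structure DataAlgebra where
  /-- basic types -/
  Base : Type
  /-- values of each basic type -/
  Carrier : Base → Type
  inhabited : ∀ b, Nonempty (Carrier b)
  /-- the basic type of truth values -/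
  bool : Base
  truth : Carrier bool ≃ Bool
  /-- operation symbols, with argument types, result type and meaning -/
  Op : Type
  arity : Op → ℕ
  dom : ∀ f, Fin (arity f) → Base
  cod : Op → Base
  interp : ∀ f, (∀ i, Carrier (dom f i)) → Carrier (cod f)

/-- Expressions: public names, constants, and operations applied to expressions. -/
inductive Expr (D : DataAlgebra) : Type
  | name (x : ℕ)
  | lit (b : D.Base) (v : D.Carrier b)
  | op (f : D.Op) (args : Fin (D.arity f) → Expr D)

/-- Values: service channels and constants. -/
inductive Val (D : DataAlgebra) : Type
  | chan (a : ℕ)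
  | lit (b : D.Base) (v : D.Carrier b)

variable {D : DataAlgebra}

/-- Evaluation `e ⇓ v`. -/
inductive Eval : Expr D → Val D → Prop
  | name (a : ℕ) : Eval (.name a) (.chan a)
  | lit (b : D.Base) (v : D.Carrier b) : Eval (.lit b v) (.lit b v)
  | op (f : D.Op) (args : Fin (D.arity f) → Expr D) (v : ∀ i, D.Carrier (D.dom f i)) :
      (∀ i, Eval (args i) (.lit (D.dom f i) (v i))) →
      Eval (.op f args) (.lit (D.cod f) (D.interp f v))

/-! ### Processes -/

/-- Processes. Comments show the named syntax. The families of branches are indexed by a finite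
set of labels. -/
inductive Proc (D : DataAlgebra) : Type
  /-- `0` -/
  | nil
  /-- `P | Q` -/
  | par (P Q : Proc D)
  /-- `(ν k) P`; binds session channel `k` -/
  | res (P : Proc D)
  /-- `!a(k).P`, replicated service; binds session channel `k` -/
  | rserv (a : ℕ) (P : Proc D)
  /-- `a(k).P`, service; binds session channel `k` -/
  | serv (a : ℕ) (P : Proc D)
  /-- `ā(k).P`, request; binds session channel `k` -/
  | req (a : ℕ) (P : Proc D)
  /-- `if e then P else Q` -/
  | cond (e : Expr D) (P Q : Proc D)
  /-- `k?(x).P`; binds public name `x` -/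
  | inp (k : ℕ) (P : Proc D)
  /-- `k!⟨e⟩.P` -/
  | out (k : ℕ) (e : Expr D) (P : Proc D)
  /-- `k?((k')).P`, session input; binds session channel `k'` -/
  | inS (k : ℕ) (P : Proc D)
  /-- `k!⟨⟨k'⟩⟩.P`, delegation -/
  | del (k k' : ℕ) (P : Proc D)
  /-- `k ▷ {l : P_l}` for `l` in `I` -/
  | bra (k : ℕ) (I : Finset ℕ) (P : {l // l ∈ I} → Proc D)
  /-- `k ◁ l.P` -/
  | sel (k : ℕ) (l : ℕ) (P : Proc D)

/-- Extends a family indexed by names with an entry for a newly bound name. -/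
def cons {α : Type} (x : α) (f : ℕ → α) : ℕ → α
  | 0 => x
  | n + 1 => f n

/-- Free session channels. -/
def Proc.fsc : Proc D → Set ℕ
  | .nil => ∅
  | .par P Q => P.fsc ∪ Q.fsc
  | .res P => {n | n + 1 ∈ P.fsc}
  | .rserv _ P => {n | n + 1 ∈ P.fsc}
  | .serv _ P => {n | n + 1 ∈ P.fsc}
  | .req _ P => {n | n + 1 ∈ P.fsc}
  | .cond _ P Q => P.fsc ∪ Q.fsc
  | .inp k P => {k} ∪ P.fsc
  | .out k _ P => {k} ∪ P.fsc
  | .inS k P => {k} ∪ {n | n + 1 ∈ P.fsc}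
  | .del k k' P => {k, k'} ∪ P.fsc
  | .bra k _ P => {k} ∪ ⋃ i, (P i).fsc
  | .sel k _ P => {k} ∪ P.fsc

/-- Lifts a renaming below a binder. -/
def liftRen (ρ : ℕ → ℕ) : ℕ → ℕ := cons 0 (fun n => ρ n + 1)

/-- Renaming of free session channels. -/
def Proc.ren : (ℕ → ℕ) → Proc D → Proc D
  | _, .nil => .nil
  | ρ, .par P Q => .par (P.ren ρ) (Q.ren ρ)
  | ρ, .res P => .res (P.ren (liftRen ρ))
  | ρ, .rserv a P => .rserv a (P.ren (liftRen ρ))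
  | ρ, .serv a P => .serv a (P.ren (liftRen ρ))
  | ρ, .req a P => .req a (P.ren (liftRen ρ))
  | ρ, .cond e P Q => .cond e (P.ren ρ) (Q.ren ρ)
  | ρ, .inp k P => .inp (ρ k) (P.ren ρ)
  | ρ, .out k e P => .out (ρ k) e (P.ren ρ)
  | ρ, .inS k P => .inS (ρ k) (P.ren (liftRen ρ))
  | ρ, .del k k' P => .del (ρ k) (ρ k') (P.ren ρ)
  | ρ, .bra k I P => .bra (ρ k) I (fun i => (P i).ren ρ)
  | ρ, .sel k l P => .sel (ρ k) l (P.ren ρ)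

/-- `P` seen below one further session binder, whose channel it does not mention. -/
def Proc.shift (P : Proc D) : Proc D := P.ren Nat.succ

/-- The channel `k'` put in the place of the outermost session binder of `P`. -/
def Proc.instSession (k' : ℕ) (P : Proc D) : Proc D := P.ren (cons k' id)

def Val.shift : Val D → Val D
  | .chan a => .chan (a + 1)
  | .lit b v => .lit b v

def Val.toExpr : Val D → Expr D
  | .chan a => .name a
  | .lit b v => .lit b v

/-- Substitution in the subject of a service or request. A constant cannot stand there (and never
does so in a typed process): the name is then left alone. -/
def Val.subject (v : Val D) (a : ℕ) : ℕ :=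
  match v with
  | .chan b => b
  | .lit _ _ => a

/-- Lifts a substitution below a binder. -/
def liftSub (σ : ℕ → Val D) : ℕ → Val D := cons (.chan 0) (fun n => (σ n).shift)

def Expr.subst (σ : ℕ → Val D) : Expr D → Expr D
  | .name x => (σ x).toExpr
  | .lit b v => .lit b v
  | .op f args => .op f (fun i => (args i).subst σ)

/-- Capture-avoiding substitution of values for public names. -/
def Proc.subst : (ℕ → Val D) → Proc D → Proc D
  | _, .nil => .nil
  | σ, .par P Q => .par (P.subst σ) (Q.subst σ)
  | σ, .res P => .res (P.subst σ)
  | σ, .rserv a P => .rserv ((σ a).subject a) (P.subst σ)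
  | σ, .serv a P => .serv ((σ a).subject a) (P.subst σ)
  | σ, .req a P => .req ((σ a).subject a) (P.subst σ)
  | σ, .cond e P Q => .cond (e.subst σ) (P.subst σ) (Q.subst σ)
  | σ, .inp k P => .inp k (P.subst (liftSub σ))
  | σ, .out k e P => .out k (e.subst σ) (P.subst σ)
  | σ, .inS k P => .inS k (P.subst σ)
  | σ, .del k k' P => .del k k' (P.subst σ)
  | σ, .bra k I P => .bra k I (fun i => (P i).subst σ)
  | σ, .sel k l P => .sel k l (P.subst σ)

/-- `P[v/x]`, for the variable `x` bound by the input prefix that `P` is the body of. -/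
def Proc.instVal (v : Val D) (P : Proc D) : Proc D := P.subst (cons v Val.chan)

/-! ### Structural congruence and reduction -/

/-- Structural congruence: the least congruence that contains the listed axioms. -/
inductive Cong : Proc D → Proc D → Prop
  | refl (P) : Cong P P
  | symm {P Q} : Cong P Q → Cong Q P
  | trans {P Q R} : Cong P Q → Cong Q R → Cong P R
  | par_comm (P Q) : Cong (.par P Q) (.par Q P)
  | par_assoc (P Q R) : Cong (.par P (.par Q R)) (.par (.par P Q) R)
  | par_nil (P) : Cong (.par P .nil) P
  /-- `P | (ν k) Q ≡ (ν k) (P | Q)` for `k` not free in `P` -/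
  | extrude (P Q) : Cong (.par P (.res Q)) (.res (.par P.shift Q))
  | res_nil : Cong (.res .nil) .nil
  | par {P P' Q Q'} : Cong P P' → Cong Q Q' → Cong (.par P Q) (.par P' Q')
  | res {P P'} : Cong P P' → Cong (.res P) (.res P')
  | rserv (a) {P P'} : Cong P P' → Cong (.rserv a P) (.rserv a P')
  | serv (a) {P P'} : Cong P P' → Cong (.serv a P) (.serv a P')
  | req (a) {P P'} : Cong P P' → Cong (.req a P) (.req a P')
  | cond (e) {P P' Q Q'} : Cong P P' → Cong Q Q' → Cong (.cond e P Q) (.cond e P' Q')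
  | inp (k) {P P'} : Cong P P' → Cong (.inp k P) (.inp k P')
  | out (k e) {P P'} : Cong P P' → Cong (.out k e P) (.out k e P')
  | inS (k) {P P'} : Cong P P' → Cong (.inS k P) (.inS k P')
  | del (k k') {P P'} : Cong P P' → Cong (.del k k' P) (.del k k' P')
  | bra (k I) {P P' : {l // l ∈ I} → Proc D} :
      (∀ i, Cong (P i) (P' i)) → Cong (.bra k I P) (.bra k I P')
  | sel (k l) {P P'} : Cong P P' → Cong (.sel k l P) (.sel k l P')

/-- Reduction. -/
inductive Red : Proc D → Proc D → Prop
  | rinit (a P Q) :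
      Red (.par (.rserv a P) (.req a Q)) (.par (.rserv a P) (.res (.par P Q)))
  | link (a P Q) : Red (.par (.serv a P) (.req a Q)) (.res (.par P Q))
  | com (k P e v Q) : Eval e v → Red (.par (.inp k P) (.out k e Q)) (.par (P.instVal v) Q)
  /-- `k?((k')).P | k!⟨⟨k'⟩⟩.Q → P | Q`. The bound channel of the receiver can be renamed to the
  delegated channel `k'` only if `k'` is not already free in the receiver's body. -/
  | del (k k' P Q) : k' + 1 ∉ P.fsc →
      Red (.par (.inS k P) (.del k k' Q)) (.par (P.instSession k') Q)
  | sel (k I P l Q) (hl : l ∈ I) :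
      Red (.par (.bra k I P) (.sel k l Q)) (.par (P ⟨l, hl⟩) Q)
  | par {P P'} (Q) : Red P P' → Red (.par P Q) (.par P' Q)
  | res {P P'} : Red P P' → Red (.res P) (.res P')
  | str {P Q Q' P'} : Cong P Q → Red Q Q' → Cong Q' P' → Red P P'
  | ifT (e v P Q) : Eval e (.lit D.bool v) → D.truth v = true → Red (.cond e P Q) P
  | ifF (e v P Q) : Eval e (.lit D.bool v) → D.truth v = false → Red (.cond e P Q) Q

/-- `Subterm Q P`: `Q` is a syntactic sub-term of `P`. -/
inductive Subterm (Q : Proc D) : Proc D → Prop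
  | refl : Subterm Q Q
  | par_left {P R} : Subterm Q P → Subterm Q (.par P R)
  | par_right {P R} : Subterm Q R → Subterm Q (.par P R)
  | res {P} : Subterm Q P → Subterm Q (.res P)
  | rserv {a P} : Subterm Q P → Subterm Q (.rserv a P)
  | serv {a P} : Subterm Q P → Subterm Q (.serv a P)
  | req {a P} : Subterm Q P → Subterm Q (.req a P)
  | cond_left {e P R} : Subterm Q P → Subterm Q (.cond e P R)
  | cond_right {e P R} : Subterm Q R → Subterm Q (.cond e P R)
  | inp {k P} : Subterm Q P → Subterm Q (.inp k P)
  | out {k e P} : Subterm Q P → Subterm Q (.out k e P)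
  | inS {k P} : Subterm Q P → Subterm Q (.inS k P)
  | del {k k' P} : Subterm Q P → Subterm Q (.del k k' P)
  | bra {k I} {P : {l // l ∈ I} → Proc D} (i) : Subterm Q (P i) → Subterm Q (.bra k I P)
  | sel {k l P} : Subterm Q P → Subterm Q (.sel k l P)

/-- Programs: no free session channels and, up to structural congruence, no restrictions. -/
def IsProgram (P : Proc D) : Prop :=
  P.fsc = ∅ ∧ ∃ P', Cong P P' ∧ ∀ Q, ¬ Subterm (.res Q) P'

/-- `Q` is a sub-process of `P`. -/
def SubProcess (Q P : Proc D) : Prop := ∃ P', Cong P P' ∧ Subterm Q P'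

/-! ### Types and typing -/

/-- Session types. Inputs `?(θ).α` and outputs `!(θ).α` come in three kinds, where the message
type `θ` is a basic type `b`, a service type `⟨β⟩`, or a session type `β`. Branching and selection
types are families over a finite non-empty set of labels. -/
inductive SessT (D : DataAlgebra) : Type
  | inBase (b : D.Base) (α : SessT D)
  | inServ (β α : SessT D)
  | inSess (β α : SessT D)
  | outBase (b : D.Base) (α : SessT D)
  | outServ (β α : SessT D)
  | outSess (β α : SessT D)
  | bra (I : Finset ℕ) (hI : I.Nonempty) (α : {l // l ∈ I} → SessT D)
  | sel (I : Finset ℕ) (hI : I.Nonempty) (α : {l // l ∈ I} → SessT D)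
  | fin

/-- Types `S` of public names and values: a basic type or a service type `⟨α⟩`. -/
inductive ValT (D : DataAlgebra) : Type
  | base (b : D.Base)
  | serv (α : SessT D)

/-- `?(S).α` -/
def SessT.inVal : ValT D → SessT D → SessT D
  | .base b, α => .inBase b α
  | .serv β, α => .inServ β α

/-- `!(S).α` -/
def SessT.outVal : ValT D → SessT D → SessT D
  | .base b, α => .outBase b α
  | .serv β, α => .outServ β α

/-- The dual session type. -/
def SessT.dual : SessT D → SessT D
  | .inBase b α => .outBase b α.dual
  | .inServ β α => .outServ β α.dual
  | .inSess β α => .outSess β α.dual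
  | .outBase b α => .inBase b α.dual
  | .outServ β α => .inServ β α.dual
  | .outSess β α => .inSess β α.dual
  | .bra I hI α => .sel I hI (fun i => (α i).dual)
  | .sel I hI α => .bra I hI (fun i => (α i).dual)
  | .fin => .fin

/-- What a session environment records for a channel: a session type, or `⊥` when both sides of
the session have been found. -/
inductive Usage (D : DataAlgebra) : Type
  | ty (α : SessT D)
  | bot

/-- Service typings `Γ`, as partial functions on public names. -/
abbrev SEnv (D : DataAlgebra) := ℕ → Option (ValT D)

/-- Session typings `Δ`, as partial functions on session channels. -/
abbrev KEnv (D : DataAlgebra) := ℕ → Option (Usage D)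

/-- `Δ` with the entry of `k` set to `u`. -/
def KEnv.set (Δ : KEnv D) (k : ℕ) (u : Usage D) : KEnv D := Function.update Δ k (some u)

/-- All sessions in `Δ` are finished. -/
def KEnv.Ended (Δ : KEnv D) : Prop := ∀ k u, Δ k = some u → u = .ty .fin

/-- The duality check on common channels. -/
def KEnv.Compat (Δ₁ Δ₂ : KEnv D) : Prop :=
  ∀ k u₁ u₂, Δ₁ k = some u₁ → Δ₂ k = some u₂ → ∃ α : SessT D, u₁ = .ty α.dual ∧ u₂ = .ty α

/-- The union of two session typings, with `⊥` on common channels. -/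
def KEnv.comp (Δ₁ Δ₂ : KEnv D) : KEnv D := fun k =>
  match Δ₁ k, Δ₂ k with
  | some _, some _ => some .bot
  | some u, none => some u
  | none, o => o

/-- `Γ ⊢ e : S`. -/
inductive ETyped (Γ : SEnv D) : Expr D → ValT D → Prop
  | name {x S} : Γ x = some S → ETyped Γ (.name x) S
  | lit (b v) : ETyped Γ (.lit b v) (.base b)
  | op (f : D.Op) (args : Fin (D.arity f) → Expr D) :
      (∀ i, ETyped Γ (args i) (.base (D.dom f i))) → ETyped Γ (.op f args) (.base (D.cod f))

/-- `Γ ⊢ P ▹ Δ`. The body of a service may use no session channel but the one that the service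
binds. As for the inactive process, finished sessions may be added to the session typing of a
service; this makes typing closed under structural congruence. -/
inductive Typed : SEnv D → Proc D → KEnv D → Prop
  | serv {Γ a α P Δ} : Γ a = some (.serv α) → Typed Γ P (cons (some (.ty α)) fun _ => none) →
      Δ.Ended → Typed Γ (.serv a P) Δ
  | rserv {Γ a α P Δ} : Γ a = some (.serv α) → Typed Γ P (cons (some (.ty α)) fun _ => none) →
      Δ.Ended → Typed Γ (.rserv a P) Δ
  | req {Γ a α P Δ} : Γ a = some (.serv α) → Typed Γ P (cons (some (.ty α.dual)) Δ) →
      Typed Γ (.req a P) Δ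
  | inp {Γ : SEnv D} {k S α P} {Δ : KEnv D} : Typed (cons (some S) Γ) P (Δ.set k (.ty α)) →
      Typed Γ (.inp k P) (Δ.set k (.ty (.inVal S α)))
  | out {Γ : SEnv D} {k e S α P} {Δ : KEnv D} : Typed Γ P (Δ.set k (.ty α)) → ETyped Γ e S →
      Typed Γ (.out k e P) (Δ.set k (.ty (.outVal S α)))
  | inS {Γ : SEnv D} {k β α P} {Δ : KEnv D} :
      Typed Γ P (cons (some (.ty β)) (Δ.set k (.ty α))) →
      Typed Γ (.inS k P) (Δ.set k (.ty (.inSess β α)))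
  | del {Γ : SEnv D} {k k' β α P} {Δ : KEnv D} : k ≠ k' → Δ k' = none →
      Typed Γ P (Δ.set k (.ty α)) →
      Typed Γ (.del k k' P) ((Δ.set k (.ty (.outSess β α))).set k' (.ty β))
  | bra {Γ : SEnv D} {k I hI α} {P : {l // l ∈ I} → Proc D} {Δ : KEnv D} :
      (∀ i, Typed Γ (P i) (Δ.set k (.ty (α i)))) →
      Typed Γ (.bra k I P) (Δ.set k (.ty (.bra I hI α)))
  | sel {Γ : SEnv D} {k I hI α l P} {Δ : KEnv D} (hl : l ∈ I) :
      Typed Γ P (Δ.set k (.ty (α ⟨l, hl⟩))) →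
      Typed Γ (.sel k l P) (Δ.set k (.ty (.sel I hI α)))
  | par {Γ P₁ P₂ Δ₁ Δ₂} : Typed Γ P₁ Δ₁ → Typed Γ P₂ Δ₂ → Δ₁.Compat Δ₂ →
      Typed Γ (.par P₁ P₂) (Δ₁.comp Δ₂)
  | nil {Γ Δ} : Δ.Ended → Typed Γ .nil Δ
  | res {Γ P Δ} : Typed Γ P (cons (some .bot) Δ) → Typed Γ (.res P) Δ
  | cond {Γ e P₁ P₂ Δ} : ETyped Γ e (.base D.bool) → Typed Γ P₁ Δ → Typed Γ P₂ Δ →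
      Typed Γ (.cond e P₁ P₂) Δ
  | bot {Γ : SEnv D} {P k} {Δ : KEnv D} : Typed Γ P (Δ.set k (.ty .fin)) →
      Typed Γ P (Δ.set k .bot)

/-- Well-typed processes: typable under finite environments, where the free public names are
service channels (a running process has no free data variables). -/
def WellTyped (P : Proc D) : Prop :=
  ∃ (Γ : SEnv D) (Δ : KEnv D), {a | Γ a ≠ none}.Finite ∧ {k | Δ k ≠ none}.Finite ∧
    (∀ a S, Γ a = some S → ∃ α, S = .serv α) ∧ Typed Γ P Δ

/-! ### Session dependency graphs and transparency -/

/-- Labelled unoriented multigraphs: every edge has two ends, every node a set of labels. -/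
structure LGraph where
  Node : Type
  Edge : Type
  dom : Edge → Node
  cod : Edge → Node
  lab : Node → Set ℕ

/-- The graph with one node. -/
def LGraph.single (L : Set ℕ) : LGraph :=
  ⟨Unit, Empty, Empty.elim, Empty.elim, fun _ => L⟩

/-- Disjoint union, with a new edge for each pair of nodes and each label that they share. -/
def LGraph.join (G H : LGraph) : LGraph where
  Node := G.Node ⊕ H.Node
  Edge := (G.Edge ⊕ H.Edge) ⊕ {t : G.Node × H.Node × ℕ // t.2.2 ∈ G.lab t.1 ∧ t.2.2 ∈ H.lab t.2.1}
  dom := Sum.elim (Sum.elim (fun e => .inl (G.dom e)) fun e => .inr (H.dom e))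
    fun t => .inl t.1.1
  cod := Sum.elim (Sum.elim (fun e => .inl (G.cod e)) fun e => .inr (H.cod e))
    fun t => .inr t.1.2.1
  lab := Sum.elim G.lab H.lab

/-- The session dependency graph. -/
def Proc.graph : Proc D → LGraph
  | .nil => ⟨Empty, Empty, Empty.elim, Empty.elim, Empty.elim⟩
  | .par P Q => P.graph.join Q.graph
  | .res P => { P.graph with lab := fun p => {n | n + 1 ∈ P.graph.lab p} }
  | P => .single P.fsc

/-- `G.Walk p es q`: the list of edges `es` leads from `p` to `q`. -/
inductive LGraph.Walk (G : LGraph) : G.Node → List G.Edge → G.Node → Prop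
  | nil (p) : Walk G p [] p
  | fwd (e) {es q} : Walk G (G.cod e) es q → Walk G (G.dom e) (e :: es) q
  | bwd (e) {es q} : Walk G (G.dom e) es q → Walk G (G.cod e) (e :: es) q

/-- No non-empty closed walk without repeated edges; two parallel edges form a cycle. -/
def LGraph.Acyclic (G : LGraph) : Prop := ∀ p es, G.Walk p es p → es.Nodup → es = []

/-- Transparent processes: every sub-process has an acyclic session dependency graph. -/
def Transparent (P : Proc D) : Prop := ∀ Q, SubProcess Q P → Q.graph.Acyclic

/-! ### Progress -/

/-- `Live B P`: some session channel that occurs in `P` is not bound by a service or a replicated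
service, where `B` holds of the free channels that are bound so by the surrounding term. The
channels introduced by requests and session inputs count as occurring; a restricted channel counts
only if it is used. -/
def Proc.Live : (ℕ → Prop) → Proc D → Prop
  | _, .nil => False
  | B, .par P Q => P.Live B ∨ Q.Live B
  | B, .res P => P.Live (cons False B)
  | B, .rserv _ P => P.Live (cons True B)
  | B, .serv _ P => P.Live (cons True B)
  | _, .req _ _ => True
  | B, .cond _ P Q => P.Live B ∨ Q.Live B
  | B, .inp k P => ¬ B k ∨ P.Live B
  | B, .out k _ P => ¬ B k ∨ P.Live B
  | _, .inS _ _ => True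
  | B, .del k k' P => ¬ B k ∨ ¬ B k' ∨ P.Live B
  | B, .bra k _ P => ¬ B k ∨ ∃ i, (P i).Live B
  | B, .sel k _ P => ¬ B k ∨ P.Live B

/-- `P` contains live channels. -/
def HasLive (P : Proc D) : Prop := P.Live fun _ => False

/-- Reduction contexts `E ::= · | E | P | (ν k) E`. -/
inductive RCtx (D : DataAlgebra) : Type
  | hole
  | par (E : RCtx D) (P : Proc D)
  | res (E : RCtx D)

def RCtx.plug : RCtx D → Proc D → Proc D
  | .hole, P => P
  | .par E Q, P => .par (E.plug P) Q
  | .res E, P => .res (E.plug P)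

/-- One unfolding of the definition of progress, relative to a predicate `X` for the process that
is reached. -/
def ProgressStep (X : Proc D → Prop) (P : Proc D) : Prop :=
  ∀ P', Relation.ReflTransGen Red P P' →
    ∀ (E : RCtx D) (P'' : Proc D), Cong P' (E.plug P'') → HasLive P'' →
      ∃ Q R, (∀ Q', ¬ Red Q Q') ∧ WellTyped (.par P'' Q) ∧ Red (.par P'' Q) R ∧ X R

/-- Progress, the greatest predicate `X` with `X P → ProgressStep X P`. -/
def HasProgress (P : Proc D) : Prop :=
  ∃ X : Proc D → Prop, X P ∧ ∀ R, X R → ProgressStep X R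

end SessPi

namespace SessPi

variable {D : DataAlgebra}

/-! ### Names, renaming and substitution -/

/-! A program uses no restricted channel and has no free one. In the typing rules `⊥` can sit on a
mentioned channel only if both ends of a session occur, so in a program every channel belongs to a
single parallel component. This is the linear typing `Proc.STyped`, obtained in `Typed.sTyped` and
invariant under `≡` and passage to sub-terms. Parallel components then share no labels, all
dependency graphs are edgeless, and transparency follows (`Proc.STyped.transparent`).

For progress, the coinductive predicate is `Safe`. Running processes do share sessions, but only
between top-level prefixes, whose bodies remain linear: this is `Proc.RTyped`. In addition, the
hypergraph with top-level prefixes as nodes and session channels as edges is acyclic. Acyclicity is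
expressed by leaves: every non-empty subfamily has a member that shares at most one label with the
others (`Forest`). A restriction contracts the edge it hides, and `Proc.Cuts` records what is needed
to undo the contraction. Reduction preserves typing (`Red.rTyped`) and acyclicity (`Red.forest`): a
new session attaches a pendant node, a delegation merges two nodes along their common session and
splits them again, and all other steps only shrink label sets or split them disjointly.

A process with live channels has a top-level prefix, so it remains to make any safe process with a
prefix react (`Safe.exists_reduces`). A conditional reduces by itself; a service or request gets a
matching partner; a prefix whose session is open gets a partner on that session. Partners exist
because every session type is inhabited once suitable service channels are available
(`SessT.inhab`). If every prefix acts on a session with both ends present, a leaf argument gives two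
prefixes with the same subject (`Forest.exists_pair`), and duality makes them a redex. Acyclicity is
needed once more here: it guarantees that a receiver does not already hold the channel delegated to
it. Partners are single prefixes other than conditionals, hence irreducible, and attaching one along
at most one session keeps the process safe. -/

@[simp] theorem cons_zero {α : Type} (x : α) (f : ℕ → α) : cons x f 0 = x := rfl
@[simp] theorem cons_succ {α : Type} (x : α) (f : ℕ → α) (n : ℕ) : cons x f (n + 1) = f n := rfl

theorem forall_nat_iff {p : ℕ → Prop} : (∀ n, p n) ↔ p 0 ∧ ∀ n, p (n + 1) :=
  ⟨fun h => ⟨h 0, fun n => h (n + 1)⟩, fun h n => by cases n; exacts [h.1, h.2 _]⟩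

theorem cons_tail {α : Type} (f : ℕ → α) : cons (f 0) (fun n => f (n + 1)) = f := by
  funext n; cases n <;> rfl

@[simp] theorem liftRen_zero (ρ : ℕ → ℕ) : liftRen ρ 0 = 0 := rfl
@[simp] theorem liftRen_succ (ρ : ℕ → ℕ) (n : ℕ) : liftRen ρ (n + 1) = ρ n + 1 := rfl

theorem liftRen_comp (ρ σ : ℕ → ℕ) (n : ℕ) : liftRen σ (liftRen ρ n) = liftRen (σ ∘ ρ) n := by
  cases n <;> rfl

theorem liftRen_injective {ρ : ℕ → ℕ} (h : Function.Injective ρ) :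
    Function.Injective (liftRen ρ) := by
  intro a b hab
  cases a <;> cases b <;> simp at hab ⊢
  exact h hab

@[simp] theorem SessT.dual_dual (α : SessT D) : α.dual.dual = α := by
  induction α <;> simp_all [SessT.dual]

/-- The labels that survive the removal of the outermost binder. -/
def down (A : Set ℕ) : Set ℕ := {n | n + 1 ∈ A}

@[simp] theorem mem_down {A : Set ℕ} {n : ℕ} : n ∈ down A ↔ n + 1 ∈ A := Iff.rfl

theorem down_image_liftRen (ρ : ℕ → ℕ) (A : Set ℕ) :
    {n | n + 1 ∈ liftRen ρ '' A} = ρ '' {n | n + 1 ∈ A} := by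
  ext n
  constructor
  · rintro ⟨m, hm, e⟩
    cases m with
    | zero => simp at e
    | succ m => exact ⟨m, hm, by simpa using e⟩
  · rintro ⟨m, hm, rfl⟩
    exact ⟨m + 1, hm, rfl⟩

theorem Proc.fsc_ren (P : Proc D) (ρ : ℕ → ℕ) : (P.ren ρ).fsc = ρ '' P.fsc := by
  induction P generalizing ρ with
  | nil => simp [ren, fsc]
  | par P Q hP hQ => simp [ren, fsc, hP, hQ, Set.image_union]
  | res P h => simp only [ren, fsc, h, down_image_liftRen]
  | rserv a P h => simp only [ren, fsc, h, down_image_liftRen]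
  | serv a P h => simp only [ren, fsc, h, down_image_liftRen]
  | req a P h => simp only [ren, fsc, h, down_image_liftRen]
  | cond e P Q hP hQ => simp [ren, fsc, hP, hQ, Set.image_union]
  | inp k P h => simp [ren, fsc, h, Set.image_insert_eq]
  | out k e P h => simp [ren, fsc, h, Set.image_insert_eq]
  | inS k P h =>
    simp only [ren, fsc, h, down_image_liftRen, Set.image_union, Set.image_singleton]
  | del k k' P h => simp only [ren, fsc, h, Set.image_union, Set.image_pair]
  | bra k I P h => simp [ren, fsc, h, Set.image_insert_eq, Set.image_iUnion]
  | sel k l P h => simp [ren, fsc, h, Set.image_insert_eq]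

theorem Proc.ren_ren (P : Proc D) (ρ σ : ℕ → ℕ) : (P.ren ρ).ren σ = P.ren (σ ∘ ρ) := by
  have key : ∀ ρ σ : ℕ → ℕ, liftRen σ ∘ liftRen ρ = liftRen (σ ∘ ρ) :=
    fun ρ σ => funext (liftRen_comp ρ σ)
  induction P generalizing ρ σ <;> simp_all [ren]

theorem Proc.ren_congr {P : Proc D} {ρ σ : ℕ → ℕ} (h : ∀ k ∈ P.fsc, ρ k = σ k) :
    P.ren ρ = P.ren σ := by
  have lift : ∀ {A : Set ℕ} {ρ σ : ℕ → ℕ}, (∀ k ∈ down A, ρ k = σ k) →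
      ∀ k ∈ A, liftRen ρ k = liftRen σ k := by
    intro A ρ σ h k hk
    cases k with
    | zero => rfl
    | succ k => simpa using h k hk
  induction P generalizing ρ σ with
  | nil => rfl
  | par P Q hP hQ =>
    simp only [ren]; rw [hP fun k hk => h k (.inl hk), hQ fun k hk => h k (.inr hk)]
  | res P ih => simp only [ren]; rw [ih (lift h)]
  | rserv a P ih => simp only [ren]; rw [ih (lift h)]
  | serv a P ih => simp only [ren]; rw [ih (lift h)]
  | req a P ih => simp only [ren]; rw [ih (lift h)]
  | cond e P Q hP hQ =>
    simp only [ren]; rw [hP fun k hk => h k (.inl hk), hQ fun k hk => h k (.inr hk)]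
  | inp k P ih => simp only [ren]; rw [ih fun k hk => h k (.inr hk), h k (.inl rfl)]
  | out k e P ih => simp only [ren]; rw [ih fun k hk => h k (.inr hk), h k (.inl rfl)]
  | inS k P ih => simp only [ren]; rw [ih (lift fun k hk => h k (.inr hk)), h k (.inl rfl)]
  | del k k' P ih =>
    simp only [ren]
    rw [ih fun k hk => h k (.inr hk), h k (.inl (.inl rfl)), h k' (.inl (.inr rfl))]
  | bra k I P ih =>
    simp only [ren]
    rw [h k (.inl rfl), funext fun i => ih i fun k hk => h k (.inr (Set.mem_iUnion.2 ⟨i, hk⟩))]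
  | sel k l P ih => simp only [ren]; rw [ih fun k hk => h k (.inr hk), h k (.inl rfl)]

theorem Proc.fsc_subst (P : Proc D) (σ : ℕ → Val D) : (P.subst σ).fsc = P.fsc := by
  induction P generalizing σ <;> simp_all [subst, fsc]

theorem Proc.fsc_shift (P : Proc D) : P.shift.fsc = Nat.succ '' P.fsc := P.fsc_ren _

theorem Proc.zero_notMem_fsc_shift (P : Proc D) : 0 ∉ P.shift.fsc := by
  simp [P.fsc_shift]

theorem finite_down {A : Set ℕ} (h : A.Finite) : (down A).Finite :=
  h.preimage (Nat.succ_injective.injOn)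

theorem Proc.finite_fsc (P : Proc D) : P.fsc.Finite := by
  induction P with
  | nil => exact Set.finite_empty
  | par P Q hP hQ => exact hP.union hQ
  | res P h => exact finite_down h
  | rserv a P h => exact finite_down h
  | serv a P h => exact finite_down h
  | req a P h => exact finite_down h
  | cond e P Q hP hQ => exact hP.union hQ
  | inp k P h => exact (Set.finite_singleton _).union h
  | out k e P h => exact (Set.finite_singleton _).union h
  | inS k P h => exact (Set.finite_singleton _).union (finite_down h)
  | del k k' P h => exact (Set.toFinite _).union h
  | bra k I P h => exact (Set.finite_singleton _).union (Set.finite_iUnion h)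
  | sel k l P h => exact (Set.finite_singleton _).union h

theorem Cong.fsc_eq {P Q : Proc D} (h : Cong P Q) : P.fsc = Q.fsc := by
  induction h with
  | refl => rfl
  | symm _ ih => exact ih.symm
  | trans _ _ h₁ h₂ => exact h₁.trans h₂
  | par_comm => exact Set.union_comm _ _
  | par_assoc => exact (Set.union_assoc _ _ _).symm
  | par_nil => exact Set.union_empty _
  | extrude P Q =>
    ext n
    simp [Proc.fsc, Proc.fsc_shift]
  | res_nil => rfl
  | bra k I _ ih => simp [Proc.fsc, ih]
  | _ => simp_all [Proc.fsc]

theorem Red.fsc_subset {P Q : Proc D} (h : Red P Q) : Q.fsc ⊆ P.fsc := by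
  induction h with
  | rinit a P Q => intro n; simp only [Proc.fsc, Set.mem_union, Set.mem_ofPred_eq]; tauto
  | link a P Q => intro n; simp only [Proc.fsc, Set.mem_union, Set.mem_ofPred_eq]; tauto
  | com k P e v Q _ =>
    intro n; simp only [Proc.fsc, Proc.instVal, Proc.fsc_subst, Set.mem_union]; tauto
  | del k k' P Q _ =>
    intro n
    simp only [Proc.fsc, Proc.instSession, Proc.fsc_ren, Set.mem_union, Set.mem_image]
    rintro (⟨m, hm, rfl⟩ | hn)
    · cases m with
      | zero => simp
      | succ m => exact .inl (.inr hm)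
    · tauto
  | sel k I P l Q hl =>
    intro n
    simp only [Proc.fsc, Set.mem_union, Set.mem_iUnion]
    rintro (h | h)
    · exact .inl (.inr ⟨_, h⟩)
    · tauto
  | par Q _ ih => exact Set.union_subset_union_left _ ih
  | res _ ih => exact fun n hn => ih hn
  | str h₁ _ h₂ ih => rwa [h₁.fsc_eq, ← h₂.fsc_eq]
  | ifT => exact Set.subset_union_left
  | ifF => exact Set.subset_union_right

/-! ### Top-level prefixes -/

/-- The number of top-level prefixes, where conditionals count twice. -/
def Proc.weight : Proc D → ℕ
  | .nil => 0
  | .par P Q => P.weight + Q.weight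
  | .res P => P.weight
  | .cond _ _ _ => 2
  | _ => 1

theorem Proc.weight_ren (P : Proc D) (ρ : ℕ → ℕ) : (P.ren ρ).weight = P.weight := by
  induction P generalizing ρ <;> simp_all [ren, weight]

theorem Cong.weight_eq {P Q : Proc D} (h : Cong P Q) : P.weight = Q.weight := by
  induction h with
  | symm _ ih => exact ih.symm
  | extrude P Q => simp [Proc.weight, Proc.shift, Proc.weight_ren]
  | _ => simp_all [Proc.weight] <;> omega

/-- A redex consists of two top-level prefixes or of one conditional, which is why conditionals
count twice. Consequently a process of weight at most one is irreducible, as the test processes in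
the definition of progress must be. -/
theorem Red.two_le_weight {P Q : Proc D} (h : Red P Q) : 2 ≤ P.weight := by
  induction h with
  | str h₁ _ _ ih => rwa [h₁.weight_eq]
  | par Q _ ih => exact ih.trans (Nat.le_add_right _ _)
  | res _ ih => exact ih
  | _ => simp [Proc.weight]

/-- Without top-level prefixes only inaction, parallel composition and restriction remain, and none
of them uses a channel. -/
theorem Proc.not_live_of_weight {P : Proc D} (h : P.weight = 0) (B : ℕ → Prop) : ¬ P.Live B := by
  induction P generalizing B <;> simp_all [weight, Live]

/-! ### Linear typing of prefix bodies -/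

/-- How the uses of a channel are shared out between two processes of which both must not mention
it: one of them gets all, and the other does not mention it. -/
def Alloc (P Q : Proc D) (Δ Δ₁ Δ₂ : ℕ → SessT D) : Prop :=
  ∀ k, (Δ₁ k = Δ k ∧ Δ₂ k = .fin ∧ k ∉ Q.fsc) ∨ (Δ₂ k = Δ k ∧ Δ₁ k = .fin ∧ k ∉ P.fsc)

/-- Typing of processes in which every channel is used by one party only and restricted channels
are not used at all. Channels that are not mentioned have type `fin`. -/
def Proc.STyped : Proc D → SEnv D → (ℕ → SessT D) → Prop
  | .nil, _, Δ => ∀ k, Δ k = .fin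
  | .par P Q, Γ, Δ => ∃ Δ₁ Δ₂, P.STyped Γ Δ₁ ∧ Q.STyped Γ Δ₂ ∧ Alloc P Q Δ Δ₁ Δ₂
  | .res P, Γ, Δ => 0 ∉ P.fsc ∧ P.STyped Γ (cons .fin Δ)
  | .rserv a P, Γ, Δ => ∃ α, Γ a = some (.serv α) ∧ (∀ k, Δ k = .fin) ∧ (∀ k, k + 1 ∉ P.fsc) ∧
      P.STyped Γ (cons α fun _ => .fin)
  | .serv a P, Γ, Δ => ∃ α, Γ a = some (.serv α) ∧ (∀ k, Δ k = .fin) ∧ (∀ k, k + 1 ∉ P.fsc) ∧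
      P.STyped Γ (cons α fun _ => .fin)
  | .req a P, Γ, Δ => ∃ α, Γ a = some (.serv α) ∧ P.STyped Γ (cons α.dual Δ)
  | .cond e P Q, Γ, Δ => ETyped Γ e (.base D.bool) ∧ P.STyped Γ Δ ∧ Q.STyped Γ Δ
  | .inp k P, Γ, Δ => ∃ S α, Δ k = .inVal S α ∧
      P.STyped (cons (some S) Γ) (Function.update Δ k α)
  | .out k e P, Γ, Δ => ∃ S α, Δ k = .outVal S α ∧ ETyped Γ e S ∧
      P.STyped Γ (Function.update Δ k α)
  | .inS k P, Γ, Δ => ∃ β α, Δ k = .inSess β α ∧ P.STyped Γ (cons β (Function.update Δ k α))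
  | .del k k' P, Γ, Δ => ∃ β α, Δ k = .outSess β α ∧ Δ k' = β ∧ k ≠ k' ∧ k' ∉ P.fsc ∧
      P.STyped Γ (Function.update (Function.update Δ k α) k' .fin)
  | .bra k I P, Γ, Δ => ∃ hI α, Δ k = .bra I hI α ∧
      ∀ i, (P i).STyped Γ (Function.update Δ k (α i))
  | .sel k l P, Γ, Δ => ∃ I hI α, ∃ hl : l ∈ I, Δ k = .sel I hI α ∧
      P.STyped Γ (Function.update Δ k (α ⟨l, hl⟩))

/-- Inaction forces `fin` everywhere, and a rule that moves a channel away from `fin` mentions it.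
So linear typings have no spare entries, and the type of an unmentioned channel is known. -/
theorem Proc.STyped.eq_fin {P : Proc D} {Γ : SEnv D} {Δ : ℕ → SessT D} (h : P.STyped Γ Δ) {k : ℕ}
    (hk : k ∉ P.fsc) : Δ k = .fin := by
  have upd : ∀ {A : Set ℕ} {Δ : ℕ → SessT D} {j k : ℕ} {α : SessT D}, k ∉ {j} ∪ A →
      (k ∉ A → Function.update Δ j α k = .fin) → Δ k = .fin := by
    intro A Δ j k α hk h
    simp only [Set.mem_union, Set.mem_singleton_iff, not_or] at hk
    rw [← h hk.2, Function.update_of_ne hk.1]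
  induction P generalizing Γ Δ k with
  | nil => exact h k
  | par P Q hP hQ =>
    obtain ⟨Δ₁, Δ₂, h₁, h₂, ha⟩ := h
    simp only [fsc, Set.mem_union, not_or] at hk
    rcases ha k with h | h
    · rw [← h.1, hP h₁ hk.1]
    · rw [← h.1, hQ h₂ hk.2]
  | res P ih => exact ih (k := k + 1) h.2 hk
  | rserv a P ih => exact h.choose_spec.2.1 k
  | serv a P ih => exact h.choose_spec.2.1 k
  | req a P ih =>
    obtain ⟨α, -, h⟩ := h
    exact ih (k := k + 1) h hk
  | cond e P Q hP hQ => exact hP h.2.1 fun h => hk (.inl h)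
  | inp j P ih =>
    obtain ⟨S, α, -, h⟩ := h
    exact upd hk (ih h)
  | out j e P ih =>
    obtain ⟨S, α, -, -, h⟩ := h
    exact upd hk (ih h)
  | inS j P ih =>
    obtain ⟨β, α, -, h⟩ := h
    exact upd (A := down P.fsc) hk (ih (k := k + 1) h)
  | del j j' P ih =>
    obtain ⟨β, α, -, -, -, -, h⟩ := h
    simp only [fsc, Set.mem_union, Set.mem_insert_iff, Set.mem_singleton_iff, not_or] at hk
    rw [← ih h hk.2, Function.update_of_ne hk.1.2, Function.update_of_ne hk.1.1]
  | bra j I P ih =>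
    obtain ⟨hI, α, -, h⟩ := h
    -- Label sets of types are non-empty; with no branch at all, unmentioned channels would be
    -- unconstrained.
    obtain ⟨l, hl⟩ := hI
    refine upd (A := (P ⟨l, hl⟩).fsc) (fun h' => hk ?_) (ih _ (h ⟨l, hl⟩))
    exact h'.imp id fun h => Set.mem_iUnion.2 ⟨_, h⟩
  | sel j l P ih =>
    obtain ⟨I, hI, α, hl, -, h⟩ := h
    exact upd hk (ih h)

theorem ETyped.mono {Γ Γ' : SEnv D} (hΓ : ∀ a S, Γ a = some S → Γ' a = some S) {e : Expr D}
    {S : ValT D} (h : ETyped Γ e S) : ETyped Γ' e S := by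
  induction h with
  | name h => exact .name (hΓ _ _ h)
  | lit b v => exact .lit b v
  | op f args _ ih => exact .op f args ih

theorem Proc.STyped.mono {Γ Γ' : SEnv D} (hΓ : ∀ a S, Γ a = some S → Γ' a = some S) {P : Proc D}
    {Δ : ℕ → SessT D} (h : P.STyped Γ Δ) : P.STyped Γ' Δ := by
  induction P generalizing Γ Γ' Δ with
  | nil => exact h
  | par P Q hP hQ =>
    obtain ⟨Δ₁, Δ₂, h₁, h₂, ha⟩ := h
    exact ⟨Δ₁, Δ₂, hP hΓ h₁, hQ hΓ h₂, ha⟩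
  | res P ih => exact ⟨h.1, ih hΓ h.2⟩
  | rserv a P ih =>
    obtain ⟨α, h₁, h₂, h₃, h₄⟩ := h
    exact ⟨α, hΓ _ _ h₁, h₂, h₃, ih hΓ h₄⟩
  | serv a P ih =>
    obtain ⟨α, h₁, h₂, h₃, h₄⟩ := h
    exact ⟨α, hΓ _ _ h₁, h₂, h₃, ih hΓ h₄⟩
  | req a P ih =>
    obtain ⟨α, h₁, h₂⟩ := h
    exact ⟨α, hΓ _ _ h₁, ih hΓ h₂⟩
  | cond e P Q hP hQ => exact ⟨h.1.mono hΓ, hP hΓ h.2.1, hQ hΓ h.2.2⟩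
  | inp k P ih =>
    obtain ⟨S, α, h₁, h₂⟩ := h
    refine ⟨S, α, h₁, ih (fun a T ha => ?_) h₂⟩
    cases a
    · exact ha
    · exact hΓ _ _ ha
  | out k e P ih =>
    obtain ⟨S, α, h₁, h₂, h₃⟩ := h
    exact ⟨S, α, h₁, h₂.mono hΓ, ih hΓ h₃⟩
  | inS k P ih =>
    obtain ⟨β, α, h₁, h₂⟩ := h
    exact ⟨β, α, h₁, ih hΓ h₂⟩
  | del k k' P ih =>
    obtain ⟨β, α, h₁, h₂, h₃, h₄, h₅⟩ := h
    exact ⟨β, α, h₁, h₂, h₃, h₄, ih hΓ h₅⟩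
  | bra k I P ih =>
    obtain ⟨hI, α, h₁, h₂⟩ := h
    exact ⟨hI, α, h₁, fun i => ih i hΓ (h₂ i)⟩
  | sel k l P ih =>
    obtain ⟨I, hI, α, hl, h₁, h₂⟩ := h
    exact ⟨I, hI, α, hl, h₁, ih hΓ h₂⟩

theorem STyped_of_subterm {P Q : Proc D} (h : Subterm Q P) {Γ : SEnv D} {Δ : ℕ → SessT D}
    (hP : P.STyped Γ Δ) : ∃ Γ' Δ', Q.STyped Γ' Δ' := by
  induction h generalizing Γ Δ with
  | refl => exact ⟨_, _, hP⟩
  | par_left _ ih =>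
    obtain ⟨_, _, h, -⟩ := hP
    exact ih h
  | par_right _ ih =>
    obtain ⟨_, _, -, h, -⟩ := hP
    exact ih h
  | res _ ih => exact ih hP.2
  | rserv _ ih => exact ih hP.choose_spec.2.2.2
  | serv _ ih => exact ih hP.choose_spec.2.2.2
  | req _ ih => exact ih hP.choose_spec.2
  | cond_left _ ih => exact ih hP.2.1
  | cond_right _ ih => exact ih hP.2.2
  | inp _ ih =>
    obtain ⟨_, _, _, h⟩ := hP
    exact ih h
  | out _ ih =>
    obtain ⟨_, _, _, _, h⟩ := hP
    exact ih h
  | inS _ ih =>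
    obtain ⟨_, _, _, h⟩ := hP
    exact ih h
  | del _ ih =>
    obtain ⟨_, _, _, _, _, _, h⟩ := hP
    exact ih h
  | bra i _ ih =>
    obtain ⟨_, _, _, h⟩ := hP
    exact ih (h i)
  | sel _ ih =>
    obtain ⟨_, _, _, _, _, h⟩ := hP
    exact ih h

/-! #### Renaming -/

theorem forall_notMem_range_liftRen {ρ : ℕ → ℕ} {Δ : ℕ → SessT D} {β : SessT D} :
    (∀ k ∉ Set.range (liftRen ρ), cons β Δ k = .fin) ↔ ∀ k ∉ Set.range ρ, Δ k = .fin := by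
  rw [forall_nat_iff]
  have h0 : 0 ∈ Set.range (liftRen ρ) := ⟨0, rfl⟩
  have hs : ∀ n, n + 1 ∈ Set.range (liftRen ρ) ↔ n ∈ Set.range ρ := by
    intro n
    constructor
    · rintro ⟨m, hm⟩
      cases m with
      | zero => simp at hm
      | succ m => exact ⟨m, by simpa using hm⟩
    · rintro ⟨m, rfl⟩
      exact ⟨m + 1, rfl⟩
  simp [h0, hs]

theorem cons_comp_liftRen {α : Type} (ρ : ℕ → ℕ) (x : α) (f : ℕ → α) :
    cons x f ∘ liftRen ρ = cons x (f ∘ ρ) := by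
  funext n; cases n <;> rfl

theorem forall_update_notMem_range {ρ : ℕ → ℕ} {Δ : ℕ → SessT D} {k : ℕ} {α : SessT D} :
    (∀ j ∉ Set.range ρ, Function.update Δ (ρ k) α j = .fin) ↔ ∀ j ∉ Set.range ρ, Δ j = .fin := by
  refine forall₂_congr fun j hj => ?_
  rw [Function.update_of_ne]
  rintro rfl
  exact hj ⟨k, rfl⟩

/-- Injectivity keeps distinct channels distinct, so typings pull back along `ρ`; channels outside
the range are not mentioned and must therefore be finished. -/
theorem Proc.STyped_ren {P : Proc D} {ρ : ℕ → ℕ} (hρ : Function.Injective ρ) {Γ : SEnv D}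
    {Δ : ℕ → SessT D} :
    (P.ren ρ).STyped Γ Δ ↔ P.STyped Γ (Δ ∘ ρ) ∧ ∀ k ∉ Set.range ρ, Δ k = .fin := by
  have upd : ∀ {ρ : ℕ → ℕ} (_ : Function.Injective ρ) (Δ : ℕ → SessT D) k α,
      Function.update Δ (ρ k) α ∘ ρ = Function.update (Δ ∘ ρ) k α :=
    fun hρ Δ k α => Function.update_comp_eq_of_injective Δ hρ k α
  have fin_iff : ∀ {ρ : ℕ → ℕ} {Δ : ℕ → SessT D},
      (∀ k, Δ k = .fin) ↔ (∀ k, (Δ ∘ ρ) k = .fin) ∧ ∀ k ∉ Set.range ρ, Δ k = .fin := by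
    intro ρ Δ
    refine ⟨fun h => ⟨fun k => h _, fun k _ => h k⟩, fun h k => ?_⟩
    by_cases hk : k ∈ Set.range ρ
    · obtain ⟨j, rfl⟩ := hk
      exact h.1 j
    · exact h.2 k hk
  have lift_fsc : ∀ {ρ : ℕ → ℕ} {P : Proc D} , (∀ k, k + 1 ∉ (P.ren (liftRen ρ)).fsc) ↔
      ∀ k, k + 1 ∉ P.fsc := by
    intro ρ P
    rw [P.fsc_ren]
    constructor
    · exact fun h k hk => h (ρ k) ⟨k + 1, hk, rfl⟩
    · rintro h k ⟨m, hm, e⟩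
      cases m with
      | zero => simp at e
      | succ m => exact h m hm
  have serv : ∀ {ρ : ℕ → ℕ} {Δ : ℕ → SessT D} {α : SessT D},
      cons α (fun _ => .fin) ∘ liftRen ρ = cons α fun _ => .fin :=
    fun {ρ Δ α} => cons_comp_liftRen ρ α fun _ => .fin
  have serv' : ∀ {ρ : ℕ → ℕ} {α : SessT D},
      ∀ k ∉ Set.range (liftRen ρ), cons α (fun _ => .fin) k = .fin :=
    fun {ρ α} => forall_notMem_range_liftRen.2 fun _ _ => rfl
  induction P generalizing ρ Γ Δ with
  | nil => exact fin_iff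
  | par P Q hP hQ =>
    simp only [ren, STyped]
    constructor
    · rintro ⟨Δ₁, Δ₂, h₁, h₂, ha⟩
      replace h₁ := (hP hρ).1 h₁
      replace h₂ := (hQ hρ).1 h₂
      refine ⟨⟨_, _, h₁.1, h₂.1, fun k => ?_⟩, fun k hk => ?_⟩
      · simpa [fsc_ren, hρ.eq_iff] using ha (ρ k)
      · rcases ha k with h | h
        · rw [← h.1, h₁.2 k hk]
        · rw [← h.1, h₂.2 k hk]
    · rintro ⟨⟨Δ₁, Δ₂, h₁, h₂, ha⟩, h⟩
      -- Typings of the components are transported forward along `ρ`, with the default `fin` outside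
      -- its range.
      have ext : ∀ Δ : ℕ → SessT D, Function.extend ρ Δ (fun _ => .fin) ∘ ρ = Δ :=
        fun Δ => Function.extend_comp hρ Δ _
      have ext' : ∀ Δ : ℕ → SessT D, ∀ k ∉ Set.range ρ,
          Function.extend ρ Δ (fun _ => .fin) k = .fin :=
        fun Δ k hk => Function.extend_apply' _ _ _ hk
      refine ⟨Function.extend ρ Δ₁ fun _ => .fin, Function.extend ρ Δ₂ fun _ => .fin,
        (hP hρ).2 ⟨by rwa [ext], ext' _⟩, (hQ hρ).2 ⟨by rwa [ext], ext' _⟩, fun k => ?_⟩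
      by_cases hk : k ∈ Set.range ρ
      · obtain ⟨k, rfl⟩ := hk
        simpa [fsc_ren, hρ.eq_iff, hρ.extend_apply] using ha k
      · left
        rw [ext' _ k hk, ext' _ k hk, h k hk]
        refine ⟨rfl, rfl, ?_⟩
        rw [fsc_ren]
        exact fun ⟨j, _, e⟩ => hk ⟨j, e⟩
  | res P ih =>
    simp only [ren, STyped]
    simp only [ih (liftRen_injective hρ), forall_notMem_range_liftRen, cons_comp_liftRen]
    rw [← and_assoc]
    refine and_congr_left fun _ => and_congr_left fun _ => not_congr ?_
    rw [fsc_ren]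
    constructor
    · rintro ⟨m, hm, e⟩
      cases m with
      | zero => exact hm
      | succ m => simp at e
    · exact fun h => ⟨0, h, rfl⟩
  | rserv a P ih =>
    simp only [ren, STyped]
    simp only [ih (liftRen_injective hρ), lift_fsc, serv (Δ := Δ), fin_iff (ρ := ρ) (Δ := Δ)]
    have := @serv' ρ
    grind
  | serv a P ih =>
    simp only [ren, STyped]
    simp only [ih (liftRen_injective hρ), lift_fsc, serv (Δ := Δ), fin_iff (ρ := ρ) (Δ := Δ)]
    have := @serv' ρ
    grind
  | req a P ih =>
    simp only [ren, STyped]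
    simp only [ih (liftRen_injective hρ), forall_notMem_range_liftRen, cons_comp_liftRen]
    grind
  | cond e P Q hP hQ =>
    simp only [ren, STyped, hP hρ, hQ hρ]
    tauto
  | inp k P ih =>
    simp only [ren, STyped, ih hρ, upd hρ, forall_update_notMem_range, Function.comp_apply]
    grind
  | out k e P ih =>
    simp only [ren, STyped, ih hρ, upd hρ, forall_update_notMem_range, Function.comp_apply]
    grind
  | inS k P ih =>
    simp only [ren, STyped, ih (liftRen_injective hρ), forall_notMem_range_liftRen,
      cons_comp_liftRen, upd hρ, forall_update_notMem_range, Function.comp_apply]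
    grind
  | del k k' P ih =>
    simp only [ren, STyped, ih hρ, upd hρ, forall_update_notMem_range, Function.comp_apply,
      fsc_ren, hρ.mem_set_image, hρ.ne_iff]
    grind
  | bra k I P ih =>
    simp only [ren, STyped, ih _ hρ, upd hρ, forall_update_notMem_range, Function.comp_apply]
    constructor
    · rintro ⟨hI, α, h₁, h₂⟩
      exact ⟨⟨hI, α, h₁, fun i => (h₂ i).1⟩, (h₂ ⟨_, hI.choose_spec⟩).2⟩
    · rintro ⟨⟨hI, α, h₁, h₂⟩, h₃⟩
      exact ⟨hI, α, h₁, fun i => ⟨h₂ i, h₃⟩⟩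
  | sel k l P ih =>
    simp only [ren, STyped, ih hρ, upd hρ, forall_update_notMem_range, Function.comp_apply]
    grind

theorem Proc.STyped_shift {P : Proc D} {Γ : SEnv D} {Δ : ℕ → SessT D} :
    P.shift.STyped Γ Δ ↔ P.STyped Γ (fun k => Δ (k + 1)) ∧ Δ 0 = .fin := by
  rw [shift, STyped_ren Nat.succ_injective]
  refine and_congr Iff.rfl ⟨fun h => h 0 (by simp), fun h k hk => ?_⟩
  cases k with
  | zero => exact h
  | succ k => exact absurd ⟨k, rfl⟩ hk

/-- The instantiation `cons k' id` identifies only `0` and `k' + 1`. When the latter is not free, it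
can be sent elsewhere, so that a delegation acts as an injective renaming and `Proc.STyped_ren`
applies. -/
theorem Proc.exists_injective_eqOn_cons_id {P : Proc D} {k' : ℕ} (h : k' + 1 ∉ P.fsc) :
    ∃ ρ : ℕ → ℕ, Function.Injective ρ ∧ ∀ k ∈ P.fsc, cons k' id k = ρ k := by
  obtain ⟨N, hN⟩ := P.finite_fsc.bddAbove
  -- `M` is above every free channel and at least `k' + 1`; it serves as the new image of `k' + 1`,
  -- and beyond it the renaming is the identity.
  let M := N + k' + 1
  refine ⟨fun n => if n = 0 then k' else if n = k' + 1 then M else if n ≤ M then n - 1 else n,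
    fun a b hab => ?_, fun k hk => ?_⟩
  · simp only at hab
    split_ifs at hab <;> omega
  · have : k ≤ N := hN hk
    cases k with
    | zero => rfl
    | succ k =>
      have : k ≠ k' := by rintro rfl; exact h hk
      have : k + 1 ≤ M := by omega
      simp [*]

theorem Proc.STyped.ext {P : Proc D} {Γ : SEnv D} {Δ Δ' : ℕ → SessT D} (h : P.STyped Γ Δ)
    (h₁ : ∀ k ∈ P.fsc, Δ' k = Δ k) (h₂ : ∀ k ∉ P.fsc, Δ' k = .fin) : P.STyped Γ Δ' := by
  convert h using 1
  funext k
  by_cases hk : k ∈ P.fsc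
  · exact h₁ k hk
  · rw [h₂ k hk, h.eq_fin hk]

theorem Proc.STyped.instSession {P : Proc D} {Γ : SEnv D} {Δ : ℕ → SessT D} {β : SessT D} {k' : ℕ}
    (h : P.STyped Γ (cons β Δ)) (hk : k' + 1 ∉ P.fsc) :
    (P.instSession k').STyped Γ (Function.update Δ k' β) := by
  obtain ⟨ρ, hρ, hρ'⟩ := exists_injective_eqOn_cons_id hk
  have hfsc : (P.instSession k').fsc = cons k' id '' P.fsc := P.fsc_ren _
  have h0 := fun h0 => h.eq_fin (k := 0) h0
  have h1 := fun k hk => h.eq_fin (k := k + 1) hk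
  simp only [cons_zero, cons_succ] at h0 h1
  have h' : (P.ren ρ).STyped Γ (Function.extend ρ (cons β Δ) fun _ => .fin) :=
    (STyped_ren hρ).2 ⟨by rwa [Function.extend_comp hρ],
      fun k hk => Function.extend_apply' _ _ _ hk⟩
  have key : ∀ k ∈ P.fsc, Function.update Δ k' β (cons k' id k) = cons β Δ k := by
    intro k hk'
    cases k with
    | zero => simp
    | succ k =>
      have : k ≠ k' := by rintro rfl; exact hk hk'
      simp [this]
  have e : P.instSession k' = P.ren ρ := ren_congr hρ'
  rw [e]
  refine h'.ext ?_ ?_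
  · rw [P.fsc_ren]
    rintro _ ⟨k, hk, rfl⟩
    rw [hρ.extend_apply, ← hρ' k hk, key k hk]
  · intro k hk'
    rw [← e, hfsc] at hk'
    by_cases e : k = k'
    · subst e
      rw [Function.update_self]
      exact h0 fun h => hk' ⟨0, h, rfl⟩
    · rw [Function.update_of_ne e]
      exact h1 _ fun h => hk' ⟨k + 1, h, rfl⟩

/-! #### Substitution -/

/-- Typing of values. -/
def VTyped (Γ : SEnv D) : Val D → ValT D → Prop
  | .chan a, S => Γ a = some S
  | .lit b _, S => S = .base b

theorem Eval.vTyped {Γ : SEnv D} {e : Expr D} {v : Val D} {S : ValT D} (h : Eval e v)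
    (he : ETyped Γ e S) : VTyped Γ v S := by
  cases h with
  | name a => cases he; assumption
  | lit b v => cases he; rfl
  | op f args v _ => cases he; rfl

theorem VTyped.toExpr {Γ : SEnv D} {v : Val D} {S : ValT D} (h : VTyped Γ v S) :
    ETyped Γ v.toExpr S := by
  cases v with
  | chan a => exact .name h
  | lit b v => cases h; exact .lit b v

theorem VTyped.shift {Γ : SEnv D} {v : Val D} {S : ValT D} {T : Option (ValT D)}
    (h : VTyped Γ v S) : VTyped (cons T Γ) v.shift S := by
  cases v <;> exact h

theorem VTyped.subject {Γ : SEnv D} {v : Val D} {α : SessT D} (h : VTyped Γ v (.serv α)) (a : ℕ) :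
    Γ (v.subject a) = some (.serv α) := by
  cases v with
  | chan b => exact h
  | lit b v => cases h

theorem ETyped.subst {Γ Γ' : SEnv D} {σ : ℕ → Val D}
    (hσ : ∀ x S, Γ x = some S → VTyped Γ' (σ x) S) {e : Expr D} {S : ValT D} (h : ETyped Γ e S) :
    ETyped Γ' (e.subst σ) S := by
  induction h with
  | name h => exact (hσ _ _ h).toExpr
  | lit b v => exact .lit b v
  | op f args _ ih => exact .op f _ ih

theorem Proc.STyped.subst {P : Proc D} {Γ Γ' : SEnv D} {σ : ℕ → Val D}
    (hσ : ∀ x S, Γ x = some S → VTyped Γ' (σ x) S) {Δ : ℕ → SessT D} (h : P.STyped Γ Δ) :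
    (P.subst σ).STyped Γ' Δ := by
  induction P generalizing Γ Γ' σ Δ with
  | nil => exact h
  | par P Q hP hQ =>
    obtain ⟨Δ₁, Δ₂, h₁, h₂, ha⟩ := h
    refine ⟨Δ₁, Δ₂, hP hσ h₁, hQ hσ h₂, ?_⟩
    simpa only [Alloc, fsc_subst] using ha
  | res P ih => exact ⟨by simpa only [fsc_subst] using h.1, ih hσ h.2⟩
  | rserv a P ih =>
    obtain ⟨α, h₁, h₂, h₃, h₄⟩ := h
    exact ⟨α, (hσ _ _ h₁).subject a, h₂, by simpa only [fsc_subst] using h₃, ih hσ h₄⟩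
  | serv a P ih =>
    obtain ⟨α, h₁, h₂, h₃, h₄⟩ := h
    exact ⟨α, (hσ _ _ h₁).subject a, h₂, by simpa only [fsc_subst] using h₃, ih hσ h₄⟩
  | req a P ih =>
    obtain ⟨α, h₁, h₂⟩ := h
    exact ⟨α, (hσ _ _ h₁).subject a, ih hσ h₂⟩
  | cond e P Q hP hQ => exact ⟨h.1.subst hσ, hP hσ h.2.1, hQ hσ h.2.2⟩
  | inp k P ih =>
    obtain ⟨S, α, h₁, h₂⟩ := h
    refine ⟨S, α, h₁, ih (fun a T ha => ?_) h₂⟩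
    cases a
    · exact ha
    · exact (hσ _ _ ha).shift
  | out k e P ih =>
    obtain ⟨S, α, h₁, h₂, h₃⟩ := h
    exact ⟨S, α, h₁, h₂.subst hσ, ih hσ h₃⟩
  | inS k P ih =>
    obtain ⟨β, α, h₁, h₂⟩ := h
    exact ⟨β, α, h₁, ih hσ h₂⟩
  | del k k' P ih =>
    obtain ⟨β, α, h₁, h₂, h₃, h₄, h₅⟩ := h
    exact ⟨β, α, h₁, h₂, h₃, by simpa only [fsc_subst] using h₄, ih hσ h₅⟩
  | bra k I P ih =>
    obtain ⟨hI, α, h₁, h₂⟩ := h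
    exact ⟨hI, α, h₁, fun i => ih i hσ (h₂ i)⟩
  | sel k l P ih =>
    obtain ⟨I, hI, α, hl, h₁, h₂⟩ := h
    exact ⟨I, hI, α, hl, h₁, ih hσ h₂⟩

theorem Proc.STyped.instVal {P : Proc D} {Γ : SEnv D} {S : ValT D} {v : Val D} {Δ : ℕ → SessT D}
    (h : P.STyped (cons (some S) Γ) Δ) (hv : VTyped Γ v S) : (P.instVal v).STyped Γ Δ := by
  refine h.subst fun x T hx => ?_
  cases x with
  | zero => cases hx; exact hv
  | succ x => exact hx

/-! #### Structural congruence -/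

theorem Proc.STyped_par_comm {P Q : Proc D} {Γ : SEnv D} {Δ : ℕ → SessT D}
    (h : (Proc.par P Q).STyped Γ Δ) : (Proc.par Q P).STyped Γ Δ := by
  obtain ⟨Δ₁, Δ₂, h₁, h₂, ha⟩ := h
  exact ⟨Δ₂, Δ₁, h₂, h₁, fun k => (ha k).symm⟩

theorem Proc.STyped_par_assoc {P Q R : Proc D} {Γ : SEnv D} {Δ : ℕ → SessT D}
    (h : (Proc.par P (.par Q R)).STyped Γ Δ) : (Proc.par (.par P Q) R).STyped Γ Δ := by
  obtain ⟨Δ₁, Δ', h₁, ⟨Δ₂, Δ₃, h₂, h₃, ha₂⟩, ha₁⟩ := h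
  have : ∀ k, ∃ u, ((Δ₁ k = u ∧ Δ₂ k = .fin ∧ k ∉ Q.fsc) ∨ (Δ₂ k = u ∧ Δ₁ k = .fin ∧ k ∉ P.fsc)) ∧
      ((u = Δ k ∧ Δ₃ k = .fin ∧ k ∉ R.fsc) ∨ (Δ₃ k = Δ k ∧ u = .fin ∧ k ∉ (Proc.par P Q).fsc)) := by
    intro k
    have a₁ := ha₁ k
    have a₂ := ha₂ k
    simp only [fsc, Set.mem_union] at a₁ ⊢
    by_contra h
    have h' := not_exists.1 h
    -- The type of the group `P | Q` on a channel is that of `P` or that of `Q`; no other candidate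
    -- is needed.
    have := h' (Δ₁ k)
    have := h' (Δ₂ k)
    grind
  choose Δ'' hl hr using this
  exact ⟨Δ'', Δ₃, ⟨Δ₁, Δ₂, h₁, h₂, hl⟩, h₃, hr⟩

theorem Cong.sTyped_iff {P Q : Proc D} (h : Cong P Q) {Γ : SEnv D} {Δ : ℕ → SessT D} :
    P.STyped Γ Δ ↔ Q.STyped Γ Δ := by
  induction h generalizing Γ Δ with
  | refl => rfl
  | symm _ ih => exact ih.symm
  | trans _ _ h₁ h₂ => exact h₁.trans h₂
  | par_comm => exact ⟨Proc.STyped_par_comm, Proc.STyped_par_comm⟩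
  | par_assoc P Q R =>
    refine ⟨Proc.STyped_par_assoc, fun h => ?_⟩
    -- The converse of associativity is associativity conjugated by commutativity.
    obtain ⟨Δ₁, Δ₂, h₁, h₂, ha⟩ := Proc.STyped_par_comm
      (Proc.STyped_par_assoc (Proc.STyped_par_comm (Proc.STyped_par_assoc (Proc.STyped_par_comm h))))
    exact ⟨Δ₁, Δ₂, h₁, h₂, ha⟩
  | par_nil P =>
    constructor
    · rintro ⟨Δ₁, Δ₂, h₁, h₂, ha⟩
      refine h₁.ext (fun k _ => ?_) fun k hk => ?_ <;>
      · have a := ha k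
        have b := h₂ k
        have c := fun h => h₁.eq_fin (k := k) h
        grind
    · exact fun h => ⟨Δ, fun _ => .fin, h, fun _ => rfl, fun k => .inl ⟨rfl, rfl, id⟩⟩
  | extrude P Q =>
    constructor
    · rintro ⟨Δ₁, Δ₂, h₁, ⟨h₀, h₂⟩, ha⟩
      refine ⟨?_, cons .fin Δ₁, cons .fin Δ₂, Proc.STyped_shift.2 ⟨h₁, rfl⟩, h₂, ?_⟩
      · simp [Proc.fsc, h₀, Proc.fsc_shift]
      · refine forall_nat_iff.2 ⟨.inl ⟨rfl, rfl, h₀⟩, fun k => ?_⟩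
        simpa [Proc.fsc_shift, Proc.fsc] using ha k
    · rintro ⟨h₀, Δ₁, Δ₂, h₁, h₂, ha⟩
      simp only [Proc.fsc, Set.mem_union, not_or] at h₀
      refine ⟨_, fun k => Δ₂ (k + 1), (Proc.STyped_shift.1 h₁).1, ⟨h₀.2, ?_⟩, fun k => ?_⟩
      · rw [← h₂.eq_fin h₀.2, cons_tail]
        exact h₂
      · simpa [Proc.fsc_shift, Proc.fsc] using ha (k + 1)
  | res_nil =>
    simp [Proc.STyped, Proc.fsc, forall_nat_iff (p := fun n => cons _ _ n = _)]
  | par h₁ h₂ ih₁ ih₂ => simp only [Proc.STyped, Alloc, ih₁, ih₂, h₁.fsc_eq, h₂.fsc_eq]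
  | res h ih => simp only [Proc.STyped, ih, h.fsc_eq]
  | rserv a h ih => simp only [Proc.STyped, ih, h.fsc_eq]
  | serv a h ih => simp only [Proc.STyped, ih, h.fsc_eq]
  | req a h ih => simp only [Proc.STyped, ih]
  | cond e _ _ ih₁ ih₂ => simp only [Proc.STyped, ih₁, ih₂]
  | inp k _ ih => simp only [Proc.STyped, ih]
  | out k e _ ih => simp only [Proc.STyped, ih]
  | inS k _ ih => simp only [Proc.STyped, ih]
  | del k k' h ih => simp only [Proc.STyped, ih, h.fsc_eq]
  | bra k I _ ih => simp only [Proc.STyped, ih]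
  | sel k l _ ih => simp only [Proc.STyped, ih]

/-! #### Transparency -/

theorem Proc.lab_graph_subset (P : Proc D) (p : P.graph.Node) : P.graph.lab p ⊆ P.fsc := by
  induction P with
  | nil => exact p.elim
  | par P Q hP hQ =>
    cases p with
    | inl p => exact (hP p).trans Set.subset_union_left
    | inr p => exact (hQ p).trans Set.subset_union_right
  | res P ih => exact fun n hn => ih p hn
  | _ => exact subset_rfl

theorem Proc.STyped.notMem_inter {P Q : Proc D} {Γ : SEnv D} {Δ : ℕ → SessT D}
    (h : (Proc.par P Q).STyped Γ Δ) (k : ℕ) : ¬ (k ∈ P.fsc ∧ k ∈ Q.fsc) := by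
  obtain ⟨Δ₁, Δ₂, -, -, ha⟩ := h
  rcases ha k with h | h <;> tauto

/-- Node labels are free channels of the component, and linear components have no free channel in
common. -/
theorem Proc.STyped.isEmpty_edge {P : Proc D} {Γ : SEnv D} {Δ : ℕ → SessT D}
    (h : P.STyped Γ Δ) : IsEmpty P.graph.Edge := by
  induction P generalizing Δ with
  | nil => exact inferInstanceAs (IsEmpty Empty)
  | par P Q hP hQ =>
    have hd := h.notMem_inter
    obtain ⟨Δ₁, Δ₂, h₁, h₂, -⟩ := h
    refine ⟨?_⟩
    rintro ((e | e) | ⟨⟨p, q, k⟩, h⟩)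
    · exact (hP h₁).false e
    · exact (hQ h₂).false e
    · exact hd k ⟨P.lab_graph_subset p h.1, Q.lab_graph_subset q h.2⟩
  | res P ih => exact ih h.2
  | _ => exact inferInstanceAs (IsEmpty Empty)

theorem Proc.STyped.transparent {P : Proc D} {Γ : SEnv D} {Δ : ℕ → SessT D}
    (h : P.STyped Γ Δ) : Transparent P := by
  rintro Q ⟨P', hc, hs⟩ p es - -
  obtain ⟨Γ', Δ', hQ⟩ := STyped_of_subterm hs (hc.sTyped_iff.1 h)
  have := hQ.isEmpty_edge
  exact List.eq_nil_iff_forall_not_mem.2 fun e => (this.false e).elim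

/-! ### Typing of running processes -/

/-- `u.Le v`: a channel with usage `u` may be recorded as having usage `v`. -/
def Usage.Le (u v : Usage D) : Prop := v = u ∨ u = .ty .fin ∧ v = .bot

@[refl] theorem Usage.Le.refl (u : Usage D) : u.Le u := .inl rfl

theorem Usage.Le.trans {u v w : Usage D} (h : u.Le v) (h' : v.Le w) : u.Le w := by
  unfold Le at *; grind

theorem Usage.Le.eq_of_ne {u v : Usage D} (h : u.Le v) (hu : u ≠ .ty .fin) : v = u := by
  unfold Le at *; grind

theorem Usage.Le.eq_of_ty {α : SessT D} {v : Usage D} (h : v.Le (.ty α)) : v = .ty α := by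
  unfold Le at *; grind

/-- How the uses of a channel are shared out between two running processes: one gets all of them
and the other does not mention the channel, or they get the two ends of the session. -/
def Share (P Q : Proc D) (Δ Δ₁ Δ₂ : ℕ → Usage D) : Prop :=
  ∀ k, (Δ₁ k = Δ k ∧ Δ₂ k = .ty .fin ∧ k ∉ Q.fsc) ∨ (Δ₂ k = Δ k ∧ Δ₁ k = .ty .fin ∧ k ∉ P.fsc) ∨
    (Δ k = .bot ∧ ∃ α : SessT D, Δ₁ k = .ty α.dual ∧ Δ₂ k = .ty α)

/-- Linear typing, with finished channels possibly recorded as `⊥`. -/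
def Proc.Leaf (P : Proc D) (Γ : SEnv D) (Δ : ℕ → Usage D) : Prop :=
  ∃ Δ₀, P.STyped Γ Δ₀ ∧ ∀ k, Usage.Le (.ty (Δ₀ k)) (Δ k)

/-- Typing of running processes: the top-level prefixes are typed linearly, and may share
sessions. -/
def Proc.RTyped : Proc D → SEnv D → (ℕ → Usage D) → Prop
  | .par P Q, Γ, Δ => ∃ Δ₁ Δ₂, P.RTyped Γ Δ₁ ∧ Q.RTyped Γ Δ₂ ∧ Share P Q Δ Δ₁ Δ₂
  | .res P, Γ, Δ => P.RTyped Γ (cons .bot Δ)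
  | P, Γ, Δ => P.Leaf Γ Δ

theorem Proc.Leaf.le {P : Proc D} {Γ : SEnv D} {Δ Δ' : ℕ → Usage D} (h : P.Leaf Γ Δ)
    (hΔ : ∀ k, (Δ k).Le (Δ' k)) : P.Leaf Γ Δ' := by
  obtain ⟨Δ₀, h₀, h₁⟩ := h
  exact ⟨Δ₀, h₀, fun k => (h₁ k).trans (hΔ k)⟩

/-- When the total usage is relaxed from `fin` to `⊥`, the change can be charged to the component
that owns the channel. -/
theorem Share.le {P Q : Proc D} {Δ Δ' Δ₁ Δ₂ : ℕ → Usage D} (h : Share P Q Δ Δ₁ Δ₂)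
    (hΔ : ∀ k, (Δ k).Le (Δ' k)) :
    ∃ Δ₁' Δ₂', (∀ k, (Δ₁ k).Le (Δ₁' k)) ∧ (∀ k, (Δ₂ k).Le (Δ₂' k)) ∧ Share P Q Δ' Δ₁' Δ₂' := by
  have : ∀ k, ∃ u v, (Δ₁ k).Le u ∧ (Δ₂ k).Le v ∧ ((u = Δ' k ∧ v = .ty .fin ∧ k ∉ Q.fsc) ∨
      (v = Δ' k ∧ u = .ty .fin ∧ k ∉ P.fsc) ∨
      (Δ' k = .bot ∧ ∃ α : SessT D, u = .ty α.dual ∧ v = .ty α)) := by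
    intro k
    have hk := hΔ k
    rcases h k with ⟨h₁, h₂, h₃⟩ | ⟨h₁, h₂, h₃⟩ | ⟨h₁, h₂⟩
    · exact ⟨Δ' k, Δ₂ k, h₁ ▸ hk, .refl _, .inl ⟨rfl, h₂, h₃⟩⟩
    · exact ⟨Δ₁ k, Δ' k, .refl _, h₁ ▸ hk, .inr (.inl ⟨rfl, h₂, h₃⟩)⟩
    · refine ⟨Δ₁ k, Δ₂ k, .refl _, .refl _, .inr (.inr ⟨?_, h₂⟩)⟩
      unfold Usage.Le at hk
      grind
  choose Δ₁' Δ₂' h₁ h₂ h₃ using this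
  exact ⟨Δ₁', Δ₂', h₁, h₂, h₃⟩

theorem Proc.RTyped.le {P : Proc D} {Γ : SEnv D} {Δ Δ' : ℕ → Usage D} (h : P.RTyped Γ Δ)
    (hΔ : ∀ k, (Δ k).Le (Δ' k)) : P.RTyped Γ Δ' := by
  induction P generalizing Δ Δ' with
  | par P Q hP hQ =>
    obtain ⟨Δ₁, Δ₂, h₁, h₂, hs⟩ := h
    obtain ⟨Δ₁', Δ₂', h₁', h₂', hs'⟩ := hs.le hΔ
    exact ⟨Δ₁', Δ₂', hP h₁ h₁', hQ h₂ h₂', hs'⟩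
  | res P ih => exact ih h (forall_nat_iff.2 ⟨.refl _, hΔ⟩)
  | _ => exact Leaf.le h hΔ

theorem Proc.Leaf.rTyped {P : Proc D} {Γ : SEnv D} {Δ : ℕ → Usage D} (h : P.Leaf Γ Δ) :
    P.RTyped Γ Δ := by
  induction P generalizing Δ with
  | par P Q hP hQ =>
    obtain ⟨Δ₀, ⟨Δ₁, Δ₂, h₁, h₂, ha⟩, hΔ⟩ := h
    have hs : Share P Q (fun k => .ty (Δ₀ k)) (fun k => .ty (Δ₁ k)) (fun k => .ty (Δ₂ k)) := by
      intro k
      have := ha k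
      grind
    obtain ⟨Δ₁', Δ₂', h₁', h₂', hs'⟩ := hs.le hΔ
    exact ⟨Δ₁', Δ₂', hP ⟨Δ₁, h₁, h₁'⟩, hQ ⟨Δ₂, h₂, h₂'⟩, hs'⟩
  | res P ih =>
    obtain ⟨Δ₀, ⟨-, h⟩, hΔ⟩ := h
    -- The restricted channel is unused, so its type `fin` may be recorded as the `⊥` that a
    -- restriction demands.
    exact ih ⟨_, h, forall_nat_iff.2 ⟨.inr ⟨rfl, rfl⟩, hΔ⟩⟩
  | _ => exact h

theorem Proc.Leaf.fin_le {P : Proc D} {Γ : SEnv D} {Δ : ℕ → Usage D} (h : P.Leaf Γ Δ) {k : ℕ}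
    (hk : k ∉ P.fsc) : Usage.Le (.ty .fin) (Δ k) := by
  obtain ⟨Δ₀, h₀, h₁⟩ := h
  rw [← h₀.eq_fin hk]
  exact h₁ k

theorem Proc.RTyped.fin_le {P : Proc D} {Γ : SEnv D} {Δ : ℕ → Usage D} (h : P.RTyped Γ Δ) {k : ℕ}
    (hk : k ∉ P.fsc) : Usage.Le (.ty .fin) (Δ k) := by
  induction P generalizing Δ k with
  | par P Q hP hQ =>
    obtain ⟨Δ₁, Δ₂, h₁, h₂, hs⟩ := h
    simp only [fsc, Set.mem_union, not_or] at hk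
    rcases hs k with h | h | h
    · rw [← h.1]; exact hP h₁ hk.1
    · rw [← h.1]; exact hQ h₂ hk.2
    · exact .inr ⟨rfl, h.1⟩
  | res P ih => exact ih (k := k + 1) h hk
  | _ => exact Leaf.fin_le h hk

theorem Proc.RTyped.mono {Γ Γ' : SEnv D} (hΓ : ∀ a S, Γ a = some S → Γ' a = some S) {P : Proc D}
    {Δ : ℕ → Usage D} (h : P.RTyped Γ Δ) : P.RTyped Γ' Δ := by
  induction P generalizing Δ with
  | par P Q hP hQ =>
    obtain ⟨Δ₁, Δ₂, h₁, h₂, hs⟩ := h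
    exact ⟨Δ₁, Δ₂, hP h₁, hQ h₂, hs⟩
  | res P ih => exact ih h
  | _ =>
    obtain ⟨Δ₀, h₀, h₁⟩ := h
    exact ⟨Δ₀, h₀.mono hΓ, h₁⟩

/-! ### Running typing under renaming and structural congruence -/

theorem Proc.Leaf_ren {P : Proc D} {ρ : ℕ → ℕ} (hρ : Function.Injective ρ) {Γ : SEnv D}
    {Δ : ℕ → Usage D} :
    (P.ren ρ).Leaf Γ Δ ↔ P.Leaf Γ (Δ ∘ ρ) ∧ ∀ k ∉ Set.range ρ, Usage.Le (.ty .fin) (Δ k) := by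
  constructor
  · rintro ⟨Δ₀, h₀, h₁⟩
    obtain ⟨h₂, h₃⟩ := (STyped_ren hρ).1 h₀
    exact ⟨⟨_, h₂, fun k => h₁ _⟩, fun k hk => h₃ k hk ▸ h₁ k⟩
  · rintro ⟨⟨Δ₀, h₀, h₁⟩, h₂⟩
    have ext' : ∀ k ∉ Set.range ρ, Function.extend ρ Δ₀ (fun _ => .fin) k = .fin :=
      fun k hk => Function.extend_apply' _ _ _ hk
    refine ⟨Function.extend ρ Δ₀ fun _ => .fin,
      (STyped_ren hρ).2 ⟨by rwa [Function.extend_comp hρ], ext'⟩, fun k => ?_⟩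
    by_cases hk : k ∈ Set.range ρ
    · obtain ⟨k, rfl⟩ := hk
      rw [hρ.extend_apply]
      exact h₁ k
    · rw [ext' k hk]
      exact h₂ k hk

theorem Proc.RTyped_ren {P : Proc D} {ρ : ℕ → ℕ} (hρ : Function.Injective ρ) {Γ : SEnv D}
    {Δ : ℕ → Usage D} :
    (P.ren ρ).RTyped Γ Δ ↔ P.RTyped Γ (Δ ∘ ρ) ∧ ∀ k ∉ Set.range ρ, Usage.Le (.ty .fin) (Δ k) := by
  induction P generalizing ρ Δ with
  | par P Q hP hQ =>
    have notMem : ∀ R : Proc D, ∀ k ∉ Set.range ρ, k ∉ (R.ren ρ).fsc := by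
      intro R k hk
      rw [fsc_ren]
      exact fun ⟨j, _, e⟩ => hk ⟨j, e⟩
    constructor
    · rintro ⟨Δ₁, Δ₂, h₁, h₂, hs⟩
      refine ⟨⟨_, _, ((hP hρ).1 h₁).1, ((hQ hρ).1 h₂).1, fun k => ?_⟩, fun k hk => ?_⟩
      · simpa [fsc_ren, hρ.eq_iff] using hs (ρ k)
      · exact RTyped.fin_le (P := .par (P.ren ρ) (Q.ren ρ)) ⟨Δ₁, Δ₂, h₁, h₂, hs⟩
          (not_or.2 ⟨notMem P k hk, notMem Q k hk⟩)
    · rintro ⟨⟨Δ₁, Δ₂, h₁, h₂, hs⟩, h⟩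
      -- Outside the range of `ρ` neither side mentions the channel; the left component is given the
      -- whole usage and the right one `fin`.
      refine ⟨Function.extend ρ Δ₁ Δ, Function.extend ρ Δ₂ fun _ => .ty .fin,
        (hP hρ).2 ⟨by rwa [Function.extend_comp hρ], fun k hk => ?_⟩,
        (hQ hρ).2 ⟨by rwa [Function.extend_comp hρ], fun k hk => ?_⟩, fun k => ?_⟩
      · rw [Function.extend_apply' _ _ _ hk]
        exact h k hk
      · rw [Function.extend_apply' _ _ _ hk]
      · by_cases hk : k ∈ Set.range ρ
        · obtain ⟨k, rfl⟩ := hk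
          simpa [fsc_ren, hρ.eq_iff, hρ.extend_apply] using hs k
        · left
          rw [Function.extend_apply' _ _ _ hk, Function.extend_apply' _ _ _ hk]
          exact ⟨rfl, rfl, notMem Q k hk⟩
  | res P ih =>
    refine (ih (liftRen_injective hρ)).trans (and_congr ?_ ?_)
    · rw [cons_comp_liftRen]; rfl
    · rw [forall_nat_iff]
      have h0 : 0 ∈ Set.range (liftRen ρ) := ⟨0, rfl⟩
      have hs : ∀ n, n + 1 ∈ Set.range (liftRen ρ) ↔ n ∈ Set.range ρ := by
        intro n
        constructor
        · rintro ⟨m, hm⟩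
          cases m with
          | zero => simp at hm
          | succ m => exact ⟨m, by simpa using hm⟩
        · rintro ⟨m, rfl⟩
          exact ⟨m + 1, rfl⟩
      simp [h0, hs]
  | _ => exact Leaf_ren hρ

theorem Proc.RTyped_shift {P : Proc D} {Γ : SEnv D} {Δ : ℕ → Usage D} :
    P.shift.RTyped Γ Δ ↔ P.RTyped Γ (fun k => Δ (k + 1)) ∧ Usage.Le (.ty .fin) (Δ 0) := by
  rw [shift, RTyped_ren Nat.succ_injective]
  refine and_congr Iff.rfl ⟨fun h => h 0 (by simp), fun h k hk => ?_⟩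
  cases k with
  | zero => exact h
  | succ k => exact absurd ⟨k, rfl⟩ hk

theorem Share.symm {P Q : Proc D} {Δ Δ₁ Δ₂ : ℕ → Usage D} (h : Share P Q Δ Δ₁ Δ₂) :
    Share Q P Δ Δ₂ Δ₁ := by
  intro k
  rcases h k with h | h | ⟨h, α, h₁, h₂⟩
  · exact .inr (.inl h)
  · exact .inl h
  · exact .inr (.inr ⟨h, α.dual, by rw [h₂, SessT.dual_dual], h₁⟩)

theorem Proc.RTyped_par_comm {P Q : Proc D} {Γ : SEnv D} {Δ : ℕ → Usage D}
    (h : (Proc.par P Q).RTyped Γ Δ) : (Proc.par Q P).RTyped Γ Δ := by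
  obtain ⟨Δ₁, Δ₂, h₁, h₂, hs⟩ := h
  exact ⟨Δ₂, Δ₁, h₂, h₁, hs.symm⟩

theorem Proc.RTyped_par_assoc {P Q R : Proc D} {Γ : SEnv D} {Δ : ℕ → Usage D}
    (h : (Proc.par P (.par Q R)).RTyped Γ Δ) : (Proc.par (.par P Q) R).RTyped Γ Δ := by
  obtain ⟨Δ₁, Δ', h₁, ⟨Δ₂, Δ₃, h₂, h₃, hs₂⟩, hs₁⟩ := h
  -- `u` is the usage of `P | Q`: it is `⊥` where `P` and `Q` hold the two ends, `fin` where `R`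
  -- owns the channel alone, and otherwise the usage of whichever of `P`, `Q` holds it. A session
  -- with ends in all three components is excluded because `⊥` is not a session type.
  have : ∀ k, ∃ u, ((Δ₁ k = u ∧ Δ₂ k = .ty .fin ∧ k ∉ Q.fsc) ∨
      (Δ₂ k = u ∧ Δ₁ k = .ty .fin ∧ k ∉ P.fsc) ∨
      (u = .bot ∧ ∃ α : SessT D, Δ₁ k = .ty α.dual ∧ Δ₂ k = .ty α)) ∧
      ((u = Δ k ∧ Δ₃ k = .ty .fin ∧ k ∉ R.fsc) ∨
      (Δ₃ k = Δ k ∧ u = .ty .fin ∧ k ∉ (Proc.par P Q).fsc) ∨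
      (Δ k = .bot ∧ ∃ α : SessT D, u = .ty α.dual ∧ Δ₃ k = .ty α)) := by
    intro k
    have a₂ := hs₂ k
    have a₁ : _ ∧ _ ∧ k ∉ Q.fsc ∪ R.fsc ∨ _ := hs₁ k
    simp only [fsc, Set.mem_union] at a₁ ⊢
    rcases a₁ with ⟨e₁, e₂, n⟩ | ⟨e₁, e₂, n⟩ | ⟨e₁, α, e₂, e₃⟩ <;>
    rcases a₂ with ⟨f₁, f₂, m⟩ | ⟨f₁, f₂, m⟩ | ⟨f₁, β, f₂, f₃⟩
    · exact ⟨Δ₁ k, by grind⟩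
    · exact ⟨Δ₁ k, by grind⟩
    · rw [e₂] at f₁; cases f₁
    · exact ⟨Δ₂ k, by grind⟩
    · exact ⟨.ty .fin, by grind⟩
    · exact ⟨Δ₂ k, by grind⟩
    · exact ⟨.bot, by grind⟩
    · exact ⟨Δ₁ k, by grind⟩
    · rw [e₃] at f₁; cases f₁
  choose Δ'' hl hr using this
  exact ⟨Δ'', Δ₃, ⟨Δ₁, Δ₂, h₁, h₂, hl⟩, h₃, hr⟩

theorem Cong.leaf_iff {P Q : Proc D} (h : Cong P Q) {Γ : SEnv D} {Δ : ℕ → Usage D} :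
    P.Leaf Γ Δ ↔ Q.Leaf Γ Δ := by
  simp only [Proc.Leaf, h.sTyped_iff]

theorem SessT.dual_eq_fin {α : SessT D} : α.dual = .fin ↔ α = .fin := by
  cases α <;> simp [dual]

/-- A process without obligations can be dropped from a parallel composition. -/
theorem Share.le_right {P Q : Proc D} {Δ Δ₁ Δ₂ : ℕ → Usage D} (h : Share P Q Δ Δ₁ Δ₂)
    (h₁ : ∀ k, Usage.Le (.ty .fin) (Δ₁ k)) (k : ℕ) : (Δ₂ k).Le (Δ k) := by
  rcases h k with ⟨e₁, e₂, n⟩ | ⟨e₁, e₂, n⟩ | ⟨e₁, α, e₂, e₃⟩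
  · rw [e₂, ← e₁]; exact h₁ k
  · rw [e₁]
  -- Two dual ends of which one is finished are both finished, so the total `⊥` is a relaxation of
  -- `fin`.
  · have := h₁ k
    rw [e₂] at this
    have := this.eq_of_ty
    rw [Usage.ty.injEq, eq_comm, SessT.dual_eq_fin] at this
    rw [e₃, e₁, this]
    exact .inr ⟨rfl, rfl⟩

theorem Cong.rTyped_iff {P Q : Proc D} (h : Cong P Q) {Γ : SEnv D} {Δ : ℕ → Usage D} :
    P.RTyped Γ Δ ↔ Q.RTyped Γ Δ := by
  induction h generalizing Γ Δ with
  | refl => rfl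
  | symm _ ih => exact ih.symm
  | trans _ _ h₁ h₂ => exact h₁.trans h₂
  | par_comm => exact ⟨Proc.RTyped_par_comm, Proc.RTyped_par_comm⟩
  | par_assoc P Q R =>
    refine ⟨Proc.RTyped_par_assoc, fun h => ?_⟩
    exact Proc.RTyped_par_comm
      (Proc.RTyped_par_assoc (Proc.RTyped_par_comm (Proc.RTyped_par_assoc (Proc.RTyped_par_comm h))))
  | par_nil P =>
    constructor
    · intro h
      obtain ⟨Δ₁, Δ₂, h₁, h₂, hs⟩ := Proc.RTyped_par_comm h
      exact h₂.le (hs.le_right fun k => h₁.fin_le id)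
    · refine fun h => ⟨Δ, fun _ => .ty .fin, h, ?_, fun k => .inl ⟨rfl, rfl, id⟩⟩
      exact Proc.Leaf.rTyped (P := .nil) ⟨fun _ => .fin, fun _ => rfl, fun _ => .refl _⟩
  | extrude P Q =>
    constructor
    · rintro ⟨Δ₁, Δ₂, h₁, h₂, hs⟩
      refine ⟨cons (.ty .fin) Δ₁, cons .bot Δ₂, Proc.RTyped_shift.2 ⟨h₁, .refl _⟩, h₂, ?_⟩
      refine forall_nat_iff.2 ⟨.inr (.inl ⟨rfl, rfl, P.zero_notMem_fsc_shift⟩), fun k => ?_⟩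
      simpa [Proc.fsc_shift, Proc.fsc] using hs k
    · rintro ⟨Δ₁, Δ₂, h₁, h₂, hs⟩
      have h₁' := Proc.RTyped_shift.1 h₁
      refine ⟨_, fun k => Δ₂ (k + 1), h₁'.1, Proc.RTyped.le (P := Q) h₂ ?_, fun k => ?_⟩
      -- As `P` does not use the restricted channel, `Q` has it at `⊥`, or at `fin`, which relaxes
      -- to `⊥`.
      · refine forall_nat_iff.2 ⟨?_, fun k => .refl _⟩
        rcases hs 0 with ⟨e₁, e₂, n⟩ | ⟨e₁, e₂, n⟩ | ⟨e₁, α, e₂, e₃⟩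
        · rw [e₂]; exact .inr ⟨rfl, rfl⟩
        · rw [e₁]; rfl
        · have := h₁'.2
          rw [e₂] at this
          have := this.eq_of_ty
          rw [Usage.ty.injEq, eq_comm, SessT.dual_eq_fin] at this
          rw [e₃, this]
          exact .inr ⟨rfl, rfl⟩
      · simpa [Proc.fsc_shift, Proc.fsc] using hs (k + 1)
  | res_nil =>
    constructor
    · rintro ⟨Δ₀, h₀, h₁⟩
      exact ⟨fun k => Δ₀ (k + 1), fun k => h₀ _, fun k => h₁ (k + 1)⟩
    · rintro ⟨Δ₀, h₀, h₁⟩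
      exact ⟨cons .fin Δ₀, forall_nat_iff.2 ⟨rfl, h₀⟩, forall_nat_iff.2 ⟨.inr ⟨rfl, rfl⟩, h₁⟩⟩
  | par h₁ h₂ ih₁ ih₂ => simp only [Proc.RTyped, Share, ih₁, ih₂, h₁.fsc_eq, h₂.fsc_eq]
  | res h ih => exact ih
  | rserv a h _ => exact (Cong.rserv a h).leaf_iff
  | serv a h _ => exact (Cong.serv a h).leaf_iff
  | req a h _ => exact (Cong.req a h).leaf_iff
  | cond e h₁ h₂ => exact (Cong.cond e h₁ h₂).leaf_iff
  | inp k h => exact (Cong.inp k h).leaf_iff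
  | out k e h => exact (Cong.out k e h).leaf_iff
  | inS k h => exact (Cong.inS k h).leaf_iff
  | del k k' h => exact (Cong.del k k' h).leaf_iff
  | bra k I h => exact (Cong.bra k I h).leaf_iff
  | sel k l h => exact (Cong.sel k l h).leaf_iff

/-! ### Forests of label sets -/

/-- All labels in a family of label sets. -/
def allLabels (M : Multiset (Set ℕ)) : Set ℕ := {k | ∃ A ∈ M, k ∈ A}

@[simp] theorem allLabels_zero : allLabels 0 = ∅ := by
  ext; simp [allLabels]

@[simp] theorem allLabels_cons (A : Set ℕ) (M : Multiset (Set ℕ)) :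
    allLabels (A ::ₘ M) = A ∪ allLabels M := by
  ext; simp [allLabels]

/-- Some member of the family shares at most one label with the others. -/
def HasLeaf (M : Multiset (Set ℕ)) : Prop :=
  ∃ A N, M = A ::ₘ N ∧ (A ∩ allLabels N).Subsingleton

/-- The hypergraph that has the members of the family as nodes and the labels as edges is
acyclic. -/
def Forest (M : Multiset (Set ℕ)) : Prop := ∀ N ≤ M, N ≠ 0 → HasLeaf N

theorem Forest.anti {M N : Multiset (Set ℕ)} (h : Forest M) (hN : N ≤ M) : Forest N :=
  fun T hT => h T (hT.trans hN)

theorem forest_zero : Forest 0 := fun _ hN h => absurd (Multiset.le_zero.1 hN) h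

theorem hasLeaf_cons {A : Set ℕ} {M : Multiset (Set ℕ)} : HasLeaf (A ::ₘ M) ↔
    (A ∩ allLabels M).Subsingleton ∨
      ∃ C N, M = C ::ₘ N ∧ (C ∩ (A ∪ allLabels N)).Subsingleton := by
  constructor
  · rintro ⟨C, N, e, h⟩
    rcases Multiset.cons_eq_cons.1 e with ⟨rfl, rfl⟩ | ⟨-, N', rfl, rfl⟩
    · exact .inl h
    · exact .inr ⟨C, N', rfl, by simpa using h⟩
  · rintro (h | ⟨C, N, rfl, h⟩)
    · exact ⟨A, M, rfl, h⟩
    · exact ⟨C, A ::ₘ N, Multiset.cons_swap _ _ _, by simpa using h⟩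

theorem hasLeaf_cons_cons {A B : Set ℕ} {M : Multiset (Set ℕ)} : HasLeaf (A ::ₘ B ::ₘ M) ↔
    (A ∩ (B ∪ allLabels M)).Subsingleton ∨ (B ∩ (A ∪ allLabels M)).Subsingleton ∨
      ∃ C N, M = C ::ₘ N ∧ (C ∩ (A ∪ (B ∪ allLabels N))).Subsingleton := by
  constructor
  · rintro ⟨C, N, e, h⟩
    rcases Multiset.cons_eq_cons.1 e with ⟨rfl, rfl⟩ | ⟨-, N', e', rfl⟩
    · exact .inl (by simpa using h)
    · rcases Multiset.cons_eq_cons.1 e' with ⟨rfl, rfl⟩ | ⟨-, N'', rfl, rfl⟩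
      · exact .inr (.inl (by simpa using h))
      · exact .inr (.inr ⟨C, N'', rfl, by simpa using h⟩)
  · rintro (h | h | ⟨C, N, rfl, h⟩)
    · exact ⟨A, B ::ₘ M, rfl, by simpa using h⟩
    · exact ⟨B, A ::ₘ M, Multiset.cons_swap _ _ _, by simpa using h⟩
    · refine ⟨C, A ::ₘ B ::ₘ N, ?_, by simpa using h⟩
      rw [Multiset.cons_swap B C, Multiset.cons_swap A C]

theorem le_cons_iff {A : Set ℕ} {M T : Multiset (Set ℕ)} :
    T ≤ A ::ₘ M ↔ T ≤ M ∨ ∃ T' ≤ M, T = A ::ₘ T' := by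
  classical
  constructor
  · intro h
    by_cases hA : A ∈ T
    · exact .inr ⟨T.erase A, Multiset.erase_le_iff_le_cons.2 h, (Multiset.cons_erase hA).symm⟩
    · exact .inl ((Multiset.le_cons_of_notMem hA).1 h)
  · rintro (h | ⟨T', h, rfl⟩)
    · exact h.trans (Multiset.le_cons_self _ _)
    · exact (Multiset.cons_le_cons_iff _).2 h

theorem forest_cons {A : Set ℕ} {M : Multiset (Set ℕ)} :
    Forest (A ::ₘ M) ↔ Forest M ∧ ∀ T ≤ M, HasLeaf (A ::ₘ T) := by
  constructor
  · exact fun h => ⟨h.anti (Multiset.le_cons_self _ _), fun T hT =>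
      h _ ((Multiset.cons_le_cons_iff _).2 hT) (Multiset.cons_ne_zero)⟩
  · rintro ⟨h₁, h₂⟩ T hT h0
    rcases le_cons_iff.1 hT with h | ⟨T', h, rfl⟩
    · exact h₁ T h h0
    · exact h₂ T' h

theorem forest_cons_cons {A B : Set ℕ} {M : Multiset (Set ℕ)} :
    Forest (A ::ₘ B ::ₘ M) ↔ Forest M ∧
      ∀ T ≤ M, HasLeaf (A ::ₘ T) ∧ HasLeaf (B ::ₘ T) ∧ HasLeaf (A ::ₘ B ::ₘ T) := by
  rw [forest_cons, forest_cons]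
  constructor
  · rintro ⟨⟨h₁, h₂⟩, h₃⟩
    exact ⟨h₁, fun T hT => ⟨h₃ T (hT.trans (Multiset.le_cons_self _ _)), h₂ T hT,
      h₃ _ ((Multiset.cons_le_cons_iff _).2 hT)⟩⟩
  · rintro ⟨h₁, h₂⟩
    refine ⟨⟨h₁, fun T hT => (h₂ T hT).2.1⟩, fun T hT => ?_⟩
    rcases le_cons_iff.1 hT with h | ⟨T', h, rfl⟩
    · exact (h₂ T h).1
    · exact (h₂ T' h).2.2

/-- The subfamily of just these two nodes has a leaf, and either choice gives the claim. -/
theorem Forest.subsingleton_inter {A B : Set ℕ} {M : Multiset (Set ℕ)}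
    (h : Forest (A ::ₘ B ::ₘ M)) : (A ∩ B).Subsingleton := by
  rcases hasLeaf_cons_cons.1 ((forest_cons_cons.1 h).2 0 (Multiset.zero_le _)).2.2 with
    h | h | ⟨C, N, h, -⟩
  · simpa using h
  · rw [Set.inter_comm]; simpa using h
  · exact absurd h (Multiset.cons_ne_zero).symm

theorem Forest.subset {A A' : Set ℕ} {M : Multiset (Set ℕ)} (h : Forest (A ::ₘ M)) (hA : A' ⊆ A) :
    Forest (A' ::ₘ M) := by
  rw [forest_cons] at h ⊢
  refine ⟨h.1, fun T hT => ?_⟩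
  rcases hasLeaf_cons.1 (h.2 T hT) with h' | ⟨C, N, rfl, h'⟩
  · exact hasLeaf_cons.2 (.inl (h'.anti (Set.inter_subset_inter_left _ hA)))
  · exact hasLeaf_cons.2 (.inr ⟨C, N, rfl, h'.anti
      (Set.inter_subset_inter_right _ (Set.union_subset_union_left _ hA))⟩)

/-- Two nodes that share an edge can be merged. -/
theorem Forest.merge {A B : Set ℕ} {M : Multiset (Set ℕ)} {x : ℕ} (h : Forest (A ::ₘ B ::ₘ M))
    (hA : x ∈ A) (hB : x ∈ B) : Forest ((A ∪ B) ::ₘ M) := by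
  -- If `A` is the leaf, its only contact with `B` and `T` is `x`, which also lies in `B`. So the
  -- merged node meets `T` exactly where `B` does, and a leaf of `B ::ₘ T` yields one of the merged
  -- family.
  have key : ∀ {A B : Set ℕ} {T : Multiset (Set ℕ)}, x ∈ A → x ∈ B → HasLeaf (B ::ₘ T) →
      (A ∩ (B ∪ allLabels T)).Subsingleton → HasLeaf ((A ∪ B) ::ₘ T) := by
    intro A B T hA hB hBT hl
    have hx : ∀ y ∈ A, y ∈ B ∪ allLabels T → y = x := fun y hy hy' =>
      hl ⟨hy, hy'⟩ ⟨hA, .inl hB⟩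
    rcases hasLeaf_cons.1 hBT with h | ⟨C, N, rfl, h⟩
    · refine hasLeaf_cons.2 (.inl (h.anti ?_))
      rintro y ⟨hy | hy, hyT⟩
      · obtain rfl := hx y hy (.inr hyT)
        exact ⟨hB, hyT⟩
      · exact ⟨hy, hyT⟩
    · refine hasLeaf_cons.2 (.inr ⟨C, N, rfl, h.anti ?_⟩)
      rintro y ⟨hy, (hyA | hyB) | hyN⟩
      · obtain rfl := hx y hyA (.inr (by simp [hy]))
        exact ⟨hy, .inl hB⟩
      · exact ⟨hy, .inl hyB⟩
      · exact ⟨hy, .inr hyN⟩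
  rw [forest_cons_cons] at h
  refine forest_cons.2 ⟨h.1, fun T hT => ?_⟩
  obtain ⟨h₁, h₂, h₃⟩ := h.2 T hT
  rcases hasLeaf_cons_cons.1 h₃ with h | h | ⟨C, N, rfl, h⟩
  · exact key hA hB h₂ h
  · rw [Set.union_comm]
    exact key hB hA h₁ h
  · exact hasLeaf_cons.2 (.inr ⟨C, N, rfl, by rwa [Set.union_assoc]⟩)

/-- A node can be split in two that share at most one edge. -/
theorem Forest.split {A B : Set ℕ} {M : Multiset (Set ℕ)} (h : Forest ((A ∪ B) ::ₘ M))
    (hAB : (A ∩ B).Subsingleton) : Forest (A ::ₘ B ::ₘ M) := by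
  have hA := (forest_cons.1 (h.subset Set.subset_union_left)).2
  have hB := (forest_cons.1 (h.subset Set.subset_union_right)).2
  rw [forest_cons] at h
  refine forest_cons_cons.2 ⟨h.1, fun T hT => ⟨hA T hT, hB T hT, ?_⟩⟩
  rcases hasLeaf_cons.1 (h.2 T hT) with h | ⟨C, N, rfl, h⟩
  -- Here the union is the leaf. If its one contact with `T` lies in `A` but outside `B`, then `B`
  -- does not meet `T` and is a leaf. Otherwise `A` meets `T` only inside `A ∩ B`, and `A` is a
  -- leaf.
  · by_cases hx : ∃ x ∈ A, x ∉ B ∧ x ∈ allLabels T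
    · obtain ⟨x, hxA, hxB, hxT⟩ := hx
      refine hasLeaf_cons_cons.2 (.inr (.inl ?_))
      refine (Set.inter_comm A B ▸ hAB).anti ?_
      rintro y ⟨hyB, hyA | hyT⟩
      · exact ⟨hyB, hyA⟩
      · have : y = x := h ⟨.inr hyB, hyT⟩ ⟨.inl hxA, hxT⟩
        exact absurd (this ▸ hyB) hxB
    · refine hasLeaf_cons_cons.2 (.inl (hAB.anti ?_))
      rintro y ⟨hyA, hyB | hyT⟩
      · exact ⟨hyA, hyB⟩
      · exact ⟨hyA, not_not.1 fun hyB => hx ⟨y, hyA, hyB, hyT⟩⟩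
  · exact hasLeaf_cons_cons.2 (.inr (.inr ⟨C, N, rfl, by rwa [Set.union_assoc] at h⟩))

/-- A node can be given a new label. -/
theorem Forest.insert_label {A : Set ℕ} {M : Multiset (Set ℕ)} {x : ℕ} (h : Forest (A ::ₘ M))
    (hx : x ∉ allLabels M) : Forest (insert x A ::ₘ M) := by
  have hx' : ∀ {T : Multiset (Set ℕ)}, T ≤ M → x ∉ allLabels T :=
    fun hT ⟨B, hB, hxB⟩ => hx ⟨B, Multiset.mem_of_le hT hB, hxB⟩
  rw [forest_cons] at h ⊢
  refine ⟨h.1, fun T hT => ?_⟩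
  rcases hasLeaf_cons.1 (h.2 T hT) with h' | ⟨C, N, rfl, h'⟩
  · refine hasLeaf_cons.2 (.inl (h'.anti ?_))
    rintro y ⟨rfl | hy, hyT⟩
    · exact absurd hyT (hx' hT)
    · exact ⟨hy, hyT⟩
  · refine hasLeaf_cons.2 (.inr ⟨C, N, rfl, h'.anti ?_⟩)
    rintro y ⟨hyC, (rfl | hy) | hyN⟩
    · exact absurd (by simp [hyC]) (hx' hT)
    · exact ⟨hyC, .inl hy⟩
    · exact ⟨hyC, .inr hyN⟩

theorem forest_map {f : Set ℕ → Set ℕ} (hf : ∀ A M, (A ∩ allLabels M).Subsingleton →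
      (f A ∩ allLabels (M.map f)).Subsingleton) {M : Multiset (Set ℕ)} (h : Forest M) :
    Forest (M.map f) := by
  intro N hN h0
  obtain ⟨N', hN', rfl⟩ : ∃ N' ≤ M, N = N'.map f := by
    clear h h0
    induction M using Multiset.induction generalizing N with
    | empty => exact ⟨0, le_rfl, by simpa using hN⟩
    | cons A M ih =>
      rw [Multiset.map_cons] at hN
      rcases le_cons_iff.1 hN with h | ⟨T, h, rfl⟩
      · obtain ⟨N', h, e⟩ := ih N h
        exact ⟨N', h.trans (Multiset.le_cons_self _ _), e⟩
      · obtain ⟨N', h', rfl⟩ := ih T h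
        exact ⟨A ::ₘ N', (Multiset.cons_le_cons_iff _).2 h', by simp⟩
  obtain ⟨A, T, rfl, hA⟩ := h N' hN' (by rintro rfl; exact h0 rfl)
  exact ⟨f A, T.map f, by simp, hf _ _ hA⟩

/-- The label sets below one further binder, whose label they do not mention. -/
def up (A : Set ℕ) : Set ℕ := Nat.succ '' A

@[simp] theorem down_up (A : Set ℕ) : down (up A) = A :=
  Set.preimage_image_eq A Nat.succ_injective

@[simp] theorem zero_notMem_up (A : Set ℕ) : 0 ∉ up A := by simp [up]

@[simp] theorem succ_mem_up {A : Set ℕ} {n : ℕ} : n + 1 ∈ up A ↔ n ∈ A :=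
  Nat.succ_injective.mem_set_image

theorem up_down {A : Set ℕ} (h : 0 ∉ A) : up (down A) = A := by
  ext n
  cases n with
  | zero => simp [h]
  | succ n => simp

theorem Forest.map_down {M : Multiset (Set ℕ)} (h : Forest M) : Forest (M.map down) := by
  refine forest_map (fun A M hA x hx y hy => ?_) h
  have key : ∀ {x}, x ∈ allLabels (M.map down) → x + 1 ∈ allLabels M := by
    rintro x ⟨B, hB, hx⟩
    obtain ⟨B, hB', rfl⟩ := Multiset.mem_map.1 hB
    exact ⟨B, hB', hx⟩
  exact Nat.succ_injective (hA ⟨hx.1, key hx.2⟩ ⟨hy.1, key hy.2⟩)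

theorem Forest.map_up {M : Multiset (Set ℕ)} (h : Forest M) : Forest (M.map up) := by
  refine forest_map (fun A M hA => ?_) h
  refine (hA.image Nat.succ).anti ?_
  rintro _ ⟨⟨x, hx, rfl⟩, ⟨B, hB, hxB⟩⟩
  obtain ⟨B, hB', rfl⟩ := Multiset.mem_map.1 hB
  exact ⟨x, ⟨hx, B, hB', succ_mem_up.1 hxB⟩, rfl⟩

@[simp] theorem map_down_map_up (M : Multiset (Set ℕ)) : (M.map up).map down = M := by
  simp [Multiset.map_map]

theorem map_up_map_down {M : Multiset (Set ℕ)} (h : 0 ∉ allLabels M) :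
    (M.map down).map up = M := by
  rw [Multiset.map_map]
  refine (Multiset.map_congr rfl fun A hA => ?_).trans (Multiset.map_id _)
  exact up_down fun h0 => h ⟨A, hA, h0⟩

theorem zero_notMem_allLabels_map_up (M : Multiset (Set ℕ)) : 0 ∉ allLabels (M.map up) := by
  rintro ⟨A, hA, h0⟩
  obtain ⟨B, -, rfl⟩ := Multiset.mem_map.1 hA
  exact zero_notMem_up B h0

theorem allLabels_add (M N : Multiset (Set ℕ)) :
    allLabels (M + N) = allLabels M ∪ allLabels N := by
  ext; simp [allLabels, or_and_right, exists_or]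

/-! #### Contraction of an edge -/

open Classical in
/-- The nodes that have the label `0`. -/
noncomputable def ends (M : Multiset (Set ℕ)) : Multiset (Set ℕ) := M.filter (0 ∈ ·)

open Classical in
/-- The nodes that do not have the label `0`. -/
noncomputable def rest (M : Multiset (Set ℕ)) : Multiset (Set ℕ) := M.filter (0 ∉ ·)

open Classical in
/-- Contracts the edge `0`. -/
noncomputable def contract (M : Multiset (Set ℕ)) : Multiset (Set ℕ) :=
  (if ends M = 0 then 0 else {down (allLabels (ends M))}) + (rest M).map down

/-- Nodes that share the label `0` share no other label. -/
def Cut (M : Multiset (Set ℕ)) : Prop :=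
  ∀ A B N, ends M = A ::ₘ B ::ₘ N → A ∩ B ⊆ {0}

theorem ends_add_rest (M : Multiset (Set ℕ)) : ends M + rest M = M := by
  classical exact Multiset.filter_add_not _ _

theorem zero_mem_of_mem_ends {M : Multiset (Set ℕ)} {A : Set ℕ} (h : A ∈ ends M) : 0 ∈ A := by
  classical exact (Multiset.mem_filter.1 h).2

theorem zero_notMem_rest (M : Multiset (Set ℕ)) : 0 ∉ allLabels (rest M) := by
  classical exact fun ⟨_, hA, h0⟩ => (Multiset.mem_filter.1 hA).2 h0

theorem ends_le (M : Multiset (Set ℕ)) : ends M ≤ M := by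
  classical exact Multiset.filter_le _ _

theorem ends_eq_zero {M : Multiset (Set ℕ)} (h : 0 ∉ allLabels M) : ends M = 0 := by
  classical exact Multiset.filter_eq_nil.2 fun A hA h0 => h ⟨A, hA, h0⟩

theorem rest_eq_self {M : Multiset (Set ℕ)} (h : 0 ∉ allLabels M) : rest M = M := by
  classical exact Multiset.filter_eq_self.2 fun A hA h0 => h ⟨A, hA, h0⟩

theorem ends_add (M N : Multiset (Set ℕ)) : ends (M + N) = ends M + ends N := by
  classical exact Multiset.filter_add _ _ _

theorem rest_add (M N : Multiset (Set ℕ)) : rest (M + N) = rest M + rest N := by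
  classical exact Multiset.filter_add _ _ _

theorem ends_map_up_add (M N : Multiset (Set ℕ)) : ends (M.map up + N) = ends N := by
  rw [ends_add, ends_eq_zero (zero_notMem_allLabels_map_up M), zero_add]

theorem contract_map_up_add (M N : Multiset (Set ℕ)) :
    contract (M.map up + N) = M + contract N := by
  rw [contract, ends_map_up_add, rest_add, rest_eq_self (zero_notMem_allLabels_map_up M),
    Multiset.map_add, map_down_map_up, contract]
  abel

theorem cut_map_up_add {M N : Multiset (Set ℕ)} : Cut (M.map up + N) ↔ Cut N := by
  rw [Cut, ends_map_up_add, Cut]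

theorem contract_of_zero_notMem {M : Multiset (Set ℕ)} (h : 0 ∉ allLabels M) :
    contract M = M.map down := by
  rw [contract, ends_eq_zero h, rest_eq_self h, if_pos rfl, zero_add]

theorem cut_of_zero_notMem {M : Multiset (Set ℕ)} (h : 0 ∉ allLabels M) : Cut M := by
  intro A B N hM
  rw [ends_eq_zero h] at hM
  exact absurd hM.symm (Multiset.cons_ne_zero)

/-- Two nodes with label `0` already share it, and nodes of a forest share at most one label. -/
theorem Forest.cut {M : Multiset (Set ℕ)} (h : Forest M) : Cut M := by
  intro A B N hM y hy
  have hA : A ∈ ends M := by simp [hM]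
  have hB : B ∈ ends M := by simp [hM]
  exact (hM ▸ h.anti (ends_le M)).subsingleton_inter hy
    ⟨zero_mem_of_mem_ends hA, zero_mem_of_mem_ends hB⟩

/-- The nodes are merged one after another along their common label `0`. -/
theorem Forest.merge_all {Z M : Multiset (Set ℕ)} (h : Forest (Z + M)) (hZ : ∀ A ∈ Z, 0 ∈ A)
    (h0 : Z ≠ 0) : Forest (allLabels Z ::ₘ M) := by
  induction Z using Multiset.induction generalizing M with
  | empty => exact absurd rfl h0
  | cons A Z ih =>
    by_cases hz : Z = 0
    · subst hz
      rw [allLabels_cons, allLabels_zero, Set.union_empty]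
      simpa using h
    · have h' : Forest (allLabels Z ::ₘ A ::ₘ M) :=
        ih (by rwa [Multiset.cons_add, ← Multiset.add_cons] at h)
          (fun B hB => hZ B (Multiset.mem_cons_of_mem hB)) hz
      obtain ⟨B, hB⟩ := Multiset.exists_mem_of_ne_zero hz
      rw [allLabels_cons, Set.union_comm]
      exact h'.merge ⟨B, hB, hZ B (Multiset.mem_cons_of_mem hB)⟩
        (hZ A (Multiset.mem_cons_self _ _))

/-- A node meets the union of the others only in `0`, so it can be split off from that union; the
rest follows by induction. -/
theorem Forest.split_all {Z M : Multiset (Set ℕ)} (h : Forest (allLabels Z ::ₘ M))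
    (hZ : ∀ A B N, Z = A ::ₘ B ::ₘ N → A ∩ B ⊆ {0}) : Forest (Z + M) := by
  induction Z using Multiset.induction generalizing M with
  | empty => exact h.anti (by simpa using Multiset.le_cons_self _ _)
  | cons A Z ih =>
    rw [allLabels_cons] at h
    have hA : A ∩ allLabels Z ⊆ {0} := by
      rintro y ⟨hy, B, hB, hyB⟩
      obtain ⟨N, rfl⟩ := Multiset.exists_cons_of_mem hB
      exact hZ A B N rfl ⟨hy, hyB⟩
    have h' := h.split (Set.subsingleton_singleton.anti hA)
    rw [Multiset.cons_swap] at h'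
    rw [Multiset.cons_add, ← Multiset.add_cons]
    refine ih h' fun B C N hN => ?_
    subst hN
    refine hZ B C (A ::ₘ N) ?_
    rw [Multiset.cons_swap A B, Multiset.cons_swap A C]

theorem Forest.contract {M N : Multiset (Set ℕ)} (h : Forest (M + N.map up)) :
    Forest (contract M + N) := by
  by_cases hM : ends M = 0
  · have hr : rest M = M := by rw [← ends_add_rest M, hM, zero_add, rest_eq_self (zero_notMem_rest M)]
    simpa [SessPi.contract, hM, hr] using h.map_down
  · rw [← ends_add_rest M, add_assoc] at h
    have := (h.merge_all (fun A hA => zero_mem_of_mem_ends hA) hM).map_down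
    simpa [SessPi.contract, hM] using this

/-- Contraction forgets how the nodes at the hidden edge overlapped. `Cut` says that they overlapped
only there, which is what splitting requires; the forest of the contracted family alone would not
suffice. -/
theorem Forest.of_contract {M N : Multiset (Set ℕ)} (h : Forest (SessPi.contract M + N))
    (hM : Cut M) : Forest (M + N.map up) := by
  by_cases h0 : ends M = 0
  · have hr : rest M = M := by rw [← ends_add_rest M, h0, zero_add, rest_eq_self (zero_notMem_rest M)]
    have := h.map_up
    rwa [SessPi.contract, if_pos h0, zero_add, Multiset.map_add,
      map_up_map_down (zero_notMem_rest M), hr] at this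
  · have := h.map_up
    rw [SessPi.contract, if_neg h0, add_assoc, Multiset.singleton_add, Multiset.map_cons,
      Multiset.map_add, map_up_map_down (zero_notMem_rest M)] at this
    rw [← ends_add_rest M, add_assoc]
    -- After the shift no node carries `0`, so it can be added to the merged node as a fresh label
    -- before splitting.
    refine Forest.split_all ((this.insert_label (x := 0) ?_).subset ?_) hM
    · rw [allLabels_add]
      exact not_or.2 ⟨zero_notMem_rest M, zero_notMem_allLabels_map_up N⟩
    · intro n hn
      cases n with
      | zero => simp
      | succ n => exact .inr (by simpa using hn)

/-! ### Subject reduction -/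

/-- A channel that both sides mention cannot be owned by one of them. Types other than `fin` do not
relax to `⊥`, so the recorded usages are the exact types of the two ends. -/
theorem Share.dual_of_leaf {P Q : Proc D} {Δ Δ₁ Δ₂ : ℕ → Usage D} (h : Share P Q Δ Δ₁ Δ₂)
    {δ₁ δ₂ : SessT D} {k : ℕ} (h₁ : Usage.Le (.ty δ₁) (Δ₁ k)) (h₂ : Usage.Le (.ty δ₂) (Δ₂ k))
    (hP : k ∈ P.fsc) (hQ : k ∈ Q.fsc) (n₁ : δ₁ ≠ .fin) (n₂ : δ₂ ≠ .fin) :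
    Δ k = .bot ∧ δ₁ = δ₂.dual := by
  rcases h k with h | h | ⟨h, α, e₁, e₂⟩
  · exact absurd hQ h.2.2
  · exact absurd hP h.2.2
  · rw [h₁.eq_of_ne (by simpa using n₁)] at e₁
    rw [h₂.eq_of_ne (by simpa using n₂)] at e₂
    cases e₁
    cases e₂
    exact ⟨h, rfl⟩

/-- One interaction on `k`: the two ends advance to a new dual pair while the total stays `⊥`. -/
theorem Share.update {P P' Q Q' : Proc D} {Δ Δ₁ Δ₂ : ℕ → Usage D} (h : Share P Q Δ Δ₁ Δ₂) {k : ℕ}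
    (hk : Δ k = .bot) (hP : P'.fsc ⊆ P.fsc) (hQ : Q'.fsc ⊆ Q.fsc) (α : SessT D) :
    Share P' Q' Δ (Function.update Δ₁ k (.ty α.dual)) (Function.update Δ₂ k (.ty α)) := by
  intro j
  by_cases e : j = k
  · subst e
    exact .inr (.inr ⟨hk, α, by simp⟩)
  · rw [Function.update_of_ne e, Function.update_of_ne e]
    rcases h j with ⟨e₁, e₂, n⟩ | ⟨e₁, e₂, n⟩ | h
    · exact .inl ⟨e₁, e₂, fun h => n (hQ h)⟩
    · exact .inr (.inl ⟨e₁, e₂, fun h => n (hP h)⟩)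
    · exact .inr (.inr h)

theorem le_update {Δ₀ : ℕ → SessT D} {Δ : ℕ → Usage D} (h : ∀ k, Usage.Le (.ty (Δ₀ k)) (Δ k))
    (k : ℕ) {α : SessT D} {u : Usage D} (hu : Usage.Le (.ty α) u) (j : ℕ) :
    Usage.Le (.ty (Function.update Δ₀ k α j)) (Function.update Δ k u j) := by
  by_cases e : j = k
  · subst e; simpa using hu
  · simpa [e] using h j

theorem SessT.inVal_ne_fin (S : ValT D) (α : SessT D) : SessT.inVal S α ≠ .fin := by
  cases S <;> simp [inVal]

theorem SessT.outVal_ne_fin (S : ValT D) (α : SessT D) : SessT.outVal S α ≠ .fin := by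
  cases S <;> simp [outVal]

theorem SessT.dual_outVal (S : ValT D) (α : SessT D) :
    (SessT.outVal S α).dual = .inVal S α.dual := by
  cases S <;> rfl

theorem SessT.dual_inVal (S : ValT D) (α : SessT D) :
    (SessT.inVal S α).dual = .outVal S α.dual := by
  cases S <;> rfl

theorem SessT.inVal_inj {S S' : ValT D} {α α' : SessT D} (h : SessT.inVal S α = .inVal S' α') :
    S = S' ∧ α = α' := by
  cases S <;> cases S' <;> simp_all [inVal]

/-- The two parties of a new session. -/
theorem Proc.STyped.link {P Q : Proc D} {Γ : SEnv D} {α : SessT D} {Δ₀ : ℕ → SessT D}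
    {Δ : ℕ → Usage D} (hP : P.STyped Γ (cons α fun _ => .fin)) (hf : ∀ k, k + 1 ∉ P.fsc)
    (hQ : Q.STyped Γ (cons α.dual Δ₀)) (hΔ : ∀ k, Usage.Le (.ty (Δ₀ k)) (Δ k)) :
    (Proc.res (.par P Q)).RTyped Γ Δ := by
  refine ⟨cons (.ty α) fun _ => .ty .fin, cons (.ty α.dual) Δ, Leaf.rTyped ⟨_, hP, ?_⟩,
    Leaf.rTyped ⟨_, hQ, ?_⟩, ?_⟩
  · exact forall_nat_iff.2 ⟨.refl _, fun _ => .refl _⟩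
  · exact forall_nat_iff.2 ⟨.refl _, hΔ⟩
  · exact forall_nat_iff.2 ⟨.inr (.inr ⟨rfl, α.dual, by simp⟩), fun k => .inr (.inl ⟨rfl, rfl, hf k⟩)⟩

/-- The usage of `k'` passes from the sender to the receiver. The receiver did not hold `k'` before,
so the total usage of `k'` is that of the sender, up to relaxing `fin`. -/
theorem Proc.RTyped.del {P Q : Proc D} {Γ : SEnv D} {k k' : ℕ} {Δ : ℕ → Usage D}
    (h : (Proc.par (.inS k P) (.del k k' Q)).RTyped Γ Δ) (hk' : k' + 1 ∉ P.fsc) :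
    (Proc.par (P.instSession k') Q).RTyped Γ Δ := by
  obtain ⟨Δ₁, Δ₂, ⟨Δ₁₀, ⟨β, α, e₁, hP⟩, l₁⟩, ⟨Δ₂₀, ⟨β', α', e₂, e', hne, hf, hQ⟩, l₂⟩, hs⟩ := h
  obtain ⟨hb, he⟩ := hs.dual_of_leaf (l₁ k) (l₂ k) (by simp [fsc]) (by simp [fsc])
    (by simp [e₁]) (by simp [e₂])
  simp only [e₁, e₂, SessT.dual, SessT.inSess.injEq] at he
  obtain ⟨rfl, rfl⟩ := he
  have hf' : k' ∉ (Proc.inS k P).fsc := by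
    rintro (h | h)
    · exact hne h.symm
    · exact hk' h
  have hfin : Δ₁₀ k' = .fin := STyped.eq_fin (P := .inS k P) ⟨β, _, e₁, hP⟩ hf'
  -- If both sides count as holding an end of `k'`, the unmentioned one on the receiver's side is
  -- `fin`; by duality `β` is `fin` too.
  have hβ : Usage.Le (.ty β) (Δ k') := by
    rcases hs k' with h | h | ⟨h, γ, h₁, h₂⟩
    · exact absurd (by simp [fsc]) h.2.2
    · rw [← h.1, ← e']; exact l₂ k'
    · have := l₁ k'
      rw [h₁, hfin] at this
      have := this.eq_of_ty
      rw [Usage.ty.injEq, eq_comm, SessT.dual_eq_fin] at this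
      have h₃ := l₂ k'
      rw [e', h₂, this] at h₃
      rw [h₃.eq_of_ty, h]
      exact .inr ⟨rfl, rfl⟩
  -- The receiver takes the whole recorded usage `Δ k'`, which may be `⊥`, and the sender is left
  -- with `fin`.
  refine ⟨Function.update (Function.update Δ₁ k (.ty α'.dual)) k' (Δ k'),
    Function.update (Function.update Δ₂ k (.ty α')) k' (.ty .fin),
    Leaf.rTyped ⟨_, hP.instSession hk', le_update (le_update l₁ k (.refl _)) k' hβ⟩,
    Leaf.rTyped ⟨_, hQ, le_update (le_update l₂ k (.refl _)) k' (.refl _)⟩, fun j => ?_⟩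
  by_cases e : j = k'
  · subst e
    exact .inl (by simpa using hf)
  · rw [Function.update_of_ne e, Function.update_of_ne e]
    have hsub : (P.instSession k').fsc \ {k'} ⊆ (Proc.inS k P).fsc := by
      rintro j ⟨hj, hne⟩
      rw [instSession, fsc_ren] at hj
      obtain ⟨m, hm, rfl⟩ := hj
      cases m with
      | zero => simp at hne
      | succ m => exact .inr hm
    have hsub' : Q.fsc ⊆ (Proc.del k k' Q).fsc := Set.subset_union_right
    rcases hs.update (P' := .inS k P) hb subset_rfl hsub' α' j with h | ⟨h₁, h₂, h₃⟩ | h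
    · exact .inl h
    · exact .inr (.inl ⟨h₁, h₂, fun h => h₃ (hsub ⟨h, e⟩)⟩)
    · exact .inr (.inr h)

/-- The session environment does not change: an interaction happens on a session of which the redex
holds both ends, so its total is `⊥` before and after. -/
theorem Red.rTyped {P P' : Proc D} (h : Red P P') {Γ : SEnv D} {Δ : ℕ → Usage D}
    (hP : P.RTyped Γ Δ) : P'.RTyped Γ Δ := by
  induction h generalizing Δ with
  | rinit a P Q =>
    obtain ⟨Δ₁, Δ₂, h₁, ⟨Δ₀, ⟨α', ha', hQ⟩, l₂⟩, hs⟩ := hP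
    obtain ⟨Δ₁₀, ⟨α, ha, hfin, hf, hP⟩, l₁⟩ := id h₁
    obtain rfl : α = α' := by simpa [ha] using ha'
    refine ⟨Δ₁, Δ₂, h₁, hP.link hf hQ l₂, fun k => ?_⟩
    rcases hs k with h | h | h
    · refine .inl ⟨h.1, h.2.1, ?_⟩
      rintro (h' | h')
      · exact hf k h'
      · exact h.2.2 h'
    · exact .inr (.inl h)
    · exact .inr (.inr h)
  | link a P Q =>
    obtain ⟨Δ₁, Δ₂, ⟨Δ₁₀, ⟨α, ha, hfin, hf, hP⟩, l₁⟩, ⟨Δ₀, ⟨α', ha', hQ⟩, l₂⟩, hs⟩ := hP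
    obtain rfl : α = α' := by simpa [ha] using ha'
    -- The consumed service had no obligations, so the requester's usages account for the total.
    refine hP.link hf hQ fun k => (l₂ k).trans (hs.le_right (fun k => ?_) k)
    rw [← hfin k]
    exact l₁ k
  | com k P e v Q hv =>
    obtain ⟨Δ₁, Δ₂, ⟨Δ₁₀, ⟨S, α, e₁, hP⟩, l₁⟩, ⟨Δ₂₀, ⟨S', α', e₂, he, hQ⟩, l₂⟩, hs⟩ := hP
    obtain ⟨hb, hd⟩ := hs.dual_of_leaf (l₁ k) (l₂ k) (by simp [Proc.fsc]) (by simp [Proc.fsc])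
      (by rw [e₁]; exact SessT.inVal_ne_fin _ _) (by rw [e₂]; exact SessT.outVal_ne_fin _ _)
    rw [e₁, e₂, SessT.dual_outVal] at hd
    obtain ⟨rfl, rfl⟩ := SessT.inVal_inj hd
    refine ⟨_, _, Proc.Leaf.rTyped ⟨_, hP.instVal (hv.vTyped he), le_update l₁ k (.refl _)⟩,
      Proc.Leaf.rTyped ⟨_, hQ, le_update l₂ k (.refl _)⟩, hs.update hb ?_ ?_ α'⟩
    · rw [Proc.instVal, Proc.fsc_subst]; exact Set.subset_union_right
    · exact Set.subset_union_right
  | del k k' P Q hk' => exact hP.del hk'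
  | sel k I P l Q hl =>
    obtain ⟨Δ₁, Δ₂, ⟨Δ₁₀, ⟨hI, α, e₁, hP⟩, l₁⟩, ⟨Δ₂₀, ⟨I', hI', α', hl', e₂, hQ⟩, l₂⟩, hs⟩ := hP
    obtain ⟨hb, hd⟩ := hs.dual_of_leaf (l₁ k) (l₂ k) (by simp [Proc.fsc]) (by simp [Proc.fsc])
      (by simp [e₁]) (by simp [e₂])
    simp only [e₁, e₂, SessT.dual, SessT.bra.injEq] at hd
    obtain ⟨rfl, hd⟩ := hd
    obtain rfl := eq_of_heq hd
    refine ⟨_, _, Proc.Leaf.rTyped ⟨_, hP ⟨l, hl⟩, le_update l₁ k (.refl _)⟩,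
      Proc.Leaf.rTyped ⟨_, hQ, le_update l₂ k (.refl _)⟩, hs.update hb ?_ ?_ _⟩
    · exact fun j hj => .inr (Set.mem_iUnion.2 ⟨_, hj⟩)
    · exact Set.subset_union_right
  | par Q h ih =>
    obtain ⟨Δ₁, Δ₂, h₁, h₂, hs⟩ := hP
    refine ⟨Δ₁, Δ₂, ih h₁, h₂, fun k => ?_⟩
    exact (hs k).imp_right fun h' => h'.imp_left fun h'' =>
      ⟨h''.1, h''.2.1, fun hk => h''.2.2 (h.fsc_subset hk)⟩
  | res _ ih => exact ih hP
  | str h₁ _ h₂ ih => exact h₂.rTyped_iff.1 (ih (h₁.rTyped_iff.1 hP))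
  | ifT e v P Q =>
    obtain ⟨Δ₀, ⟨-, h, -⟩, l⟩ := hP
    exact Proc.Leaf.rTyped ⟨_, h, l⟩
  | ifF e v P Q =>
    obtain ⟨Δ₀, ⟨-, -, h⟩, l⟩ := hP
    exact Proc.Leaf.rTyped ⟨_, h, l⟩

/-! ### Acyclicity of running processes -/

/-- The label sets of the top-level prefixes, where the prefixes that share a restricted channel
are merged. -/
noncomputable def Proc.labels : Proc D → Multiset (Set ℕ)
  | .nil => 0
  | .par P Q => P.labels + Q.labels
  | .res P => contract P.labels
  | P => {P.fsc}

/-- At every top-level restriction, the processes that share the restricted channel share no other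
channel. -/
def Proc.Cuts : Proc D → Prop
  | .par P Q => P.Cuts ∧ Q.Cuts
  | .res P => P.Cuts ∧ Cut P.labels
  | _ => True

theorem allLabels_map_image (M : Multiset (Set ℕ)) (g : ℕ → ℕ) :
    allLabels (M.map (g '' ·)) = g '' allLabels M := by
  ext n
  simp only [allLabels, Multiset.mem_map, Set.mem_image]
  constructor
  · rintro ⟨_, ⟨A, hA, rfl⟩, ⟨m, hm, rfl⟩⟩
    exact ⟨m, ⟨A, hA, hm⟩, rfl⟩
  · rintro ⟨m, ⟨A, hA, hm⟩, rfl⟩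
    exact ⟨_, ⟨A, hA, rfl⟩, ⟨m, hm, rfl⟩⟩

theorem zero_mem_image_liftRen {ρ : ℕ → ℕ} {A : Set ℕ} : 0 ∈ liftRen ρ '' A ↔ 0 ∈ A := by
  constructor
  · rintro ⟨m, hm, e⟩
    cases m with
    | zero => exact hm
    | succ m => simp at e
  · exact fun h => ⟨0, h, rfl⟩

theorem ends_map_image_liftRen (M : Multiset (Set ℕ)) (ρ : ℕ → ℕ) :
    ends (M.map (liftRen ρ '' ·)) = (ends M).map (liftRen ρ '' ·) := by
  classical
  simp only [ends, Multiset.filter_map]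
  congr 1
  exact Multiset.filter_congr fun A _ => zero_mem_image_liftRen

theorem rest_map_image_liftRen (M : Multiset (Set ℕ)) (ρ : ℕ → ℕ) :
    rest (M.map (liftRen ρ '' ·)) = (rest M).map (liftRen ρ '' ·) := by
  classical
  simp only [rest, Multiset.filter_map]
  congr 1
  exact Multiset.filter_congr fun A _ => not_congr zero_mem_image_liftRen

theorem contract_map_image_liftRen (M : Multiset (Set ℕ)) (ρ : ℕ → ℕ) :
    contract (M.map (liftRen ρ '' ·)) = (contract M).map (ρ '' ·) := by
  have hd : ∀ A, down (liftRen ρ '' A) = ρ '' down A := down_image_liftRen ρ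
  simp only [contract, ends_map_image_liftRen, rest_map_image_liftRen, allLabels_map_image,
    Multiset.map_eq_zero, hd, Multiset.map_add, Multiset.map_map, Function.comp_def]
  split_ifs <;> simp

theorem cut_map_image_liftRen {M : Multiset (Set ℕ)} {ρ : ℕ → ℕ} (hρ : Function.Injective ρ) :
    Cut (M.map (liftRen ρ '' ·)) ↔ Cut M := by
  classical
  simp only [Cut, ends_map_image_liftRen]
  constructor
  · intro h A B N e x hx
    have := @h (liftRen ρ '' A) (liftRen ρ '' B) (N.map (liftRen ρ '' ·)) (by simp [e])
      (liftRen ρ x) ⟨⟨x, hx.1, rfl⟩, ⟨x, hx.2, rfl⟩⟩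
    cases x with
    | zero => rfl
    | succ x => simp at this
  · intro h A B N e
    obtain ⟨A, hA, rfl, e'⟩ := (Multiset.map_eq_cons _ _ _ _).2 e
    obtain ⟨B, hB, rfl, -⟩ := (Multiset.map_eq_cons _ _ _ _).2 e'
    rw [← Set.image_inter (liftRen_injective hρ)]
    have := h A B (((ends M).erase A).erase B)
      (by rw [Multiset.cons_erase hB, Multiset.cons_erase hA])
    rintro _ ⟨x, hx, rfl⟩
    rw [this hx]
    rfl

theorem Proc.labels_ren (P : Proc D) (ρ : ℕ → ℕ) :
    (P.ren ρ).labels = P.labels.map (ρ '' ·) := by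
  induction P generalizing ρ with
  | nil => rfl
  | par P Q hP hQ => simp only [ren, labels, hP, hQ, Multiset.map_add]
  | res P ih => simp only [ren, labels, ih, contract_map_image_liftRen]
  | _ => exact congrArg _ (fsc_ren _ ρ)

theorem Proc.labels_shift (P : Proc D) : P.shift.labels = P.labels.map up := P.labels_ren _

theorem Proc.cuts_ren {P : Proc D} {ρ : ℕ → ℕ} (hρ : Function.Injective ρ) :
    (P.ren ρ).Cuts ↔ P.Cuts := by
  induction P generalizing ρ with
  | par P Q hP hQ => simp only [ren, Cuts, hP hρ, hQ hρ]
  | res P ih =>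
    simp only [ren, Cuts, ih (liftRen_injective hρ), labels_ren, cut_map_image_liftRen hρ]
  | _ => exact Iff.rfl

/-- Contraction affects only the nodes labelled `0`, and a process that is moved under a restriction
has none, which settles scope extrusion. -/
theorem Cong.labels_eq {P Q : Proc D} (h : Cong P Q) : P.labels = Q.labels := by
  have one : ∀ {A B : Set ℕ}, A = B → ({A} : Multiset (Set ℕ)) = {B} := congrArg _
  induction h with
  | refl => rfl
  | symm _ ih => exact ih.symm
  | trans _ _ h₁ h₂ => exact h₁.trans h₂
  | par_comm => exact add_comm _ _
  | par_assoc => exact (add_assoc _ _ _).symm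
  | par_nil => exact add_zero _
  | extrude P Q => simp only [Proc.labels, Proc.labels_shift, contract_map_up_add]
  | res_nil =>
    simp [Proc.labels, contract_of_zero_notMem]
  | par _ _ ih₁ ih₂ => simp only [Proc.labels, ih₁, ih₂]
  | res _ ih => simp only [Proc.labels, ih]
  | rserv a h _ => exact one (Cong.rserv a h).fsc_eq
  | serv a h _ => exact one (Cong.serv a h).fsc_eq
  | req a h _ => exact one (Cong.req a h).fsc_eq
  | cond e h₁ h₂ => exact one (Cong.cond e h₁ h₂).fsc_eq
  | inp k h => exact one (Cong.inp k h).fsc_eq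
  | out k e h => exact one (Cong.out k e h).fsc_eq
  | inS k h => exact one (Cong.inS k h).fsc_eq
  | del k k' h => exact one (Cong.del k k' h).fsc_eq
  | bra k I h => exact one (Cong.bra k I h).fsc_eq
  | sel k l h => exact one (Cong.sel k l h).fsc_eq

theorem Cong.cuts_iff {P Q : Proc D} (h : Cong P Q) : P.Cuts ↔ Q.Cuts := by
  induction h with
  | refl => rfl
  | symm _ ih => exact ih.symm
  | trans _ _ h₁ h₂ => exact h₁.trans h₂
  | par_comm => exact and_comm
  | par_assoc => exact and_assoc.symm
  | par_nil => exact and_iff_left trivial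
  | extrude P Q =>
    simp only [Proc.Cuts, Proc.labels, Proc.labels_shift, cut_map_up_add, and_assoc]
    exact and_congr_left fun _ => (Proc.cuts_ren Nat.succ_injective).symm
  | res_nil => simp [Proc.Cuts, Proc.labels, cut_of_zero_notMem]
  | par _ _ ih₁ ih₂ => simp only [Proc.Cuts, ih₁, ih₂]
  | res h ih => simp only [Proc.Cuts, ih, h.labels_eq]
  | _ => exact Iff.rfl

theorem allLabels_contract_subset {M : Multiset (Set ℕ)} :
    allLabels (contract M) ⊆ down (allLabels M) := by
  have h₁ : allLabels (ends M) ⊆ allLabels M := fun k ⟨A, hA, hk⟩ =>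
    ⟨A, Multiset.mem_of_le (ends_le M) hA, hk⟩
  have h₂ : allLabels ((rest M).map down) ⊆ down (allLabels M) := by
    rintro k ⟨A, hA, hk⟩
    obtain ⟨A, hA', rfl⟩ := Multiset.mem_map.1 hA
    refine ⟨A, ?_, hk⟩
    rw [← ends_add_rest M]
    exact Multiset.mem_add.2 (.inr hA')
  rw [contract, allLabels_add]
  refine Set.union_subset ?_ h₂
  split_ifs
  · simp
  · rw [← Multiset.cons_zero, allLabels_cons, allLabels_zero, Set.union_empty]
    exact fun k hk => h₁ hk

theorem Proc.allLabels_labels_subset (P : Proc D) : allLabels P.labels ⊆ P.fsc := by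
  induction P with
  | nil => simp [labels]
  | par P Q hP hQ =>
    rw [labels, allLabels_add]
    exact Set.union_subset_union hP hQ
  | res P ih => exact allLabels_contract_subset.trans fun k hk => ih hk
  | _ => simp [labels, ← Multiset.cons_zero]

/-- The top-level prefixes of a linearly typed process share no channels. -/
theorem Proc.STyped.forest {P : Proc D} {Γ : SEnv D} {Δ : ℕ → SessT D} (h : P.STyped Γ Δ) :
    P.Cuts ∧ ∀ {N}, Forest (P.fsc ::ₘ N) → Forest (P.labels + N) := by
  induction P generalizing Δ with
  | nil => exact ⟨trivial, fun {N} hN => hN.anti (by simpa [labels] using Multiset.le_cons_self _ _)⟩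
  | par P Q hP hQ =>
    have hd := h.notMem_inter
    obtain ⟨Δ₁, Δ₂, h₁, h₂, ha⟩ := h
    refine ⟨⟨(hP h₁).1, (hQ h₂).1⟩, fun {N} hN => ?_⟩
    -- Linear components have disjoint label sets, so splitting their union is allowed.
    have := (hP h₁).2 (hN.split (A := P.fsc) (B := Q.fsc) fun k hk => (hd k hk).elim)
    rw [Multiset.add_cons] at this
    have := (hQ h₂).2 this
    rwa [labels, add_assoc, add_left_comm]
  | res P ih =>
    obtain ⟨h₀, h⟩ := h
    have h0 : 0 ∉ allLabels P.labels := fun h => h₀ (P.allLabels_labels_subset h)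
    refine ⟨⟨(ih h).1, cut_of_zero_notMem h0⟩, fun {N} hN => Forest.contract ((ih h).2 ?_)⟩
    have := hN.map_up
    rw [Multiset.map_cons] at this
    rwa [show (Proc.res P).fsc = down P.fsc from rfl, up_down h₀] at this
  | _ => exact ⟨trivial, id⟩

/-! ### Preservation of acyclicity under reduction -/

theorem Proc.STyped.forest_add {P Q : Proc D} {Γ Γ' : SEnv D} {Δ Δ' : ℕ → SessT D}
    (hP : P.STyped Γ Δ) (hQ : Q.STyped Γ' Δ') {N : Multiset (Set ℕ)}
    (h : Forest (P.fsc ::ₘ Q.fsc ::ₘ N)) : Forest (P.labels + Q.labels + N) := by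
  have := hP.forest.2 h
  rw [Multiset.add_cons] at this
  have := hQ.forest.2 this
  rwa [add_assoc, add_left_comm]

theorem Proc.STyped.forest_of_subset {P Q : Proc D} {Γ Γ' : SEnv D} {Δ Δ' : ℕ → SessT D}
    (hP : P.STyped Γ Δ) (hQ : Q.STyped Γ' Δ') {A B : Set ℕ} (hA : P.fsc ⊆ A) (hB : Q.fsc ⊆ B) :
    (P.Cuts ∧ Q.Cuts) ∧ ∀ {N}, Forest (A ::ₘ B ::ₘ N) → Forest (P.labels + Q.labels + N) := by
  refine ⟨⟨hP.forest.1, hQ.forest.1⟩, fun {N} h => hP.forest_add hQ ?_⟩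
  have := h.subset hA
  rw [Multiset.cons_swap] at this
  have := this.subset hB
  rwa [Multiset.cons_swap]

/-- Sender and receiver are adjacent through `k`, so they may be merged, and the merged node does
not depend on which of them holds `k'`. It can be split with `k'` on the other side, because `k' ∉
B` adds nothing to the overlap. -/
theorem Forest.delegate {A B : Set ℕ} {M : Multiset (Set ℕ)} {k k' : ℕ}
    (h : Forest (A ::ₘ insert k' B ::ₘ M)) (hA : k ∈ A) (hB : k ∈ B) (hk : k' ∉ B) :
    Forest (insert k' A ::ₘ B ::ₘ M) := by
  have hs := h.subsingleton_inter
  refine Forest.split ?_ ?_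
  · have := h.merge hA (.inr hB)
    rwa [Set.union_insert, ← Set.insert_union] at this
  · rw [Set.insert_inter_of_notMem hk]
    exact hs.anti (Set.inter_subset_inter_right _ (Set.subset_insert _ _))

/-- The service body mentions only the new channel `0`, so it becomes a pendant node: the
requester's node receives the fresh label `0`, and `{0}` is split off from it. -/
theorem Proc.STyped.forest_link {P Q : Proc D} {Γ Γ' : SEnv D} {Δ Δ' : ℕ → SessT D}
    (hP : P.STyped Γ Δ) (hQ : Q.STyped Γ' Δ') (hf : ∀ k, k + 1 ∉ P.fsc) :
    (P.Cuts ∧ Q.Cuts) ∧ ∀ {N}, Forest (down Q.fsc ::ₘ N) →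
      Forest (P.labels + Q.labels + N.map up) := by
  refine ⟨⟨hP.forest.1, hQ.forest.1⟩, fun {N} hN => ?_⟩
  have h := (hN.map_up)
  rw [Multiset.map_cons] at h
  have h := h.insert_label (x := 0) (zero_notMem_allLabels_map_up N)
  have h₁ : Forest (({0} ∪ insert 0 (up (down Q.fsc))) ::ₘ N.map up) :=
    h.subset (by simp)
  have h₂ := (h₁.split (Set.subsingleton_singleton.anti Set.inter_subset_left)).subset
    (A' := P.fsc) (by intro k hk; cases k with | zero => rfl | succ k => exact absurd hk (hf k))
  rw [Multiset.cons_swap] at h₂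
  have h₃ := h₂.subset (A' := Q.fsc)
    (by intro k hk; cases k with | zero => simp | succ k => exact .inr (by simpa using hk))
  rw [Multiset.cons_swap] at h₃
  exact hP.forest_add hQ h₃

theorem Proc.fsc_instSession_subset (P : Proc D) (k' : ℕ) :
    (P.instSession k').fsc ⊆ insert k' (down P.fsc) := by
  rw [instSession, fsc_ren]
  rintro _ ⟨m, hm, rfl⟩
  cases m with
  | zero => exact .inl rfl
  | succ m => exact .inr hm

/-- The claim for every surrounding family `N` says that the redex can be replaced in place; this
lets the induction pass through parallel composition and restriction. -/
theorem Red.forest {P P' : Proc D} (h : Red P P') {Γ : SEnv D} {Δ : ℕ → Usage D}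
    (hP : P.RTyped Γ Δ) (hc : P.Cuts) (hF : Forest P.labels) :
    P'.Cuts ∧ ∀ {N}, Forest (P.labels + N) → Forest (P'.labels + N) := by
  induction h generalizing Δ with
  | rinit a P Q =>
    obtain ⟨Δ₁, Δ₂, ⟨Δ₁₀, ⟨α, ha, hfin, hf, hP⟩, l₁⟩, ⟨Δ₀, ⟨α', ha', hQ⟩, l₂⟩, hs⟩ := hP
    have key : ∀ {N}, Forest ((Proc.par (.rserv a P) (.req a Q)).labels + N) →
        Forest (P.labels + Q.labels + (((Proc.rserv a P).labels + N).map up)) := by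
      intro N hN
      refine (hP.forest_link hQ hf).2 ?_
      have : Forest ((Proc.rserv a P).labels + (Proc.req a Q).labels + N) := hN
      rw [add_right_comm, add_comm] at this
      exact this
    refine ⟨⟨trivial, (hP.forest_link hQ hf).1, ?_⟩, fun {N} hN => ?_⟩
    · exact ((key (N := 0) (by simpa using hF)).anti (Multiset.le_add_right _ _)).cut
    · have := (key hN).contract
      rw [← add_assoc, add_comm (contract _)] at this
      exact this
  | link a P Q =>
    obtain ⟨Δ₁, Δ₂, ⟨Δ₁₀, ⟨α, ha, hfin, hf, hP⟩, l₁⟩, ⟨Δ₀, ⟨α', ha', hQ⟩, l₂⟩, hs⟩ := hP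
    have key : ∀ {N}, Forest ((Proc.par (.serv a P) (.req a Q)).labels + N) →
        Forest (P.labels + Q.labels + N.map up) := by
      intro N hN
      refine (hP.forest_link hQ hf).2 (hN.anti ?_)
      change _ ≤ {(Proc.serv a P).fsc} + {down Q.fsc} + N
      rw [add_assoc, Multiset.singleton_add, Multiset.singleton_add]
      exact Multiset.le_cons_self _ _
    refine ⟨⟨(hP.forest_link hQ hf).1, ?_⟩, fun {N} hN => (key hN).contract⟩
    exact ((key (N := 0) (by simpa using hF)).anti (Multiset.le_add_right _ _)).cut
  | com k P e v Q hv =>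
    obtain ⟨Δ₁, Δ₂, ⟨Δ₁₀, ⟨S, α, e₁, hP⟩, l₁⟩, ⟨Δ₂₀, ⟨S', α', e₂, he, hQ⟩, l₂⟩, hs⟩ := hP
    obtain ⟨hb, hd⟩ := hs.dual_of_leaf (l₁ k) (l₂ k) (by simp [Proc.fsc]) (by simp [Proc.fsc])
      (by rw [e₁]; exact SessT.inVal_ne_fin _ _) (by rw [e₂]; exact SessT.outVal_ne_fin _ _)
    rw [e₁, e₂, SessT.dual_outVal] at hd
    obtain ⟨rfl, rfl⟩ := SessT.inVal_inj hd
    have := (hP.instVal (hv.vTyped he)).forest_of_subset hQ (A := (Proc.inp k P).fsc) (B := (Proc.out k e Q).fsc) 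
      (by rw [Proc.instVal, Proc.fsc_subst]; exact Set.subset_union_right) Set.subset_union_right
    refine ⟨this.1, fun {N} hN => this.2 ?_⟩
    rw [← Multiset.singleton_add, ← Multiset.singleton_add, ← add_assoc]
    exact hN
  | del k k' P Q hk' =>
    obtain ⟨Δ₁, Δ₂, ⟨Δ₁₀, ⟨β, α, e₁, hP⟩, l₁⟩, ⟨Δ₂₀, ⟨β', α', e₂, e', hne, hf, hQ⟩, l₂⟩, hs⟩ := hP
    -- The label sets after the exchange: `k'` is added to the receiver's prefix and removed from
    -- the sender's.
    have := (hP.instSession hk').forest_of_subset hQ (A := insert k' (Proc.inS k P).fsc)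
      (B := insert k Q.fsc)
      ((P.fsc_instSession_subset k').trans (Set.insert_subset_insert Set.subset_union_right))
      (Set.subset_insert _ _)
    refine ⟨this.1, fun {N} hN => this.2 (Forest.delegate ?_ (.inl rfl) (.inl rfl) ?_)⟩
    · rw [Set.insert_comm, ← Multiset.singleton_add, ← Multiset.singleton_add, ← add_assoc]
      convert hN using 1
      simp only [Proc.labels, Proc.fsc, Set.insert_union, Set.singleton_union]
    · rintro (h | h)
      · exact hne h.symm
      · exact hf h
  | sel k I P l Q hl =>
    obtain ⟨Δ₁, Δ₂, ⟨Δ₁₀, ⟨hI, α, e₁, hP⟩, l₁⟩, ⟨Δ₂₀, ⟨I', hI', α', hl', e₂, hQ⟩, l₂⟩, hs⟩ := hP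
    have := (hP ⟨l, hl⟩).forest_of_subset hQ (A := (Proc.bra k I P).fsc) (B := (Proc.sel k l Q).fsc) 
      (fun j hj => .inr (Set.mem_iUnion.2 ⟨_, hj⟩)) Set.subset_union_right
    refine ⟨this.1, fun {N} hN => this.2 ?_⟩
    rw [← Multiset.singleton_add, ← Multiset.singleton_add, ← add_assoc]
    exact hN
  | par Q h ih =>
    obtain ⟨Δ₁, Δ₂, h₁, h₂, hs⟩ := hP
    have hF' := hF.anti (Multiset.le_add_right _ _)
    refine ⟨⟨(ih h₁ hc.1 hF').1, hc.2⟩, fun {N} hN => ?_⟩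
    have := (ih h₁ hc.1 hF').2 (N := Proc.labels Q + N)
    rw [← add_assoc, ← add_assoc] at this
    exact this hN
  | res _ ih =>
    -- The contraction is undone with `Cuts`, the reduct is handled below the restriction, and the
    -- edge is contracted again.
    have key := fun {N} hN => Forest.of_contract (N := N) hN hc.2
    have hF' := key (N := 0) (by rw [add_zero]; exact hF)
    have ih' := ih hP hc.1 (by simpa using hF')
    exact ⟨⟨ih'.1, (ih'.2 (N := 0) hF').anti (Multiset.le_add_right _ _) |>.cut⟩,
      fun {N} hN => (ih'.2 (key hN)).contract⟩
  | str h₁ _ h₂ ih =>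
    have ih' := ih (h₁.rTyped_iff.1 hP) (h₁.cuts_iff.1 hc) (h₁.labels_eq ▸ hF)
    rw [h₁.labels_eq, ← h₂.labels_eq, ← h₂.cuts_iff]
    exact ih'
  | ifT e v P Q =>
    obtain ⟨Δ₀, ⟨-, h, -⟩, l⟩ := hP
    exact ⟨h.forest.1, fun {N} hN => h.forest.2 (Forest.subset hN Set.subset_union_left)⟩
  | ifF e v P Q =>
    obtain ⟨Δ₀, ⟨-, -, h⟩, l⟩ := hP
    exact ⟨h.forest.1, fun {N} hN => h.forest.2 (Forest.subset hN Set.subset_union_right)⟩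

/-! ### Partners for open sessions -/

/-- All free public names are service channels. -/
def SEnv.Services (Γ : SEnv D) : Prop := ∀ a S, Γ a = some S → ∃ α, S = .serv α

/-- Free names are channels, so an expression of basic type has no names standing for data and
evaluates to a constant. That second part is what makes the induction pass through operations, which
need constants as arguments. -/
theorem ETyped.exists_eval {Γ : SEnv D} (hΓ : Γ.Services) {e : Expr D} {S : ValT D}
    (h : ETyped Γ e S) : ∃ v, Eval e v ∧ ∀ b, S = .base b → ∃ w, v = .lit b w := by
  induction h with
  | name h =>
    obtain ⟨α, rfl⟩ := hΓ _ _ h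
    exact ⟨_, .name _, by simp⟩
  | lit b v =>
    refine ⟨_, .lit b v, ?_⟩
    rintro _ ⟨⟩
    exact ⟨v, rfl⟩
  | op f args _ ih =>
    have : ∀ i, ∃ w, Eval (args i) (.lit (D.dom f i) w) := by
      intro i
      obtain ⟨v, hv, h⟩ := ih i
      obtain ⟨w, rfl⟩ := h _ rfl
      exact ⟨w, hv⟩
    choose w hw using this
    refine ⟨_, .op f args w hw, ?_⟩
    rintro _ ⟨⟩
    exact ⟨_, rfl⟩

/-- The types of the service channels that an inhabitant of a session type needs. -/
def SessT.needs : SessT D → Set (SessT D)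
  | .inBase _ α => α.needs
  | .inServ _ α => α.needs
  | .inSess β α => β.needs ∪ α.needs
  | .outBase _ α => α.needs
  | .outServ β α => {β} ∪ α.needs
  | .outSess β α => {β.dual} ∪ α.needs
  | .bra _ _ α => ⋃ i, (α i).needs
  | .sel _ _ α => ⋃ i, (α i).needs
  | .fin => ∅

theorem SessT.finite_needs (α : SessT D) : α.needs.Finite := by
  induction α with
  | inBase b α h => exact h
  | inServ β α _ h => exact h
  | inSess β α h₁ h₂ => exact h₁.union h₂
  | outBase b α h => exact h
  | outServ β α _ h => exact (Set.finite_singleton _).union h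
  | outSess β α _ h => exact (Set.finite_singleton _).union h
  | bra I hI α h => exact Set.finite_iUnion h
  | sel I hI α h => exact Set.finite_iUnion h
  | fin => exact Set.finite_empty

/-- There are service channels of all types in `N`. -/
def SEnv.Provides (Γ : SEnv D) (N : Set (SessT D)) : Prop :=
  ∀ α ∈ N, ∃ a, Γ a = some (.serv α)

theorem SEnv.Provides.anti {Γ : SEnv D} {N N' : Set (SessT D)} (h : Γ.Provides N) (hN : N' ⊆ N) :
    Γ.Provides N' := fun α hα => h α (hN hα)

theorem SEnv.Provides.cons {Γ : SEnv D} {N : Set (SessT D)} (h : Γ.Provides N)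
    (S : Option (ValT D)) : SEnv.Provides (cons S Γ) N := by
  intro α hα
  obtain ⟨a, ha⟩ := h α hα
  exact ⟨a + 1, ha⟩

/-- A finite environment leaves names free, and each missing type is assigned to one of them. -/
theorem SEnv.exists_provides {Γ : SEnv D} (hf : {a | Γ a ≠ none}.Finite) (hs : Γ.Services)
    {N : Set (SessT D)} (hN : N.Finite) :
    ∃ Γ' : SEnv D, (∀ a S, Γ a = some S → Γ' a = some S) ∧ {a | Γ' a ≠ none}.Finite ∧
      Γ'.Services ∧ Γ'.Provides N := by
  induction N, hN using Set.Finite.induction_on with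
  | empty => exact ⟨Γ, fun _ _ h => h, hf, hs, fun _ h => absurd h id⟩
  | @insert β N _ _ ih =>
    obtain ⟨Γ', h₁, h₂, h₃, h₄⟩ := ih
    obtain ⟨a, ha⟩ := h₂.exists_notMem
    have ha : Γ' a = none := not_not.1 ha
    have hle : ∀ c S, Γ' c = some S → Function.update Γ' a (some (.serv β)) c = some S := by
      intro c S hc
      rw [Function.update_of_ne]
      · exact hc
      · rintro rfl
        simp [ha] at hc
    refine ⟨Function.update Γ' a (some (.serv β)), fun c S hc => hle c S (h₁ c S hc), ?_, ?_, ?_⟩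
    · refine (h₂.insert a).subset fun c hc => ?_
      by_cases e : c = a
      · exact .inl e
      · refine .inr ?_
        change Function.update _ _ _ _ ≠ _ at hc
        rwa [Function.update_of_ne e] at hc
    · intro c S hc
      by_cases e : c = a
      · subst e
        simp only [Function.update_self, Option.some.injEq] at hc
        exact ⟨β, hc.symm⟩
      · rw [Function.update_of_ne e] at hc
        exact h₃ c S hc
    · rintro α (rfl | hα)
      · exact ⟨a, by simp⟩
      · obtain ⟨c, hc⟩ := h₄ α hα
        exact ⟨c, hle c _ hc⟩

/-- There is a process whose only session is of type `α`. -/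
def Inhab (Γ : SEnv D) (α : SessT D) : Prop :=
  ∃ P : Proc D, P.STyped Γ (cons α fun _ => .fin) ∧ ∀ k, k + 1 ∉ P.fsc

@[simp] theorem update_cons_zero {α : Type} (x y : α) (f : ℕ → α) :
    Function.update (cons x f) 0 y = cons y f := by
  funext n; cases n <;> simp

@[simp] theorem update_cons_succ {α : Type} (x y : α) (f : ℕ → α) (k : ℕ) :
    Function.update (cons x f) (k + 1) y = cons x (Function.update f k y) := by
  funext n
  cases n with
  | zero => simp
  | succ n => simp [Function.update_apply]

/-- Recursion on the type. Received values are ignored, and a received session is served in parallel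
with the continuation. To delegate a session of type `β`, a new one is requested from a service of
type `β.dual`: the requester's end then has type `β`. -/
theorem SessT.inhab {α : SessT D} {Γ : SEnv D} (h : Γ.Provides α.needs) : Inhab Γ α := by
  have inp : ∀ {S : ValT D} {α : SessT D} {Γ : SEnv D}, Inhab (cons (some S) Γ) α →
      Inhab Γ (.inVal S α) := by
    rintro S α Γ ⟨P, h, hf⟩
    exact ⟨.inp 0 P, ⟨S, α, rfl, by simpa using h⟩, fun k => by simpa [Proc.fsc] using hf k⟩
  have out : ∀ {S : ValT D} {α : SessT D} {Γ : SEnv D} {e : Expr D}, ETyped Γ e S → Inhab Γ α →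
      Inhab Γ (.outVal S α) := by
    rintro S α Γ e he ⟨P, h, hf⟩
    exact ⟨.out 0 e P, ⟨S, α, rfl, he, by simpa using h⟩, fun k => by simpa [Proc.fsc] using hf k⟩
  induction α generalizing Γ with
  | inBase b α ih => exact inp (S := .base b) (ih (h.cons _))
  | inServ β α _ ih => exact inp (S := .serv β) (ih (h.cons _))
  | outBase b α ih =>
    obtain ⟨v⟩ := D.inhabited b
    exact out (S := .base b) (.lit b v) (ih h)
  | outServ β α _ ih =>
    obtain ⟨a, ha⟩ := h β (.inl rfl)
    exact out (S := .serv β) (.name ha) (ih (h.anti Set.subset_union_right))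
  | inSess β α ih₁ ih₂ =>
    obtain ⟨P, hP, hPf⟩ := ih₁ (h.anti Set.subset_union_left)
    obtain ⟨Q, hQ, hQf⟩ := ih₂ (h.anti Set.subset_union_right)
    -- Below the binder the received session has index `0` and the old one index `1`, hence the
    -- shift of `Q`.
    refine ⟨.inS 0 (.par P Q.shift), ⟨β, α, rfl, _, _, hP,
      Proc.STyped_shift (Δ := cons .fin (cons α fun _ => .fin)).2 ⟨hQ, rfl⟩, ?_⟩, fun k => ?_⟩
    · refine forall_nat_iff.2 ⟨.inl ⟨rfl, rfl, Q.zero_notMem_fsc_shift⟩, fun k => .inr ⟨?_, rfl, hPf k⟩⟩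
      simp
    · simp [Proc.fsc, Proc.fsc_shift, hPf, hQf]
  | outSess β α _ ih =>
    obtain ⟨P, hP, hPf⟩ := ih (h.anti Set.subset_union_right)
    obtain ⟨a, ha⟩ := h β.dual (.inl rfl)
    -- Below the request, index `1` is the given session and index `0` the one just obtained and
    -- passed on.
    refine ⟨.req a (.del 1 0 P.shift), ⟨_, ha, β, α, rfl, by simp, by simp,
      P.zero_notMem_fsc_shift, Proc.STyped_shift.2 ⟨?_, by simp⟩⟩, fun k => ?_⟩
    · have : Function.update (cons (SessT.outSess β α) fun _ => .fin) 0 α = cons α fun _ => .fin :=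
        update_cons_zero _ _ _
      rw [show (1 : ℕ) = 0 + 1 from rfl, update_cons_succ, this, update_cons_zero]
      exact hP
    · simp [Proc.fsc, Proc.fsc_shift, hPf]
  | bra I hI α ih =>
    have := fun i => ih i (h.anti (Set.subset_iUnion (fun i => (α i).needs) i))
    choose P hP hf using this
    exact ⟨.bra 0 I P, ⟨hI, α, rfl, fun i => by simpa using hP i⟩,
      fun k => by simpa [Proc.fsc] using fun l hl => hf ⟨l, hl⟩ k⟩
  | sel I hI α ih =>
    obtain ⟨l, hl⟩ := id hI
    obtain ⟨P, hP, hf⟩ := ih ⟨l, hl⟩ (h.anti (Set.subset_iUnion (fun i => (α i).needs) _))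
    exact ⟨.sel 0 l P, ⟨I, hI, α, hl, rfl, by simpa using hP⟩,
      fun k => by simpa [Proc.fsc] using hf k⟩
  | fin => exact ⟨.nil, forall_nat_iff.2 ⟨rfl, fun _ => rfl⟩, fun _ => id⟩

/-- The session channel of the interactions on a session. -/
def Proc.subject : Proc D → Option ℕ
  | .inp k _ => some k
  | .out k _ _ => some k
  | .inS k _ => some k
  | .del k _ _ => some k
  | .bra k _ _ => some k
  | .sel k _ _ => some k
  | _ => none

theorem Proc.subject_mem {T : Proc D} {s : ℕ} (h : T.subject = some s) : s ∈ T.fsc := by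
  cases T <;> simp_all [subject, fsc]

/-- The process can be reduced. -/
def Reduces (P : Proc D) : Prop := ∃ R, Red P R

theorem Reduces.of_cong {P Q : Proc D} (h : Reduces Q) (hc : Cong P Q) : Reduces P := by
  obtain ⟨R, hR⟩ := h
  exact ⟨R, .str hc hR (.refl _)⟩

theorem Reduces.par {P : Proc D} (h : Reduces P) (Q : Proc D) : Reduces (.par P Q) := by
  obtain ⟨R, hR⟩ := h
  exact ⟨_, hR.par Q⟩

theorem Reduces.comm {P Q : Proc D} (h : Reduces (.par P Q)) : Reduces (.par Q P) :=
  h.of_cong (.par_comm _ _)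

/-- The kind of interaction that a session type begins with. -/
def SessT.kind : SessT D → ℕ
  | .inBase _ _ | .inServ _ _ => 1
  | .outBase _ _ | .outServ _ _ => 2
  | .inSess _ _ => 3
  | .outSess _ _ => 4
  | .bra _ _ _ => 5
  | .sel _ _ _ => 6
  | .fin => 0

/-- The kind of interaction that a prefix offers on its subject. -/
def Proc.kind : Proc D → ℕ
  | .inp _ _ => 1
  | .out _ _ _ => 2
  | .inS _ _ => 3
  | .del _ _ _ => 4
  | .bra _ _ _ => 5
  | .sel _ _ _ => 6
  | _ => 0

/-- The kind of the dual interaction. -/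
def dualKind : ℕ → ℕ
  | 1 => 2
  | 2 => 1
  | 3 => 4
  | 4 => 3
  | 5 => 6
  | 6 => 5
  | n => n

theorem SessT.kind_dual (α : SessT D) : α.dual.kind = dualKind α.kind := by
  cases α <;> rfl

theorem Proc.STyped.kind_eq {T : Proc D} {Γ : SEnv D} {Δ : ℕ → SessT D} {s : ℕ}
    (h : T.STyped Γ Δ) (hs : T.subject = some s) : (Δ s).kind = T.kind := by
  cases T <;> simp only [subject, reduceCtorEq, Option.some.injEq] at hs <;> subst hs
  · obtain ⟨S, α, e, -⟩ := h
    rw [e]; cases S <;> rfl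
  · obtain ⟨S, α, e, -⟩ := h
    rw [e]; cases S <;> rfl
  · obtain ⟨_, _, e, -⟩ := h
    rw [e]; rfl
  · obtain ⟨_, _, e, -⟩ := h
    rw [e]; rfl
  · obtain ⟨_, _, e, -⟩ := h
    rw [e]; rfl
  · obtain ⟨_, _, _, _, e, -⟩ := h
    rw [e]; rfl

theorem Proc.STyped.subject_ne_fin {T : Proc D} {Γ : SEnv D} {Δ : ℕ → SessT D} {s : ℕ}
    (h : T.STyped Γ Δ) (hs : T.subject = some s) : Δ s ≠ .fin := by
  intro e
  have := h.kind_eq hs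
  rw [e] at this
  cases T <;> simp [subject, kind, SessT.kind] at hs this

/-- For every interaction on a session there is a process that offers the dual interaction. -/
theorem exists_partner {T : Proc D} {Γ : SEnv D} {Δ : ℕ → SessT D} {s : ℕ} (hΓ : Γ.Services)
    (hT : T.STyped Γ Δ) (hs : T.subject = some s) :
    ∃ N : Set (SessT D), N.Finite ∧ ∀ Γ' : SEnv D, Γ'.Provides N → ∀ j, ∃ (Q : Proc D) (Δ' : _),
      Q.subject = some 0 ∧ Q.STyped Γ' Δ' ∧ Δ' 0 = (Δ s).dual ∧ Q.fsc ⊆ {0, j + 1} ∧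
      ∀ σ : ℕ → ℕ, σ 0 = s → σ (j + 1) ∉ T.fsc → Reduces (.par T (Q.ren σ)) := by
  cases T <;> simp only [Proc.subject, reduceCtorEq, Option.some.injEq] at hs <;> subst hs
  case inp k P =>
    obtain ⟨S, α, e, -⟩ := hT
    have main : ∀ {Γ' : SEnv D} {E : Expr D} {v : Val D} (j : ℕ), ETyped Γ' E S → Eval E v →
        Inhab Γ' α.dual → ∃ (Q : Proc D) (Δ' : _),
        Q.subject = some 0 ∧ Q.STyped Γ' Δ' ∧ Δ' 0 = (Δ k).dual ∧ Q.fsc ⊆ {0, j + 1} ∧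
        ∀ σ : ℕ → ℕ, σ 0 = k → σ (j + 1) ∉ (Proc.inp k P).fsc →
          Reduces (.par (.inp k P) (Q.ren σ)) := by
      rintro Γ' E v j hE hv ⟨C, hC, hf⟩
      refine ⟨.out 0 E C, cons (.outVal S α.dual) fun _ => .fin, rfl, ⟨S, α.dual, rfl, hE, ?_⟩, ?_,
        ?_, ?_⟩
      · simpa using hC
      · rw [e, SessT.dual_inVal]; rfl
      · rintro i (hi | hi)
        · exact .inl hi
        · cases i with
          | zero => exact .inl rfl
          | succ i => exact absurd hi (hf i)
      · rintro σ h0 -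
        simp only [Proc.ren, h0]
        exact ⟨_, .com _ _ _ _ _ hv⟩
    cases S with
    | base b =>
      obtain ⟨v⟩ := D.inhabited b
      exact ⟨α.dual.needs, SessT.finite_needs _, fun Γ' hN j =>
        main j (.lit b v) (.lit b v) (SessT.inhab hN)⟩
    | serv β =>
      refine ⟨{β} ∪ α.dual.needs, (Set.finite_singleton _).union (SessT.finite_needs _),
        fun Γ' hN j => ?_⟩
      obtain ⟨a, ha⟩ := hN β (.inl rfl)
      exact main j (.name ha) (.name a) (SessT.inhab (hN.anti Set.subset_union_right))
  case out k E P =>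
    obtain ⟨S, α, e, hE, -⟩ := hT
    refine ⟨α.dual.needs, SessT.finite_needs _, fun Γ' hN j => ?_⟩
    obtain ⟨C, hC, hf⟩ := SessT.inhab (hN.cons (some S))
    obtain ⟨v, hv, -⟩ := hE.exists_eval hΓ
    refine ⟨.inp 0 C, cons (.inVal S α.dual) fun _ => .fin, rfl, ⟨S, α.dual, rfl, ?_⟩, ?_, ?_, ?_⟩
    · simpa using hC
    · rw [e, SessT.dual_outVal]; rfl
    · rintro i (hi | hi)
      · exact .inl hi
      · cases i with
        | zero => exact .inl rfl
        | succ i => exact absurd hi (hf i)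
    · rintro σ h0 -
      simp only [Proc.ren, h0]
      exact Reduces.comm ⟨_, .com _ _ _ _ _ hv⟩
  case inS k P =>
    obtain ⟨β, α, e, -⟩ := hT
    refine ⟨α.dual.needs, SessT.finite_needs _, fun Γ' hN j => ?_⟩
    obtain ⟨C, hC, hf⟩ := SessT.inhab hN
    -- The partner of a session input must delegate something. The index `j + 1` is left to the
    -- caller, who can choose a channel that the receiver does not hold.
    refine ⟨.del 0 (j + 1) C, cons (.outSess β α.dual) (Function.update (fun _ => .fin) j β), rfl,
      ⟨β, α.dual, rfl, by simp, by simp, hf j, ?_⟩, ?_, ?_, ?_⟩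
    · have : Function.update (fun _ => .fin) j SessT.fin = fun _ : ℕ => (.fin : SessT D) := by
        funext i; simp [Function.update_apply]
      simpa [this] using hC
    · rw [e]; rfl
    · rintro i (hi | hi)
      · exact hi
      · cases i with
        | zero => exact .inl rfl
        | succ i => exact absurd hi (hf i)
    · rintro σ h0 h1
      simp only [Proc.ren, h0]
      exact ⟨_, .del _ _ _ _ fun h => h1 (.inr h)⟩
  case del k k' P =>
    obtain ⟨β, α, e, -, hne, -, -⟩ := hT
    refine ⟨(SessT.inSess β α.dual).needs, SessT.finite_needs _, fun Γ' hN j => ?_⟩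
    obtain ⟨C₁, hC₁, hf₁⟩ := SessT.inhab (hN.anti Set.subset_union_left)
    obtain ⟨C₂, hC₂, hf₂⟩ := SessT.inhab (hN.anti Set.subset_union_right)
    -- The partner's body mentions only the received channel and its own session. Hence the side
    -- condition on delegation can fail only for `k' = k`, which typing excludes.
    have hsub : ∀ i, i ∈ (Proc.par C₁ C₂.shift).fsc → i ≤ 1 := by
      rintro i (hi | hi)
      · cases i with
        | zero => simp
        | succ i => exact absurd hi (hf₁ i)
      · rw [Proc.fsc_shift] at hi
        obtain ⟨m, hm, rfl⟩ := hi
        cases m with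
        | zero => simp
        | succ m => exact absurd hm (hf₂ m)
    refine ⟨.inS 0 (.par C₁ C₂.shift), cons (.inSess β α.dual) fun _ => .fin, rfl,
      ⟨β, α.dual, rfl, _, _, hC₁,
      Proc.STyped_shift (Δ := cons .fin (cons α.dual fun _ => .fin)).2 ⟨hC₂, rfl⟩, ?_⟩, ?_, ?_, ?_⟩
    · refine forall_nat_iff.2
        ⟨.inl ⟨rfl, rfl, C₂.zero_notMem_fsc_shift⟩, fun k => .inr ⟨?_, rfl, hf₁ k⟩⟩
      simp
    · rw [e]; rfl
    · rintro i (hi | hi)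
      · exact .inl hi
      · have := hsub _ hi
        exact .inl (by omega)
    · rintro σ h0 -
      rw [Proc.ren, h0]
      refine Reduces.comm ⟨_, .del _ _ _ _ fun h => ?_⟩
      rw [Proc.fsc_ren] at h
      obtain ⟨m, hm, e⟩ := h
      have := hsub m hm
      interval_cases m
      · simp at e
      · change liftRen σ (0 + 1) = _ at e
        rw [liftRen_succ, h0] at e
        omega
  case bra k I P =>
    obtain ⟨⟨l, hl⟩, α, e, -⟩ := hT
    refine ⟨(α ⟨l, hl⟩).dual.needs, SessT.finite_needs _, fun Γ' hN j => ?_⟩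
    obtain ⟨C, hC, hf⟩ := SessT.inhab hN
    refine ⟨.sel 0 l C, cons (.sel I ⟨l, hl⟩ fun i => (α i).dual) fun _ => .fin, rfl,
      ⟨I, ⟨l, hl⟩, _, hl, rfl, ?_⟩, ?_, ?_, ?_⟩
    · simpa using hC
    · rw [e]; rfl
    · rintro i (hi | hi)
      · exact .inl hi
      · cases i with
        | zero => exact .inl rfl
        | succ i => exact absurd hi (hf i)
    · rintro σ h0 -
      simp only [Proc.ren, h0]
      exact ⟨_, .sel _ _ _ _ _ hl⟩
  case sel k l P =>
    obtain ⟨I, hI, α, hl, e, -⟩ := hT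
    refine ⟨⋃ i, (α i).dual.needs, Set.finite_iUnion fun i => SessT.finite_needs _,
      fun Γ' hN j => ?_⟩
    have := fun i => SessT.inhab (hN.anti (Set.subset_iUnion (fun i => (α i).dual.needs) i))
    choose C hC hf using this
    refine ⟨.bra 0 I C, cons (.bra I hI fun i => (α i).dual) fun _ => .fin, rfl,
      ⟨hI, _, rfl, fun i => ?_⟩, ?_, ?_, ?_⟩
    · simpa using hC i
    · rw [e]; rfl
    · rintro i (hi | hi)
      · exact .inl hi
      · cases i with
        | zero => exact .inl rfl
        | succ i =>
          obtain ⟨m, hm⟩ := Set.mem_iUnion.1 hi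
          exact absurd hm (hf m i)
    · rintro σ h0 -
      simp only [Proc.ren, h0]
      exact Reduces.comm ⟨_, .sel _ _ _ _ _ hl⟩

/-- Dual interactions on the same session form a redex. -/
theorem exists_redex {T U : Proc D} {Γ : SEnv D} {Δ₁ Δ₂ : ℕ → SessT D} {s : ℕ} (hΓ : Γ.Services)
    (hT : T.STyped Γ Δ₁) (hU : U.STyped Γ Δ₂) (hsT : T.subject = some s)
    (hsU : U.subject = some s) (hd : Δ₁ s = (Δ₂ s).dual) (hTU : (T.fsc ∩ U.fsc).Subsingleton) :
    Reduces (.par T U) := by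
  have com : ∀ {k P E Q Γ} {Δ : ℕ → SessT D}, SEnv.Services Γ → (Proc.out k E Q).STyped Γ Δ →
      Reduces (.par (.inp k P) (.out k E Q)) := by
    rintro k P E Q Γ Δ hΓ ⟨S, α, -, hE, -⟩
    obtain ⟨v, hv, -⟩ := hE.exists_eval hΓ
    exact ⟨_, .com _ _ _ _ _ hv⟩
  have del : ∀ {k k' P Q Γ} {Δ : ℕ → SessT D}, (Proc.del k k' Q).STyped Γ Δ →
      ((Proc.inS k P).fsc ∩ (Proc.del k k' Q).fsc).Subsingleton →
      Reduces (.par (.inS k P) (.del k k' Q)) := by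
    rintro k k' P Q Γ Δ ⟨β, α, -, -, hne, -⟩ h
    -- If the receiver already held `k'`, the two prefixes would share both `k` and `k'`.
    refine ⟨_, .del _ _ _ _ fun hk' => hne (h ⟨.inl rfl, .inl (.inl rfl)⟩ ⟨.inr hk', ?_⟩)⟩
    exact .inl (.inr rfl)
  have sel : ∀ {k I P l Q Γ} {Δ Δ' : ℕ → SessT D}, (Proc.bra k I P).STyped Γ Δ →
      (Proc.sel k l Q).STyped Γ Δ' → Δ k = (Δ' k).dual →
      Reduces (.par (.bra k I P) (.sel k l Q)) := by
    rintro k I P l Q Γ Δ Δ' ⟨hI, α, e, -⟩ ⟨I', hI', α', hl, e', -⟩ h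
    rw [e, e', SessT.dual, SessT.bra.injEq] at h
    obtain ⟨rfl, -⟩ := h
    exact ⟨_, .sel _ _ _ _ _ hl⟩
  have hd' : Δ₂ s = (Δ₁ s).dual := by rw [hd, SessT.dual_dual]
  have hUT : (U.fsc ∩ T.fsc).Subsingleton := by rwa [Set.inter_comm]
  -- Duality of the types determines the kind of one prefix from that of the other and discards all
  -- mismatched pairs below.
  have hk := congrArg SessT.kind hd
  rw [SessT.kind_dual, hT.kind_eq hsT, hU.kind_eq hsU] at hk
  cases T <;> simp only [Proc.subject, reduceCtorEq, Option.some.injEq] at hsT <;> subst hsT <;>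
    cases U <;> simp only [Proc.subject, reduceCtorEq, Option.some.injEq] at hsU <;> subst hsU
  all_goals first
    | exact com hΓ hU
    | exact (com hΓ hT).comm
    | exact del hU hTU
    | exact (del hT hUT).comm
    | exact sel hT hU hd
    | exact (sel hU hT hd').comm
    | simp [Proc.kind, dualKind] at hk

/-! ### Normal forms -/

/-- Neither inaction, nor a parallel composition, nor a restriction. -/
def Proc.IsPrefix : Proc D → Prop
  | .nil | .par _ _ | .res _ => False
  | _ => True

/-- Parallel composition of a list of processes. -/
def parList : List (Proc D) → Proc D
  | [] => .nil
  | P :: l => .par P (parList l)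

/-- `n` restrictions. -/
def resN : ℕ → Proc D → Proc D
  | 0, P => P
  | n + 1, P => .res (resN n P)

theorem Proc.ren_id (P : Proc D) : P.ren id = P := by
  have : liftRen id = id := by funext n; cases n <;> rfl
  induction P <;> simp_all [ren]

theorem ren_parList (l : List (Proc D)) (ρ : ℕ → ℕ) :
    (parList l).ren ρ = parList (l.map (Proc.ren ρ)) := by
  induction l with
  | nil => rfl
  | cons P l ih => simp only [parList, Proc.ren, ih, List.map_cons]

theorem Proc.IsPrefix.ren {P : Proc D} (h : P.IsPrefix) (ρ : ℕ → ℕ) : (P.ren ρ).IsPrefix := by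
  cases P <;> exact h

theorem Cong.resN {P Q : Proc D} (h : Cong P Q) (n : ℕ) : Cong (resN n P) (resN n Q) := by
  induction n with
  | zero => exact h
  | succ n ih => exact .res ih

theorem cong_par_resN (P Q : Proc D) (n : ℕ) :
    Cong (.par P (resN n Q)) (resN n (.par (P.ren (· + n)) Q)) := by
  induction n generalizing P with
  | zero =>
    rw [show (fun x : ℕ => x + 0) = id from rfl, P.ren_id]
    exact .refl _
  | succ n ih =>
    refine (Cong.extrude P (resN n Q)).trans (.res ((ih P.shift).trans ?_))
    rw [Proc.shift, Proc.ren_ren]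
    rw [show (fun x => x + n) ∘ Nat.succ = fun x => x + (n + 1) by funext x; simp; omega]
    exact .refl _

theorem cong_parList_append (l m : List (Proc D)) :
    Cong (parList (l ++ m)) (.par (parList l) (parList m)) := by
  induction l with
  | nil => exact (Cong.trans (.par_comm _ _) (.par_nil _)).symm
  | cons P l ih => exact (Cong.par (.refl P) ih).trans (.par_assoc _ _ _)

theorem cong_parList_perm {l m : List (Proc D)} (h : l.Perm m) :
    Cong (parList l) (parList m) := by
  induction h with
  | nil => exact .refl _
  | cons P _ ih => exact .par (.refl _) ih
  | swap P Q l =>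
    exact (Cong.par_assoc _ _ _).trans
      ((Cong.par (.par_comm _ _) (.refl _)).trans (Cong.par_assoc _ _ _).symm)
  | trans _ _ h₁ h₂ => exact h₁.trans h₂

/-- All top-level restrictions are extruded to the front. Moving one component under the binders of
the other shifts it, so the induction is over all renamings. -/
theorem Proc.exists_normal_form (P : Proc D) (ρ : ℕ → ℕ) : ∃ n l,
    Cong (P.ren ρ) (resN n (parList l)) ∧ ∀ T ∈ l, T.IsPrefix := by
  induction P generalizing ρ with
  | nil => exact ⟨0, [], .refl _, by simp⟩
  | par P Q hP hQ =>
    obtain ⟨m, l, hm, hl⟩ := hQ ρ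
    obtain ⟨n, l', hn, hl'⟩ := hP ((· + m) ∘ ρ)
    refine ⟨m + n, l.map (Proc.ren (· + n)) ++ l', ?_, ?_⟩
    · have h₁ : Cong ((P.ren ρ).par (Q.ren ρ)) (resN m (.par (P.ren ((· + m) ∘ ρ)) (parList l))) := by
        rw [← ren_ren]
        exact (Cong.par (.refl _) hm).trans (cong_par_resN _ _ _)
      refine h₁.trans ?_
      have h₂ : Cong (.par (P.ren ((· + m) ∘ ρ)) (parList l))
          (resN n (parList (l.map (Proc.ren (· + n)) ++ l'))) := by
        refine ((Cong.par hn (.refl _)).trans (.par_comm _ _)).trans ?_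
        refine (cong_par_resN _ _ _).trans (Cong.resN ?_ n)
        rw [ren_parList]
        exact (cong_parList_append _ _).symm
      have h₃ : ∀ a b (R : Proc D), resN (a + b) R = resN a (resN b R) := by
        intro a b R
        induction a with
        | zero => rw [Nat.zero_add]; rfl
        | succ a ih => rw [Nat.add_right_comm]; exact congrArg Proc.res ih
      rw [h₃]
      exact h₂.resN m
    · intro T hT
      rcases List.mem_append.1 hT with h | h
      · obtain ⟨T, hT', rfl⟩ := List.mem_map.1 h
        exact (hl T hT').ren _
      · exact hl' T h
  | res P ih =>
    obtain ⟨n, l, h, hl⟩ := ih (liftRen ρ)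
    exact ⟨n + 1, l, .res h, hl⟩
  | _ => exact ⟨0, [_], (Cong.par_nil _).symm, by simp [ren, IsPrefix]⟩

theorem weight_resN (n : ℕ) (P : Proc D) : (resN n P).weight = P.weight := by
  induction n with
  | zero => rfl
  | succ n ih => exact ih

theorem Reduces.resN {P : Proc D} (h : Reduces P) (n : ℕ) : Reduces (resN n P) := by
  induction n with
  | zero => exact h
  | succ n ih =>
    obtain ⟨R, hR⟩ := ih
    exact ⟨_, .res hR⟩

theorem mem_fsc_resN {n k : ℕ} {P : Proc D} : k ∈ (resN n P).fsc ↔ k + n ∈ P.fsc := by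
  induction n generalizing k with
  | zero => rfl
  | succ n ih =>
    refine (ih (k := k + 1)).trans ?_
    rw [Nat.add_right_comm]; rfl

theorem Proc.Leaf.of_rTyped {T : Proc D} (hT : T.IsPrefix) {Γ : SEnv D} {Δ : ℕ → Usage D}
    (h : T.RTyped Γ Δ) : T.Leaf Γ Δ := by
  cases T <;> first | exact h | exact hT.elim

theorem RTyped_resN {n : ℕ} {P : Proc D} {Γ : SEnv D} {Δ : ℕ → Usage D}
    (h : (resN n P).RTyped Γ Δ) :
    ∃ Δ' : ℕ → Usage D, P.RTyped Γ Δ' ∧ (∀ k < n, Δ' k = .bot) ∧ ∀ k, Δ' (k + n) = Δ k := by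
  induction n generalizing Δ with
  | zero => exact ⟨Δ, h, by simp, fun _ => rfl⟩
  | succ n ih =>
    obtain ⟨Δ', h₁, h₂, h₃⟩ := ih h
    refine ⟨Δ', h₁, fun k hk => ?_, fun k => ?_⟩
    · rcases Nat.lt_succ_iff_lt_or_eq.1 hk with h | rfl
      · exact h₂ k h
      · simpa using h₃ 0
    · rw [show k + (n + 1) = k + 1 + n by omega, h₃]; rfl

/-- The contractions are undone one at a time, outermost first. -/
theorem forest_of_resN {n : ℕ} {P : Proc D} (hc : (resN n P).Cuts)
    (h : Forest (resN n P).labels) : Forest P.labels := by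
  induction n with
  | zero => exact h
  | succ n ih =>
    refine ih hc.1 ?_
    have := Forest.of_contract (N := 0) (by rw [add_zero]; exact h) hc.2
    simpa using this

theorem Proc.IsPrefix.labels {T : Proc D} (h : T.IsPrefix) : T.labels = {T.fsc} := by
  cases T <;> first | rfl | exact h.elim

theorem labels_parList {l : List (Proc D)} (h : ∀ T ∈ l, T.IsPrefix) :
    (parList l).labels = (l : Multiset (Proc D)).map Proc.fsc := by
  induction l with
  | nil => rfl
  | cons T l ih =>
    simp only [parList, Proc.labels, ih fun U hU => h U (List.mem_cons_of_mem _ hU),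
      (h T List.mem_cons_self).labels]
    rfl

/-- In a forest of interactions of which each shares its subject with some other one, there are
two with the same subject. -/
theorem Forest.exists_pair {M : Multiset (Proc D)} {s : Proc D → ℕ} (hF : Forest (M.map Proc.fsc))
    (hs : ∀ T ∈ M, s T ∈ T.fsc) (h0 : M ≠ 0)
    (h : ∀ T N, M = T ::ₘ N → s T ∈ allLabels (N.map Proc.fsc)) :
    ∃ T U N, M = T ::ₘ U ::ₘ N ∧ s T = s U := by
  classical
  induction hn : M.card generalizing M with
  | zero => exact absurd (Multiset.card_eq_zero.1 hn) h0
  | succ n ih =>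
    -- A leaf `T` shares its subject, hence nothing else. Unless another prefix has the same
    -- subject, `T` can be dropped: a subject shared with `T` alone would have to be the subject of
    -- `T`.
    obtain ⟨A, N', e, hl⟩ := hF _ le_rfl (by simpa using h0)
    obtain ⟨T, hT, rfl, rfl⟩ := (Multiset.map_eq_cons _ _ _ _).2 e
    obtain ⟨N, rfl⟩ := Multiset.exists_cons_of_mem hT
    rw [Multiset.erase_cons_head] at hl
    have hTs := h T N rfl
    by_cases hU : ∃ U ∈ N, s U = s T
    · obtain ⟨U, hU, hst⟩ := hU
      obtain ⟨N, rfl⟩ := Multiset.exists_cons_of_mem hU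
      exact ⟨T, U, N, rfl, hst.symm⟩
    · have hN0 : N ≠ 0 := by
        rintro rfl
        simp at hTs
      have hpair := ih (M := N) (hF.anti (by simpa using Multiset.le_cons_self _ _))
        (fun U hU => hs U (Multiset.mem_cons_of_mem hU)) hN0 (fun U N' e => ?_)
        (by simpa using hn)
      · obtain ⟨U, V, N', e, h'⟩ := hpair
        refine ⟨U, V, T ::ₘ N', ?_, h'⟩
        rw [e, Multiset.cons_swap T, Multiset.cons_swap T]
      · have hUN : U ∈ N := by simp [e]
        have := h U (T ::ₘ N') (by rw [e, Multiset.cons_swap])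
        rw [Multiset.map_cons, allLabels_cons] at this
        rcases this with h' | h'
        · refine absurd ⟨U, hUN, hl ⟨h', ?_⟩ ⟨hs T (Multiset.mem_cons_self _ _), hTs⟩⟩ hU
          exact ⟨U.fsc, Multiset.mem_map_of_mem _ hUN, hs U (Multiset.mem_cons_of_mem hUN)⟩
        · exact h'

/-! ### Safe processes -/

/-- Typed processes without cyclic dependencies between their sessions. -/
def Safe (P : Proc D) : Prop :=
  ∃ (Γ : SEnv D) (Δ : ℕ → Usage D), {a | Γ a ≠ none}.Finite ∧ {k | Δ k ≠ .ty .fin}.Finite ∧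
    Γ.Services ∧ P.RTyped Γ Δ ∧ P.Cuts ∧ Forest P.labels

theorem Safe.red {P Q : Proc D} (h : Safe P) (hr : Red P Q) : Safe Q := by
  obtain ⟨Γ, Δ, h₁, h₂, h₃, h₄, h₅, h₆⟩ := h
  obtain ⟨h₇, h₈⟩ := hr.forest h₄ h₅ h₆
  exact ⟨Γ, Δ, h₁, h₂, h₃, hr.rTyped h₄, h₇, by simpa using h₈ (N := 0) (by simpa using h₆)⟩

theorem Safe.cong {P Q : Proc D} (h : Safe P) (hc : Cong P Q) : Safe Q := by
  obtain ⟨Γ, Δ, h₁, h₂, h₃, h₄, h₅, h₆⟩ := h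
  exact ⟨Γ, Δ, h₁, h₂, h₃, hc.rTyped_iff.1 h₄, hc.cuts_iff.1 h₅, hc.labels_eq ▸ h₆⟩

theorem Safe.of_plug {E : RCtx D} {P : Proc D} (h : Safe (E.plug P)) : Safe P := by
  induction E with
  | hole => exact h
  | par E Q ih =>
    obtain ⟨Γ, Δ, h₁, h₂, h₃, ⟨Δ₁, Δ₂, h₄, h₄', hs⟩, h₅, h₆⟩ := h
    refine ih ⟨Γ, Δ₁, h₁, h₂.subset fun k hk => ?_, h₃, h₄, h₅.1,
      h₆.anti (Multiset.le_add_right _ _)⟩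
    change _ ≠ _ at hk ⊢
    have := hs k
    grind
  | res E ih =>
    obtain ⟨Γ, Δ, h₁, h₂, h₃, h₄, h₅, h₆⟩ := h
    refine ih ⟨Γ, _, h₁, ?_, h₃, h₄, h₅.1, forest_of_resN (n := 1) h₅ h₆⟩
    refine ((h₂.image Nat.succ).insert 0).subset fun k hk => ?_
    cases k with
    | zero => exact .inl rfl
    | succ k => exact .inr ⟨k, hk, rfl⟩

/-- Composition with a process that shares at most one session. -/
theorem Proc.RTyped.safe_par {P Q : Proc D} {Γ : SEnv D} {Δ : ℕ → Usage D} {Δ' : ℕ → SessT D}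
    {k : ℕ} (hΓ : {a | Γ a ≠ none}.Finite) (hΔ : {k | Δ k ≠ .ty .fin}.Finite) (hs : Γ.Services)
    (hP : P.RTyped Γ Δ) (hc : P.Cuts) (hF : Forest P.labels) (hpre : Q.IsPrefix)
    (hQ : Q.STyped Γ Δ')
    (h : ∀ i ∈ Q.fsc, (i ∉ P.fsc ∧ Δ i = .ty .fin) ∨ (i = k ∧ Δ i = .ty (Δ' i).dual)) :
    Safe (.par P Q) := by
  -- The combined usage is that of `Q` on its fresh channels, `⊥` on the joined session, and that of
  -- `P` elsewhere.
  have : ∀ i, ∃ u, ((Δ i = u ∧ Usage.ty (Δ' i) = .ty .fin ∧ i ∉ Q.fsc) ∨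
      (Usage.ty (Δ' i) = u ∧ Δ i = .ty .fin ∧ i ∉ P.fsc) ∨
      (u = .bot ∧ ∃ α : SessT D, Δ i = .ty α.dual ∧ Usage.ty (Δ' i) = .ty α)) ∧
      (i ∉ Q.fsc → u = Δ i) := by
    intro i
    by_cases hi : i ∈ Q.fsc
    · rcases h i hi with ⟨h₁, h₂⟩ | ⟨-, h₂⟩
      · exact ⟨_, .inr (.inl ⟨rfl, h₂, h₁⟩), fun h => absurd hi h⟩
      · exact ⟨_, .inr (.inr ⟨rfl, _, h₂, rfl⟩), fun h => absurd hi h⟩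
    · exact ⟨_, .inl ⟨rfl, by rw [hQ.eq_fin hi], hi⟩, fun _ => rfl⟩
  choose Δ'' h₁ h₂ using this
  refine ⟨Γ, Δ'', hΓ, (hΔ.union Q.finite_fsc).subset fun i hi => ?_, hs,
    ⟨Δ, _, hP, Leaf.rTyped ⟨Δ', hQ, fun _ => .refl _⟩, h₁⟩, ⟨hc, hQ.forest.1⟩, ?_⟩
  · by_cases hq : i ∈ Q.fsc
    · exact .inr hq
    · exact .inl fun e => hi ((h₂ i hq).trans e)
  · rw [labels, hpre.labels, add_comm, Multiset.singleton_add, forest_cons]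
    refine ⟨hF, fun T hT => hasLeaf_cons.2 (.inl ?_)⟩
    -- The new node touches the old ones at most in `k`, so it is a leaf of every subfamily that
    -- contains it.
    have : ∀ i ∈ Q.fsc ∩ allLabels T, i = k := by
      rintro i ⟨hi, A, hA, hiA⟩
      rcases h i hi with h | h
      · exact absurd (P.allLabels_labels_subset ⟨A, Multiset.mem_of_le hT hA, hiA⟩) h.1
      · exact h.1
    exact fun i hi j hj => (this i hi).trans (this j hj).symm

theorem Proc.IsPrefix.cases_of_subject_eq_none {T : Proc D} (h : T.IsPrefix)
    (hs : T.subject = none) :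
    (∃ a P, T = .serv a P) ∨ (∃ a P, T = .rserv a P) ∨ (∃ a P, T = .req a P) ∨
      ∃ e P Q, T = .cond e P Q := by
  cases T <;> simp_all [IsPrefix, subject]

/-- Services, requests and conditionals always find a partner. -/
theorem exists_partner_of_subject_eq_none {T : Proc D} {Γ : SEnv D} {Δ : ℕ → SessT D}
    (hΓ : Γ.Services) (hT : T.STyped Γ Δ) (hp : T.IsPrefix) (hs : T.subject = none) :
    Reduces T ∨ ∃ N : Set (SessT D), N.Finite ∧ ∀ Γ' : SEnv D,
      (∀ a S, Γ a = some S → Γ' a = some S) → Γ'.Provides N → ∃ Q : Proc D,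
      Q.IsPrefix ∧ Q.weight = 1 ∧ Q.STyped Γ' (fun _ => .fin) ∧ Q.fsc = ∅ ∧
      ∀ σ, Reduces (.par T (Q.ren σ)) := by
  have serv : ∀ {a : ℕ} {α : SessT D}, Γ a = some (.serv α) →
      (∀ C C', Reduces (.par T (.req a (Proc.ren C' C)))) →
      ∃ N : Set (SessT D), N.Finite ∧ ∀ Γ' : SEnv D,
      (∀ a S, Γ a = some S → Γ' a = some S) → Γ'.Provides N → ∃ Q : Proc D,
      Q.IsPrefix ∧ Q.weight = 1 ∧ Q.STyped Γ' (fun _ => .fin) ∧ Q.fsc = ∅ ∧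
      ∀ σ, Reduces (.par T (Q.ren σ)) := by
    intro a α ha hr
    refine ⟨α.dual.needs, SessT.finite_needs _, fun Γ' hle hN => ?_⟩
    obtain ⟨C, hC, hf⟩ := SessT.inhab hN
    exact ⟨.req a C, trivial, rfl, ⟨α, hle _ _ ha, hC⟩, Set.eq_empty_of_forall_notMem hf,
      fun σ => hr _ _⟩
  rcases hp.cases_of_subject_eq_none hs with
    ⟨a, P, rfl⟩ | ⟨a, P, rfl⟩ | ⟨a, P, rfl⟩ | ⟨e, P, Q, rfl⟩
  · obtain ⟨α, ha, -⟩ := hT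
    exact .inr (serv ha fun _ _ => ⟨_, .link _ _ _⟩)
  · obtain ⟨α, ha, -⟩ := hT
    exact .inr (serv ha fun _ _ => ⟨_, .rinit _ _ _⟩)
  · obtain ⟨α, ha, -⟩ := hT
    refine .inr ⟨α.needs, SessT.finite_needs _, fun Γ' hle hN => ?_⟩
    obtain ⟨C, hC, hf⟩ := SessT.inhab hN
    exact ⟨.serv a C, trivial, rfl, ⟨α, hle _ _ ha, fun _ => rfl, hf, hC⟩,
      Set.eq_empty_of_forall_notMem hf, fun σ => Reduces.comm ⟨_, .link _ _ _⟩⟩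
  · obtain ⟨he, -⟩ := hT
    obtain ⟨v, hv, h⟩ := he.exists_eval hΓ
    obtain ⟨w, rfl⟩ := h _ rfl
    refine .inl ?_
    cases ht : D.truth w with
    | true => exact ⟨_, .ifT _ _ _ _ hv ht⟩
    | false => exact ⟨_, .ifF _ _ _ _ hv ht⟩

/-! ### Making a safe process react -/

theorem Proc.RTyped.of_mem {l m : List (Proc D)} {T : Proc D} (hl : l.Perm (T :: m))
    (hT : T.IsPrefix) {Γ : SEnv D} {Δ : ℕ → Usage D} (h : (parList l).RTyped Γ Δ) :
    ∃ (Δ₀ : ℕ → SessT D) (Δ₁ Δ₂ : ℕ → Usage D), T.STyped Γ Δ₀ ∧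
      (∀ k, Usage.Le (.ty (Δ₀ k)) (Δ₁ k)) ∧ (parList m).RTyped Γ Δ₂ ∧
      Share T (parList m) Δ Δ₁ Δ₂ := by
  obtain ⟨Δ₁, Δ₂, h₁, h₂, hs⟩ := (cong_parList_perm hl).rTyped_iff.1 h
  obtain ⟨Δ₀, h₀, hle⟩ := Leaf.of_rTyped hT h₁
  exact ⟨Δ₀, Δ₁, Δ₂, h₀, hle, h₂, hs⟩

theorem Reduces.parList_of_mem {l m : List (Proc D)} {T : Proc D} (hl : l.Perm (T :: m))
    (h : Reduces T) : Reduces (parList l) :=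
  (h.par _).of_cong (cong_parList_perm hl)

/-- A partner placed outside the `n` restrictions is extruded into them, which shifts its channels
by `n`, and then meets the chosen prefix. -/
theorem Reduces.resN_par {l m : List (Proc D)} {P Q T : Proc D} {n : ℕ}
    (hP : Cong P (SessPi.resN n (parList l))) (hl : l.Perm (T :: m))
    (h : Reduces (.par T (Q.ren (· + n)))) : Reduces (.par P Q) := by
  refine Reduces.comm (Reduces.of_cong ?_
    ((Cong.par (.refl Q) hP).trans (cong_par_resN Q _ n)))
  refine Reduces.resN (Reduces.of_cong (h.par (parList m)) ?_) n
  refine (Cong.par (.refl _) (cong_parList_perm hl)).trans ?_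
  exact (Cong.par_assoc _ _ _).trans (.par (.par_comm _ _) (.refl _))

/-- The subject is free in `P` and only one end of its session is present, so a partner with the
dual type may take the other end without creating a cycle. -/
theorem Safe.exists_reduces_of_open {P T : Proc D} {Γ : SEnv D} {Δ : ℕ → Usage D} {n k : ℕ}
    {l m : List (Proc D)} {Δ₀ : ℕ → SessT D} (hΓf : {a | Γ a ≠ none}.Finite)
    (hΔf : {k | Δ k ≠ .ty .fin}.Finite) (hΓs : Γ.Services) (hP : P.RTyped Γ Δ) (hPc : P.Cuts)
    (hPF : Forest P.labels) (hc : Cong P (SessPi.resN n (parList l))) (hm : l.Perm (T :: m))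
    (h₀ : T.STyped Γ Δ₀) (hs : T.subject = some (k + n)) (hΔk : Δ k = .ty (Δ₀ (k + n))) :
    ∃ Q : Proc D, Q.weight ≤ 1 ∧ Safe (.par P Q) ∧ Reduces (.par P Q) := by
  obtain ⟨N, hN, hpart⟩ := exists_partner hΓs h₀ hs
  obtain ⟨Γ', hΓ', hf', hs', hprov⟩ := SEnv.exists_provides hΓf hΓs hN
  -- Beyond `b` channels are neither used nor promised, so `b + 1 + k` is fresh; this is where the
  -- finiteness condition in `Safe` matters.
  obtain ⟨b, hb⟩ := (hΔf.union P.finite_fsc).bddAbove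
  obtain ⟨Q, Δq, hQs, hQ, hq0, hQf, hQr⟩ := hpart Γ' hprov b
  have hfresh : b + 1 + k ∉ P.fsc ∧ Δ (b + 1 + k) = .ty .fin := by
    constructor
    · intro h
      have := hb (.inr h)
      omega
    · by_contra h
      have := hb (.inl h)
      omega
  have hinj : Function.Injective fun i : ℕ => i + k := fun a b h => by simpa using h
  have hren : (Q.ren (· + k)).STyped Γ' (Function.extend (· + k) Δq fun _ => .fin) :=
    (Proc.STyped_ren hinj).2 ⟨by rwa [Function.extend_comp hinj],
      fun i hi => Function.extend_apply' _ _ _ hi⟩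
  have hQ' : Q.weight = 1 ∧ Q.IsPrefix := by
    cases Q <;> simp [Proc.subject] at hQs <;> exact ⟨rfl, trivial⟩
  refine ⟨Q.ren (· + k), by rw [Q.weight_ren, hQ'.1], (hP.mono hΓ').safe_par (k := k) hf' hΔf hs'
    hPc hPF (hQ'.2.ren _) hren ?_, Reduces.resN_par hc hm ?_⟩
  · intro i hi
    rw [Q.fsc_ren] at hi
    obtain ⟨i, hi, rfl⟩ := hi
    rcases hQf hi with rfl | rfl
    · refine .inr ⟨by simp, ?_⟩
      rw [hinj.extend_apply, hq0, SessT.dual_dual, ← hΔk]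
      exact congrArg Δ (Nat.zero_add k)
    · exact .inl hfresh
  · rw [Proc.ren_ren]
    refine hQr _ (by simp) fun hmem => hfresh.1 ?_
    rw [hc.fsc_eq, mem_fsc_resN, (cong_parList_perm hm).fsc_eq]
    exact .inl hmem

theorem mem_fsc_parList {N : List (Proc D)} {k : ℕ} (h : k ∈ (parList N).fsc) :
    k ∈ allLabels ((N : Multiset (Proc D)).map Proc.fsc) := by
  induction N with
  | nil => exact absurd h id
  | cons U N ih =>
    rw [← Multiset.cons_coe, Multiset.map_cons, allLabels_cons]
    exact h.imp id ih

/-- Interactions that all wait for one another contain a redex. -/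
theorem reduces_parList {l : List (Proc D)} {Γ : SEnv D} {Δ : ℕ → Usage D} {s : Proc D → ℕ}
    (hΓs : Γ.Services) (hl : ∀ T ∈ l, T.IsPrefix) (hl' : (parList l).RTyped Γ Δ)
    (hF : Forest ((l : Multiset (Proc D)).map Proc.fsc)) (hl0 : l ≠ [])
    (hs : ∀ T ∈ l, T.subject = some (s T)) (hbot : ∀ T ∈ l, Δ (s T) = .bot) :
    Reduces (parList l) := by
  -- The type of a subject is not `fin`. As the total is `⊥`, the remaining prefixes hold the dual
  -- end, which is not `fin` either, so one of them mentions the channel.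
  have hshare : ∀ (T : Proc D) (N : Multiset (Proc D)), (l : Multiset (Proc D)) = T ::ₘ N →
      s T ∈ allLabels (N.map Proc.fsc) := by
    intro T N hN
    obtain ⟨N, rfl⟩ := Quot.exists_rep N
    have hm : l.Perm (T :: N) := Multiset.coe_eq_coe.1 hN
    have hT : T ∈ l := hm.mem_iff.2 List.mem_cons_self
    obtain ⟨Δ₀, Δ₁, Δ₂, h₀, hle, h₂, hsh⟩ := hl'.of_mem hm (hl T hT)
    have hne := h₀.subject_ne_fin (hs T hT)
    have h₁ := (hle (s T)).eq_of_ne (by simpa using hne)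
    refine mem_fsc_parList (not_not.1 fun hnot => ?_)
    have hfin := h₂.fin_le hnot
    rcases hsh (s T) with ⟨e, -, -⟩ | ⟨-, -, e⟩ | ⟨-, α, e₁, e₂⟩
    · rw [h₁, hbot T hT] at e
      cases e
    · exact e (Proc.subject_mem (hs T hT))
    · rw [e₂] at hfin
      have := hfin.eq_of_ty
      rw [Usage.ty.injEq] at this
      rw [h₁, Usage.ty.injEq, ← this] at e₁
      exact hne e₁
  obtain ⟨T, U, N, hM, hTU⟩ := Forest.exists_pair (s := s) hF
    (fun T hT => Proc.subject_mem (hs T hT)) (by simpa using hl0) hshare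
  have hTUs : (T.fsc ∩ U.fsc).Subsingleton := by
    rw [hM, Multiset.map_cons, Multiset.map_cons] at hF
    exact hF.subsingleton_inter
  obtain ⟨N, rfl⟩ := Quot.exists_rep N
  have hm : l.Perm (T :: U :: N) := Multiset.coe_eq_coe.1 hM
  have hT : T ∈ l := hm.mem_iff.2 (by simp)
  have hU : U ∈ l := hm.mem_iff.2 (by simp)
  have hsU : U.subject = some (s T) := hTU ▸ hs U hU
  obtain ⟨Δ₁₂, Δ₃, ⟨Δ₁, Δ₂, h₁, h₂, hsh⟩, -⟩ :=
    Proc.RTyped_par_assoc ((cong_parList_perm hm).rTyped_iff.1 hl')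
  obtain ⟨Δ₁₀, h₁, l₁⟩ := Proc.Leaf.of_rTyped (hl T hT) h₁
  obtain ⟨Δ₂₀, h₂, l₂⟩ := Proc.Leaf.of_rTyped (hl U hU) h₂
  have hd := (hsh.dual_of_leaf (l₁ (s T)) (l₂ (s T)) (Proc.subject_mem (hs T hT))
    (Proc.subject_mem hsU) (h₁.subject_ne_fin (hs T hT)) (h₂.subject_ne_fin hsU)).2
  have hr := exists_redex hΓs h₁ h₂ (hs T hT) hsU hd hTUs
  exact (hr.par (parList N)).of_cong ((cong_parList_perm hm).trans (.par_assoc _ _ _))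

/-- A safe process that is not inactive reduces in some context. -/
theorem Safe.exists_reduces {P : Proc D} (h : Safe P) (hw : P.weight ≠ 0) :
    ∃ Q : Proc D, Q.weight ≤ 1 ∧ Safe (.par P Q) ∧ Reduces (.par P Q) := by
  have hnil : Reduces P → ∃ Q : Proc D, Q.weight ≤ 1 ∧ Safe (.par P Q) ∧ Reduces (.par P Q) :=
    fun hr => ⟨.nil, by simp [Proc.weight], h.cong (Cong.par_nil P).symm, hr.par _⟩
  obtain ⟨n, l, hc, hl⟩ := P.exists_normal_form id
  rw [P.ren_id] at hc
  have hl0 : l ≠ [] := by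
    rintro rfl
    rw [hc.weight_eq, weight_resN] at hw
    exact hw rfl
  obtain ⟨Γ, Δ, hΓf, hΔf, hΓs, hP, hPc, hPF⟩ := id h
  obtain ⟨Δ', hl', hbot, hshift⟩ := RTyped_resN (hc.rTyped_iff.1 hP)
  have hF : Forest ((l : Multiset (Proc D)).map Proc.fsc) := by
    rw [← labels_parList hl]
    exact forest_of_resN (hc.cuts_iff.1 hPc) (hc.labels_eq ▸ hPF)
  have hperm : ∀ T ∈ l, ∃ m : List (Proc D), l.Perm (T :: m) := by
    intro T hT
    classical
    exact ⟨_, List.perm_cons_erase hT⟩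
  by_cases hnone : ∃ T ∈ l, T.subject = none
  · obtain ⟨T, hT, hs⟩ := hnone
    obtain ⟨m, hm⟩ := hperm T hT
    obtain ⟨Δ₀, Δ₁, Δ₂, h₀, hle, h₂, hsh⟩ := hl'.of_mem hm (hl T hT)
    rcases exists_partner_of_subject_eq_none hΓs h₀ (hl T hT) hs with hr | ⟨N, hN, hpart⟩
    · exact hnil (((hr.parList_of_mem hm).resN n).of_cong hc)
    · obtain ⟨Γ', hΓ', hf', hs', hprov⟩ := SEnv.exists_provides hΓf hΓs hN
      obtain ⟨Q, hQp, hQw, hQ, hQf, hQr⟩ := hpart Γ' hΓ' hprov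
      refine ⟨Q, hQw.le, (hP.mono hΓ').safe_par (k := 0) hf' hΔf hs' hPc hPF hQp hQ ?_,
        Reduces.resN_par hc hm (hQr _)⟩
      simp [hQf]
  have hsub : ∀ T ∈ l, ∃ s, T.subject = some s := by
    intro T hT
    exact Option.ne_none_iff_exists'.1 fun h => hnone ⟨T, hT, h⟩
  -- Only interactions on sessions are left. A subject with usage other than `⊥` is not restricted,
  -- so an outside partner can reach it; if there is none, the redex is internal.
  by_cases hopen : ∃ T ∈ l, ∃ s, T.subject = some s ∧ Δ' s ≠ .bot
  · obtain ⟨T, hT, s, hs, hsb⟩ := hopen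
    obtain ⟨m, hm⟩ := hperm T hT
    obtain ⟨Δ₀, Δ₁, Δ₂, h₀, hle, h₂, hsh⟩ := hl'.of_mem hm (hl T hT)
    have hne := h₀.subject_ne_fin hs
    have h₁ := (hle s).eq_of_ne (by simpa using hne)
    have hΔs : Δ' s = .ty (Δ₀ s) := by
      rcases hsh s with ⟨e, -, -⟩ | ⟨-, -, e⟩ | ⟨e, -⟩
      · rw [← e, h₁]
      · exact absurd (Proc.subject_mem hs) e
      · exact absurd e hsb
    obtain ⟨k, rfl⟩ : ∃ k, s = k + n :=
      ⟨s - n, (Nat.sub_add_cancel (not_lt.1 fun h => hsb (hbot s h))).symm⟩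
    exact Safe.exists_reduces_of_open hΓf hΔf hΓs hP hPc hPF hc hm h₀ hs (by rw [← hshift, hΔs])
  choose! s hs using hsub
  refine hnil (Reduces.of_cong (Reduces.resN ?_ n) hc)
  exact reduces_parList hΓs hl hl' hF hl0 hs fun T hT =>
    not_not.1 fun h => hopen ⟨T, hT, s T, hs T hT, h⟩

/-! ### The typing system and its linear fragments -/

theorem KEnv.set_self (Δ : KEnv D) (k : ℕ) (u : Usage D) : Δ.set k u k = some u := by
  simp [set]

theorem KEnv.set_of_ne {Δ : KEnv D} {k j : ℕ} (h : j ≠ k) (u : Usage D) : Δ.set k u j = Δ j := by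
  simp [set, h]

/-! #### From typing to linear typing -/

theorem KEnv.comp_ne_none {Δ₁ Δ₂ : KEnv D} {k : ℕ} :
    Δ₁.comp Δ₂ k ≠ none ↔ Δ₁ k ≠ none ∨ Δ₂ k ≠ none := by
  unfold comp
  cases Δ₁ k <;> cases Δ₂ k <;> simp

theorem KEnv.set_ne_none {Δ : KEnv D} {k j : ℕ} {u : Usage D} :
    Δ.set k u j ≠ none ↔ j = k ∨ Δ j ≠ none := by
  by_cases h : j = k
  · subst h; simp [set]
  · simp [set, h]

/-- Outside the domain of a session typing nothing is mentioned; in particular the body of a service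
mentions only its own session. -/
theorem Typed.ne_none {Γ : SEnv D} {P : Proc D} {Δ : KEnv D} (h : Typed Γ P Δ) {k : ℕ}
    (hk : k ∈ P.fsc) : Δ k ≠ none := by
  have upd : ∀ {A : Set ℕ} {Δ : KEnv D} {k j : ℕ} {u v : Usage D},
      (∀ {j}, j ∈ A → Δ.set k u j ≠ none) → j ∈ {k} ∪ A → Δ.set k v j ≠ none := by
    rintro A Δ k j u v h (hj | hj)
    · exact KEnv.set_ne_none.2 (.inl hj)
    · exact KEnv.set_ne_none.2 (KEnv.set_ne_none.1 (h hj))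
  induction h generalizing k with
  | serv _ _ _ ih => exact absurd rfl (ih (k := k + 1) hk)
  | rserv _ _ _ ih => exact absurd rfl (ih (k := k + 1) hk)
  | req _ _ ih => exact ih (k := k + 1) hk
  | inp _ ih => exact upd ih hk
  | out _ _ ih => exact upd ih hk
  | inS _ ih => exact upd (A := down _) (fun {j} hj => ih (k := j + 1) hj) hk
  | del _ _ _ ih =>
    rcases hk with (rfl | rfl) | hk
    · exact KEnv.set_ne_none.2 (.inr (KEnv.set_ne_none.2 (.inl rfl)))
    · exact KEnv.set_ne_none.2 (.inl rfl)
    · exact KEnv.set_ne_none.2 (.inr (upd ih (.inr hk)))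
  | bra _ ih =>
    rcases hk with hk | hk
    · exact KEnv.set_ne_none.2 (.inl hk)
    · obtain ⟨i, hi⟩ := Set.mem_iUnion.1 hk
      exact upd (ih i) (.inr hi)
  | sel _ _ ih => exact upd ih hk
  | par _ _ _ ih₁ ih₂ => exact KEnv.comp_ne_none.2 (hk.imp ih₁ ih₂)
  | nil => exact absurd hk id
  | res _ ih => exact ih (k := k + 1) hk
  | cond _ _ _ ih₁ ih₂ => exact hk.elim ih₁ ih₂
  | bot _ ih => exact KEnv.set_ne_none.2 (KEnv.set_ne_none.1 (ih hk))

/-- Restricted channels are not used anywhere in the process. -/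
def Proc.Unrestricted : Proc D → Prop
  | .nil => True
  | .par P Q => P.Unrestricted ∧ Q.Unrestricted
  | .res P => 0 ∉ P.fsc ∧ P.Unrestricted
  | .rserv _ P => P.Unrestricted
  | .serv _ P => P.Unrestricted
  | .req _ P => P.Unrestricted
  | .cond _ P Q => P.Unrestricted ∧ Q.Unrestricted
  | .inp _ P => P.Unrestricted
  | .out _ _ P => P.Unrestricted
  | .inS _ P => P.Unrestricted
  | .del _ _ P => P.Unrestricted
  | .bra _ _ P => ∀ i, (P i).Unrestricted
  | .sel _ _ P => P.Unrestricted

theorem Proc.unrestricted_ren (P : Proc D) (ρ : ℕ → ℕ) :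
    (P.ren ρ).Unrestricted ↔ P.Unrestricted := by
  induction P generalizing ρ with
  | res P ih => simp only [ren, Unrestricted, ih, fsc_ren, zero_mem_image_liftRen]
  | _ => simp_all [ren, Unrestricted]

/-- Absence of restrictions is not invariant under `≡`, since `(ν k) 0 ≡ 0`. That restricted
channels are unused is invariant, and so carries over from the restriction-free form of a program to
the program itself. -/
theorem Cong.unrestricted_iff {P Q : Proc D} (h : Cong P Q) :
    P.Unrestricted ↔ Q.Unrestricted := by
  induction h with
  | refl => rfl
  | symm _ ih => exact ih.symm
  | trans _ _ h₁ h₂ => exact h₁.trans h₂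
  | par_comm => exact and_comm
  | par_assoc => exact and_assoc.symm
  | par_nil => exact and_iff_left trivial
  | extrude P Q =>
    simp only [Proc.Unrestricted, Proc.fsc, Set.mem_union, P.zero_notMem_fsc_shift, false_or]
    rw [Proc.shift, Proc.unrestricted_ren]
    tauto
  | res_nil => simp [Proc.Unrestricted, Proc.fsc]
  | res h ih => simp only [Proc.Unrestricted, ih, h.fsc_eq]
  | _ => simp_all [Proc.Unrestricted]

theorem Proc.unrestricted_of_no_res {P : Proc D} (h : ∀ Q, ¬ Subterm (.res Q) P) :
    P.Unrestricted := by
  induction P with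
  | nil => trivial
  | par P Q hP hQ => exact ⟨hP fun R hR => h R hR.par_left, hQ fun R hR => h R hR.par_right⟩
  | res P _ => exact absurd .refl (h P)
  | rserv a P ih => exact ih fun R hR => h R hR.rserv
  | serv a P ih => exact ih fun R hR => h R hR.serv
  | req a P ih => exact ih fun R hR => h R hR.req
  | cond e P Q hP hQ => exact ⟨hP fun R hR => h R hR.cond_left, hQ fun R hR => h R hR.cond_right⟩
  | inp k P ih => exact ih fun R hR => h R hR.inp
  | out k e P ih => exact ih fun R hR => h R hR.out
  | inS k P ih => exact ih fun R hR => h R hR.inS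
  | del k k' P ih => exact ih fun R hR => h R hR.del
  | bra k I P ih => exact fun i => ih i fun R hR => h R (hR.bra i)
  | sel k l P ih => exact ih fun R hR => h R hR.sel

/-- The session types in a session typing; `fin` elsewhere. -/
def KEnv.strip (Δ : KEnv D) (k : ℕ) : SessT D :=
  match Δ k with
  | some (.ty α) => α
  | _ => .fin

theorem KEnv.strip_set (Δ : KEnv D) (k : ℕ) (α : SessT D) :
    (Δ.set k (.ty α)).strip = Function.update Δ.strip k α := by
  funext j
  by_cases h : j = k
  · subst h; simp [strip, set_self]
  · simp [strip, set_of_ne h, h]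

theorem KEnv.strip_cons (Δ : KEnv D) (α : SessT D) :
    KEnv.strip (cons (some (.ty α)) Δ) = cons α Δ.strip := by
  funext j
  cases j <;> rfl

theorem KEnv.strip_none : KEnv.strip (D := D) (fun _ => none) = fun _ => .fin := rfl

theorem KEnv.Ended.strip {Δ : KEnv D} (h : Δ.Ended) (k : ℕ) : Δ.strip k = .fin := by
  unfold KEnv.strip
  cases e : Δ k with
  | none => rfl
  | some u => rw [h k u e]

/-- Only mentioned channels must avoid `⊥`, since the rules can put `⊥` on unused finished ones. The
condition is inherited by all premises: binders of prefixes introduce session types, and a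
restricted channel is unused. -/
theorem Typed.sTyped {Γ : SEnv D} {P : Proc D} {Δ : KEnv D} (h : Typed Γ P Δ)
    (hu : P.Unrestricted) (hb : ∀ k ∈ P.fsc, Δ k ≠ some .bot) : P.STyped Γ Δ.strip := by
  have upd : ∀ {A : Set ℕ} {Δ : KEnv D} {k : ℕ} {α β : SessT D},
      (∀ j ∈ {k} ∪ A, Δ.set k (.ty β) j ≠ some .bot) → ∀ j ∈ A, Δ.set k (.ty α) j ≠ some .bot := by
    intro A Δ k α β h j hj
    have := h j (.inr hj)
    by_cases e : j = k
    · subst e; simp [KEnv.set_self]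
    · rwa [KEnv.set_of_ne e] at this ⊢
  have ext : ∀ {A : Set ℕ} {Δ : KEnv D} {α : SessT D}, (∀ j ∈ down A, Δ j ≠ some .bot) →
      ∀ j ∈ A, cons (some (.ty α)) Δ j ≠ some .bot := by
    intro A Δ α h j hj
    cases j with
    | zero => simp
    | succ j => exact h j hj
  have body : ∀ {Γ : SEnv D} {P : Proc D} {u : Option (Usage D)},
      Typed Γ P (cons u fun _ => none) → ∀ k, k + 1 ∉ P.fsc :=
    fun h k hk => h.ne_none hk rfl
  induction h with
  | serv ha h hd ih =>
    refine ⟨_, ha, hd.strip, body h, ?_⟩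
    rw [← KEnv.strip_none, ← KEnv.strip_cons]
    exact ih hu (ext fun _ _ => by simp)
  | rserv ha h hd ih =>
    refine ⟨_, ha, hd.strip, body h, ?_⟩
    rw [← KEnv.strip_none, ← KEnv.strip_cons]
    exact ih hu (ext fun _ _ => by simp)
  | req ha h ih =>
    refine ⟨_, ha, ?_⟩
    rw [← KEnv.strip_cons]
    exact ih hu (ext hb)
  | inp h ih =>
    refine ⟨_, _, by rw [KEnv.strip_set, Function.update_self], ?_⟩
    rw [KEnv.strip_set, Function.update_idem, ← KEnv.strip_set]
    exact ih hu (upd hb)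
  | out h he ih =>
    refine ⟨_, _, by rw [KEnv.strip_set, Function.update_self], he, ?_⟩
    rw [KEnv.strip_set, Function.update_idem, ← KEnv.strip_set]
    exact ih hu (upd hb)
  | inS h ih =>
    refine ⟨_, _, by rw [KEnv.strip_set, Function.update_self], ?_⟩
    rw [KEnv.strip_set, Function.update_idem, ← KEnv.strip_set, ← KEnv.strip_cons]
    exact ih hu (ext (upd hb))
  | @del Γ k k' β α P Δ hne hn h ih =>
    have hk' : k' ∉ P.fsc := fun hk => h.ne_none hk (by rw [KEnv.set_of_ne hne.symm, hn])
    refine ⟨_, _, by rw [KEnv.strip_set, KEnv.strip_set, Function.update_of_ne hne,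
      Function.update_self], by rw [KEnv.strip_set, Function.update_self], hne, hk', ?_⟩
    have e : Function.update (Function.update
        (KEnv.strip ((Δ.set k (.ty (.outSess β α))).set k' (.ty β))) k α) k' .fin =
        KEnv.strip (Δ.set k (.ty α)) := by
      funext j
      by_cases e : j = k'
      · subst e
        simp [KEnv.strip, KEnv.set_of_ne hne.symm, hn]
      · rw [Function.update_of_ne e, KEnv.strip_set, KEnv.strip_set, KEnv.strip_set]
        by_cases e' : j = k
        · subst e'; simp
        · simp [e, e']
    rw [e]
    refine ih hu (upd (β := .outSess β α) fun j hj => ?_)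
    by_cases e : j = k'
    · subst e
      rcases hj with hj | hj
      · exact absurd hj.symm hne
      · exact absurd hj hk'
    · have := hb j (by rcases hj with rfl | hj; exacts [.inl (.inl rfl), .inr hj])
      rwa [KEnv.set_of_ne e] at this
  | bra h ih =>
    refine ⟨_, _, by rw [KEnv.strip_set, Function.update_self], fun i => ?_⟩
    rw [KEnv.strip_set, Function.update_idem, ← KEnv.strip_set]
    exact ih i (hu i) fun j hj => upd hb j (Set.mem_iUnion.2 ⟨i, hj⟩)
  | sel hl h ih =>
    refine ⟨_, _, _, hl, by rw [KEnv.strip_set, Function.update_self], ?_⟩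
    rw [KEnv.strip_set, Function.update_idem, ← KEnv.strip_set]
    exact ih hu (upd hb)
  | @par Γ P Q Δ₁ Δ₂ h₁ h₂ hc ih₁ ih₂ =>
    -- A common channel becomes `⊥` in the composition, so neither side mentions it and its type is
    -- `fin` on both.
    have both : ∀ {k u₁ u₂}, Δ₁ k = some u₁ → Δ₂ k = some u₂ → k ∉ P.fsc ∧ k ∉ Q.fsc := by
      intro k u₁ u₂ e₁ e₂
      have : Δ₁.comp Δ₂ k = some .bot := by simp [KEnv.comp, e₁, e₂]
      exact ⟨fun h => hb k (.inl h) this, fun h => hb k (.inr h) this⟩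
    have hP := ih₁ hu.1 fun k hk e => by
      cases e₂ : Δ₂ k with
      | none => exact hb k (.inl hk) (by simp [KEnv.comp, e, e₂])
      | some u => exact (both e e₂).1 hk
    have hQ := ih₂ hu.2 fun k hk e => by
      cases e₁ : Δ₁ k with
      | none => exact hb k (.inr hk) (by simp [KEnv.comp, e, e₁])
      | some u => exact (both e₁ e).2 hk
    refine ⟨_, _, hP, hQ, fun k => ?_⟩
    cases e₁ : Δ₁ k with
    | none =>
      refine .inr ⟨?_, by simp [KEnv.strip, e₁], fun hk => h₁.ne_none hk e₁⟩
      simp [KEnv.strip, KEnv.comp, e₁]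
    | some u₁ =>
      cases e₂ : Δ₂ k with
      | none =>
        refine .inl ⟨?_, by simp [KEnv.strip, e₂], fun hk => h₂.ne_none hk e₂⟩
        simp [KEnv.strip, KEnv.comp, e₁, e₂]
      | some u₂ =>
        have hn := both e₁ e₂
        refine .inl ⟨?_, hQ.eq_fin hn.2, hn.2⟩
        rw [hP.eq_fin hn.1]
        simp [KEnv.strip, KEnv.comp, e₁, e₂]
  | nil h => exact h.strip
  | @res Γ P Δ h ih =>
    refine ⟨hu.1, ?_⟩
    have : KEnv.strip (cons (some .bot) Δ) = cons .fin (KEnv.strip Δ) := by funext j; cases j <;> rfl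
    rw [← this]
    refine ih hu.2 fun j hj => ?_
    cases j with
    | zero => exact absurd hj hu.1
    | succ j => exact hb j hj
  | cond he h₁ h₂ ih₁ ih₂ =>
    exact ⟨he, ih₁ hu.1 fun k hk => hb k (.inl hk), ih₂ hu.2 fun k hk => hb k (.inr hk)⟩
  | @bot Γ P k Δ h ih =>
    have hk : ∀ {j}, j ∈ P.fsc → j ≠ k := by
      rintro j hj rfl
      exact hb j hj (KEnv.set_self _ _ _)
    have : KEnv.strip (Δ.set k .bot) = KEnv.strip (Δ.set k (.ty .fin)) := by
      funext j
      by_cases e : j = k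
      · subst e; simp [KEnv.strip, KEnv.set_self]
      · simp [KEnv.strip, KEnv.set_of_ne e]
    rw [this]
    refine ih hu fun j hj => ?_
    have := hb j hj
    rwa [KEnv.set_of_ne (hk hj)] at this ⊢

/-! #### From running processes to typing -/

open Classical in
/-- The session typing with domain `S`. -/
noncomputable def restrict (S : Set ℕ) (Δ : ℕ → Usage D) : KEnv D :=
  fun k => if k ∈ S then some (Δ k) else none

theorem restrict_of_mem {S : Set ℕ} {Δ : ℕ → Usage D} {k : ℕ} (h : k ∈ S) :
    restrict S Δ k = some (Δ k) := if_pos h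

theorem restrict_of_notMem {S : Set ℕ} {Δ : ℕ → Usage D} {k : ℕ} (h : k ∉ S) :
    restrict S Δ k = none := if_neg h

theorem set_restrict {S : Set ℕ} {Δ : ℕ → Usage D} {k : ℕ} (h : k ∈ S) (u : Usage D) :
    (restrict S Δ).set k u = restrict S (Function.update Δ k u) := by
  funext j
  by_cases e : j = k
  · subst e; simp [KEnv.set_self, restrict, h]
  · simp [KEnv.set_of_ne e, restrict, e]

theorem cons_restrict {S : Set ℕ} {Δ : ℕ → Usage D} (u : Usage D) :
    cons (some u) (restrict S Δ) = restrict (insert 0 (up S)) (cons u Δ) := by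
  funext j
  cases j with
  | zero => rw [restrict_of_mem (Set.mem_insert 0 _)]; rfl
  | succ j =>
    have : j + 1 ∈ insert 0 (up S) ↔ j ∈ S := by
      rw [Set.mem_insert_iff, succ_mem_up]; simp
    by_cases hj : j ∈ S
    · rw [restrict_of_mem (this.2 hj)]; exact restrict_of_mem hj
    · rw [restrict_of_notMem (this.not.2 hj)]; exact restrict_of_notMem hj

/-- The typing rule relaxes one channel at a time; finiteness of the domain bounds the number of
uses. -/
theorem Typed.bot_of_finite {Γ : SEnv D} {P : Proc D} {S : Set ℕ} {Δ Δ' : ℕ → Usage D}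
    (hS : S.Finite) (h : Typed Γ P (restrict S Δ)) (hle : ∀ k, (Δ k).Le (Δ' k)) :
    Typed Γ P (restrict S Δ') := by
  classical
  have key : ∀ F : Set ℕ, F.Finite → F ⊆ {k | Δ k ≠ Δ' k} → F ⊆ S →
      Typed Γ P (restrict S fun k => if k ∈ F then Δ' k else Δ k) := by
    intro F hF
    induction F, hF using Set.Finite.induction_on with
    | empty => intro _ _; simpa using h
    | @insert a F ha _ ih =>
      intro h₁ h₂
      have ih := ih ((Set.subset_insert _ _).trans h₁) ((Set.subset_insert _ _).trans h₂)
      have haS : a ∈ S := h₂ (.inl rfl)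
      have hne : Δ a ≠ Δ' a := h₁ (.inl rfl)
      obtain ⟨hf, hb⟩ := (hle a).resolve_left fun e => hne e.symm
      convert Typed.bot (k := a) (Δ := restrict S fun k => if k ∈ F then Δ' k else Δ k) ?_ using 1
      · rw [set_restrict haS]
        congr 1
        funext k
        by_cases e : k = a
        · subst e; simp [hb]
        · simp [e]
      · rw [set_restrict haS]
        convert ih using 2
        funext k
        by_cases e : k = a
        · subst e; simp [ha, hf]
        · simp [e]
  convert key (S ∩ {k | Δ k ≠ Δ' k}) (hS.inter_of_left _) Set.inter_subset_right
    Set.inter_subset_left using 1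
  funext k
  by_cases hk : k ∈ S <;> by_cases e : Δ k = Δ' k <;> simp [restrict, hk, e]

theorem restrict_comp {S S₁ S₂ : Set ℕ} {Δ Δ₁ Δ₂ : ℕ → Usage D}
    (h : ∀ k, (k ∈ S₁ ∧ k ∉ S₂ ∧ k ∈ S ∧ Δ₁ k = Δ k) ∨ (k ∈ S₂ ∧ k ∉ S₁ ∧ k ∈ S ∧ Δ₂ k = Δ k) ∨
      (k ∉ S₁ ∧ k ∉ S₂ ∧ k ∉ S) ∨ (k ∈ S₁ ∧ k ∈ S₂ ∧ k ∈ S ∧ Δ k = .bot)) :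
    (restrict S₁ Δ₁).comp (restrict S₂ Δ₂) = restrict S Δ := by
  funext k
  rcases h k with h | h | h | h <;> simp [restrict, KEnv.comp, h]

/-- The domain may be any superset of the free channels. This freedom is needed because binders
enlarge it, parallel composition divides it, and services and delegation shrink it. -/
theorem Proc.STyped.typed {P : Proc D} {Γ : SEnv D} {Δ : ℕ → SessT D} (h : P.STyped Γ Δ)
    {S : Set ℕ} (hS : P.fsc ⊆ S) : Typed Γ P (restrict S fun k => .ty (Δ k)) := by
  have upd : ∀ {S : Set ℕ} {Δ : ℕ → SessT D} {k : ℕ} {α : SessT D}, k ∈ S →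
      restrict S (fun j => .ty (Function.update Δ k α j)) =
        (restrict S fun j => .ty (Δ j)).set k (.ty α) := by
    intro S Δ k α hk
    rw [set_restrict hk]
    congr 1
    funext j
    by_cases e : j = k
    · subst e; simp
    · simp [e]
  have self : ∀ {S : Set ℕ} {Δ : ℕ → SessT D} {k : ℕ} {α : SessT D}, k ∈ S → Δ k = α →
      (restrict S fun j => .ty (Δ j)) = (restrict S fun j => .ty (Δ j)).set k (.ty α) := by
    rintro S Δ k α hk rfl
    rw [← upd hk, Function.update_eq_self]
  have ext : ∀ {S : Set ℕ} {Δ : ℕ → SessT D} {α : SessT D},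
      restrict (insert 0 (up S)) (fun k => .ty (cons α Δ k)) =
        cons (some (.ty α)) (restrict S fun k => .ty (Δ k)) := by
    intro S Δ α
    rw [cons_restrict]
    congr 1
    funext k
    cases k <;> rfl
  have sub : ∀ {A S : Set ℕ}, down A ⊆ S → A ⊆ insert 0 (up S) := by
    intro A S h k hk
    cases k with
    | zero => exact .inl rfl
    | succ k => exact .inr (succ_mem_up.2 (h hk))
  have ended : ∀ {S : Set ℕ} {Δ : ℕ → SessT D}, (∀ k, Δ k = .fin) →
      KEnv.Ended (restrict S fun k => .ty (Δ k)) := by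
    intro S Δ h k u hu
    by_cases hk : k ∈ S
    · rw [restrict_of_mem hk, h k, Option.some.injEq] at hu
      exact hu.symm
    · rw [restrict_of_notMem hk] at hu
      cases hu
  have serv : ∀ {Δ : ℕ → SessT D} {α : SessT D}, restrict (insert 0 (up ∅))
      (fun k => .ty (cons α (fun _ => .fin) k)) = cons (some (.ty α)) fun _ => none := by
    intro Δ α
    rw [ext]
    congr 1
    funext k
    exact restrict_of_notMem id
  induction P generalizing Γ Δ S with
  | nil => exact .nil (ended h)
  | par P Q hP hQ =>
    obtain ⟨Δ₁, Δ₂, h₁, h₂, ha⟩ := h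
    -- The domain is partitioned into the channels owned by `P` and the others, so that the
    -- composition creates no `⊥`.
    let A : Set ℕ := {k | Δ₁ k = Δ k ∧ Δ₂ k = .fin ∧ k ∉ Q.fsc}
    have e₁ : P.fsc ⊆ S ∩ A := fun k hk =>
      ⟨hS (.inl hk), (ha k).resolve_right fun h => h.2.2 hk⟩
    have e₂ : Q.fsc ⊆ S \ A := fun k hk => ⟨hS (.inr hk), fun h => h.2.2 hk⟩
    rw [← restrict_comp (S₁ := S ∩ A) (S₂ := S \ A) (Δ₁ := fun k => .ty (Δ₁ k))
      (Δ₂ := fun k => .ty (Δ₂ k))]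
    · refine .par (hP h₁ e₁) (hQ h₂ e₂) fun k u₁ u₂ h₁ h₂ => ?_
      by_cases hk : k ∈ A
      · rw [restrict_of_notMem fun h => h.2 hk] at h₂
        cases h₂
      · rw [restrict_of_notMem fun h => hk h.2] at h₁
        cases h₁
    · intro k
      by_cases hk : k ∈ S
      · by_cases hA : k ∈ A
        · exact .inl ⟨⟨hk, hA⟩, fun h => h.2 hA, hk, congrArg _ hA.1⟩
        · exact .inr (.inl ⟨⟨hk, hA⟩, fun h => hA h.2, hk,
            congrArg _ ((ha k).resolve_left hA).1⟩)
      · exact .inr (.inr (.inl ⟨fun h => hk h.1, fun h => hk h.1, hk⟩))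
  | res P ih =>
    refine .res ?_
    have := ih h.2 (sub hS)
    rw [ext] at this
    convert Typed.bot (k := 0) (Δ := cons none (restrict S fun k => .ty (Δ k))) ?_ using 1
    · funext j; cases j <;> simp [KEnv.set]
    · convert this using 1
      funext j; cases j <;> simp [KEnv.set]
  | rserv a P ih =>
    obtain ⟨α, ha, hf, hP, h⟩ := h
    have := ih h (sub (S := ∅) fun k hk => absurd hk (hP k))
    rw [serv (Δ := Δ)] at this
    exact .rserv ha this (ended hf)
  | serv a P ih =>
    obtain ⟨α, ha, hf, hP, h⟩ := h
    have := ih h (sub (S := ∅) fun k hk => absurd hk (hP k))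
    rw [serv (Δ := Δ)] at this
    exact .serv ha this (ended hf)
  | req a P ih =>
    obtain ⟨α, ha, h⟩ := h
    have := ih h (sub hS)
    rw [ext] at this
    exact .req ha this
  | cond e P Q hP hQ =>
    exact .cond h.1 (hP h.2.1 fun k hk => hS (.inl hk)) (hQ h.2.2 fun k hk => hS (.inr hk))
  | inp k P ih =>
    obtain ⟨T, α, e, h⟩ := h
    have := ih h fun k hk => hS (.inr hk)
    rw [upd (hS (.inl rfl))] at this
    rw [self (hS (.inl rfl)) e]
    exact .inp this
  | out k E P ih =>
    obtain ⟨T, α, e, hE, h⟩ := h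
    have := ih h fun k hk => hS (.inr hk)
    rw [upd (hS (.inl rfl))] at this
    rw [self (hS (.inl rfl)) e]
    exact .out this hE
  | inS k P ih =>
    obtain ⟨β, α, e, h⟩ := h
    have := ih h (sub fun k hk => hS (.inr hk))
    rw [ext, upd (hS (.inl rfl))] at this
    rw [self (hS (.inl rfl)) e]
    exact .inS this
  | del k k' P ih =>
    obtain ⟨β, α, e, e', hne, hk', h⟩ := h
    have hk : k ∈ S \ {k'} := ⟨hS (.inl (.inl rfl)), hne⟩
    -- The delegated channel must be absent from the session typing of the continuation, not merely
    -- finished.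
    have := ih h (S := S \ {k'}) fun j hj => ⟨hS (.inr hj), by rintro rfl; exact hk' hj⟩
    have e₁ : restrict (S \ {k'}) (fun j => .ty (Function.update (Function.update Δ k α) k' .fin j)) =
        (restrict (S \ {k'}) fun j => .ty (Δ j)).set k (.ty α) := by
      rw [← upd hk]
      funext j
      by_cases e : j = k'
      · subst e; simp [restrict]
      · simp [restrict, e]
    rw [e₁] at this
    have := Typed.del (k' := k') (β := β) hne (restrict_of_notMem fun h => h.2 rfl) this
    convert this using 1
    funext j
    by_cases hj : j = k'
    · subst hj
      rw [KEnv.set_self, restrict_of_mem (hS (.inl (.inr rfl))), e']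
    · have : j ∈ S \ {k'} ↔ j ∈ S := ⟨fun h => h.1, fun h => ⟨h, hj⟩⟩
      rw [KEnv.set_of_ne hj, ← self hk e]
      by_cases hS : j ∈ S
      · rw [restrict_of_mem hS, restrict_of_mem (this.2 hS)]
      · rw [restrict_of_notMem hS, restrict_of_notMem (this.not.2 hS)]
  | bra k I P ih =>
    obtain ⟨hI, α, e, h⟩ := h
    have := fun i => ih i (h i) fun k hk => hS (.inr (Set.mem_iUnion.2 ⟨i, hk⟩))
    simp only [upd (hS (.inl rfl))] at this
    rw [self (hS (.inl rfl)) e]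
    exact .bra this
  | sel k l P ih =>
    obtain ⟨I, hI, α, hl, e, h⟩ := h
    have := ih h fun k hk => hS (.inr hk)
    rw [upd (hS (.inl rfl))] at this
    rw [self (hS (.inl rfl)) e]
    exact .sel hl this

theorem Proc.Leaf.typed {P : Proc D} {Γ : SEnv D} {Δ : ℕ → Usage D} (h : P.Leaf Γ Δ)
    {S : Set ℕ} (hf : S.Finite) (hS : P.fsc ⊆ S) : Typed Γ P (restrict S Δ) := by
  obtain ⟨Δ₀, h₀, h₁⟩ := h
  exact (h₀.typed hS).bot_of_finite hf h₁

theorem Proc.RTyped.typed {P : Proc D} {Γ : SEnv D} {Δ : ℕ → Usage D} (h : P.RTyped Γ Δ)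
    {S : Set ℕ} (hf : S.Finite) (hS : P.fsc ⊆ S) : Typed Γ P (restrict S Δ) := by
  induction P generalizing Δ S with
  | par P Q hP hQ =>
    obtain ⟨Δ₁, Δ₂, h₁, h₂, hs⟩ := h
    -- `A` is owned by `P` and `B` by `Q`, with overlaps assigned to `P`. The remaining channels of
    -- `S` enter both domains, where the two ends are dual and compose to `⊥`.
    let A : Set ℕ := {k | Δ₁ k = Δ k ∧ Δ₂ k = .ty .fin ∧ k ∉ Q.fsc}
    let B : Set ℕ := {k | Δ₂ k = Δ k ∧ Δ₁ k = .ty .fin ∧ k ∉ P.fsc}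
    have e₁ : P.fsc ⊆ S \ (B \ A) := fun k hk => ⟨hS (.inl hk), fun h => h.1.2.2 hk⟩
    have e₂ : Q.fsc ⊆ S \ A := fun k hk => ⟨hS (.inr hk), fun h => h.2.2 hk⟩
    rw [← restrict_comp (S₁ := S \ (B \ A)) (S₂ := S \ A) (Δ₁ := Δ₁) (Δ₂ := Δ₂)]
    · refine .par (hP h₁ (hf.subset Set.sdiff_subset) e₁) (hQ h₂ (hf.subset Set.sdiff_subset) e₂)
        fun k u₁ u₂ h₁ h₂ => ?_
      by_cases hk₁ : k ∈ S \ (B \ A)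
      · by_cases hk₂ : k ∈ S \ A
        · rw [restrict_of_mem hk₁] at h₁
          rw [restrict_of_mem hk₂] at h₂
          cases h₁
          cases h₂
          rcases hs k with h | h | ⟨-, h⟩
          · exact absurd h hk₂.2
          · exact absurd ⟨h, hk₂.2⟩ hk₁.2
          · exact h
        · rw [restrict_of_notMem hk₂] at h₂
          cases h₂
      · rw [restrict_of_notMem hk₁] at h₁
        cases h₁
    · intro k
      by_cases hk : k ∈ S
      · by_cases hA : k ∈ A
        · exact .inl ⟨⟨hk, fun h => h.2 hA⟩, fun h => h.2 hA, hk, hA.1⟩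
        · by_cases hB : k ∈ B
          · exact .inr (.inl ⟨⟨hk, hA⟩, fun h => h.2 ⟨hB, hA⟩, hk, hB.1⟩)
          · refine .inr (.inr (.inr ⟨⟨hk, fun h => hB h.1⟩, ⟨hk, hA⟩, hk, ?_⟩))
            exact (((hs k).resolve_left hA).resolve_left hB).1
      · exact .inr (.inr (.inl ⟨fun h => hk h.1, fun h => hk h.1, hk⟩))
  | res P ih =>
    refine .res ?_
    rw [cons_restrict]
    refine ih h ((hf.image _).insert 0) fun k hk => ?_
    cases k with
    | zero => exact .inl rfl
    | succ k => exact .inr (succ_mem_up.2 (hS hk))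
  | _ => exact Leaf.typed h hf hS

theorem Safe.wellTyped {P : Proc D} (h : Safe P) : WellTyped P := by
  obtain ⟨Γ, Δ, hΓ, -, hs, hP, -⟩ := h
  refine ⟨Γ, restrict P.fsc Δ, hΓ, P.finite_fsc.subset fun k hk => ?_, hs,
    hP.typed P.finite_fsc subset_rfl⟩
  by_contra h
  exact hk (restrict_of_notMem h)

theorem IsProgram.exists_sTyped {P : Proc D} (hp : IsProgram P) {Γ : SEnv D} {Δ : KEnv D}
    (h : Typed Γ P Δ) : ∃ Δ', P.STyped Γ Δ' := by
  obtain ⟨hf, P', hc, hr⟩ := hp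
  exact ⟨_, h.sTyped (hc.unrestricted_iff.2 (Proc.unrestricted_of_no_res hr)) (by simp [hf])⟩

theorem Proc.STyped.safe {P : Proc D} {Γ : SEnv D} {Δ : ℕ → SessT D}
    (hΓ : {a | Γ a ≠ none}.Finite) (hs : Γ.Services) (h : P.STyped Γ Δ) : Safe P := by
  refine ⟨Γ, _, hΓ, P.finite_fsc.subset fun k hk => ?_, hs, Leaf.rTyped ⟨Δ, h, fun _ => .refl _⟩,
    h.forest.1, ?_⟩
  · by_contra hn
    exact hk (congrArg _ (h.eq_fin hn))
  · have := h.forest.2 (N := 0) (forest_cons.2 ⟨forest_zero, fun T hT => ?_⟩)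
    · simpa using this
    · rw [Multiset.le_zero.1 hT]
      exact hasLeaf_cons.2 (.inl (by simp))

/-- Safety survives reduction, congruence and removal of a reduction context, and the reduct with
the partner is safe again. So `Safe` is contained in the greatest predicate closed under progress
steps. -/
theorem Safe.progressStep {P : Proc D} (h : Safe P) : ProgressStep Safe P := by
  intro P' hred E P'' hc hlive
  have hP' : Safe P' := by
    clear hc
    induction hred with
    | refl => exact h
    | tail _ hr ih => exact ih.red hr
  have hP'' := (hP'.cong hc).of_plug
  obtain ⟨Q, hw, hsafe, R, hR⟩ := hP''.exists_reduces fun hw => Proc.not_live_of_weight hw _ hlive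
  exact ⟨Q, R, fun Q' hr => absurd hr.two_le_weight (by omega), hsafe.wellTyped, hR, hsafe.red hR⟩

end SessPi

theorem mainTheorem4 (D : SessPi.DataAlgebra) (P : SessPi.Proc D)
    (hprog : SessPi.IsProgram P) (hty : SessPi.WellTyped P) :
    SessPi.Transparent P ∧ SessPi.HasProgress P := by
  obtain ⟨Γ, Δ, hΓ, -, hs, h⟩ := hty
  obtain ⟨Δ', h'⟩ := hprog.exists_sTyped h
  exact ⟨h'.transparent, SessPi.Safe, h'.safe hΓ hs, fun R hR => hR.progressStep⟩
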